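/- Let $n\ge 0$ and $\lambda\in\mathbb R\setminus\{0\}$. Write points of $\mathbb R^{2n}$ as $\xi=(x,u)$, $\eta=(a,b)$ with $x,u,a,b\in\mathbb R^n$, let $[(x,u),(y,v)]=u\cdot y-x\cdot v$, and define on $\mathcal S(\mathbb R^{2n})$ the twisted translations and twisted modulations $$\tau_\lambda(\xi)g(t)=g(t-\xi)\,e^{-i\frac{\lambda}{2}[t,\xi]},\qquad e_\lambda(a,b)g(x,u)=g\big(x-(\tanh\tfrac{\lambda}{2})b,\;u+(\tanh\tfrac{\lambda}{2})a\big)\,e^{-i\frac{\lambda}{2}(\coth\frac{\lambda}{2})(x\cdot a+u\cdot b)},$$ and $\Pi_\lambda(\xi,\eta)=e^{i\frac{\lambda}{2}(\coth\lambda)\,\xi\cdot\eta}\,e_\lambda(\eta)\,\tau_\lambda(\xi)$. For $f\in\mathcal S'(\mathbb R^{2n})$ and $g\in\mathcal S(\mathbb R^{2n})$ put $V_gf(\xi,\eta)=\langle f,\Pi_\lambda(\xi,\eta)g\rangle$, where $\langle f,\varphi\rangle=f(\overline{\varphi})$. For $1\le p,q\le\infty$ let $L^{p,q}(\mathbb R^{2n}\times\mathbb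 R^{2n})$ be the space of measurable functions $F$ with finite norm $$\|F\|_{p,q}=\Big(\int_{\mathbb R^{2n}}\Big(\int_{\mathbb R^{2n}}|F(\xi,\eta)|^p\,d\xi\Big)^{q/p}d\eta\Big)^{1/q}$$ (essential suprema if $p=\infty$ or $q=\infty$). The twisted modulation space $M_\lambda^{p,q}(\mathbb R^{2n})$ is the set of all tempered distributions $f$ on $\mathbb R^{2n}$ with $V_gf\in L^{p,q}(\mathbb R^{2n}\times\mathbb R^{2n})$ for some nonzero $g\in\mathcal S(\mathbb R^{2n})$. (i) For $1\le p,q\le\infty$, $M_\lambda^{p,q}(\mathbb R^{2n})$ is a linear subspace of $\mathcal S'(\mathbb R^{2n})$, and for every nonzero $g\in\mathcal S(\mathbb R^{2n})$ the expression $\|f\|_{(p,q)}=\|V_gf\|_{p,q}$ is a (finite) norm on it which makes it a Banach space. (ii) Let $1\le p,q<\infty$, $\frac1p+\frac1{p'}=1$, $\frac1q+\frac1{q'}=1$, and let $0\ne g\in\mathcal S(\mathbb R^{2n})$. Then $\mathcal S(\mathbb R^{2n})$ is contained and dense in $M_\lambda^{p,q}(\mathbb R^{2n})$, and the dual of $M_\lambda^{p,q}(\mathbb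 R^{2n})$ is $M_\lambda^{p',q'}(\mathbb R^{2n})$ under the pairing $$\langle f,h\rangle_\lambda=\int_{\mathbb R^{2n}}\int_{\mathbb R^{2n}}V_gf(\xi,\eta)\,\overline{V_gh(\xi,\eta)}\,d\xi\,d\eta .$$ That is: for $h\in M_\lambda^{p',q'}(\mathbb R^{2n})$ the integral converges absolutely and $f\mapsto\langle f,h\rangle_\lambda$ is a linear functional on $M_\lambda^{p,q}(\mathbb R^{2n})$ with $|\langle f,h\rangle_\lambda|\le\|V_gf\|_{p,q}\|V_gh\|_{p',q'}$; every bounded linear functional on $M_\lambda^{p,q}(\mathbb R^{2n})$ has this form for exactly one $h\in M_\lambda^{p',q'}(\mathbb R^{2n})$; and the norm of the functional is equivalent to $\|V_gh\|_{p',q'}$. (iii) If $1\le p_1\le p_2\le\infty$ and $1\le q_1\le q_2\le\infty$, then $M_\lambda^{p_1,q_1}(\mathbb R^{2n})\subseteq M_\lambda^{p_2,q_2}(\mathbb R^{2n})$. -/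

import Mathlib

open MeasureTheory
open scoped SchwartzMap ENNReal ComplexConjugate

noncomputable section

namespace TwistedMod

/-- The space `ℝ²ⁿ`, with Euclidean norm and Lebesgue measure. A point is `ξ = (x, u)` with
`x j = ξ (Sum.inl j)` and `u j = ξ (Sum.inr j)`. -/
abbrev Space (n : ℕ) := EuclideanSpace ℝ (Fin n ⊕ Fin n)

/-- The (bilinear) symplectic form `[(x, u), (y, v)] = u · y - x · v` on `R²ⁿ`, used for `R = ℝ`
and `R = ℂ`. -/
def symp {R : Type*} [CommRing R] {n : ℕ} (ζ ζ' : Fin n ⊕ Fin n → R) : R :=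
  ∑ j : Fin n, (ζ (Sum.inr j) * ζ' (Sum.inl j) - ζ (Sum.inl j) * ζ' (Sum.inr j))

/-- The (bilinear) dot product on `R²ⁿ`. -/
def dot {R : Type*} [CommRing R] {n : ℕ} (ζ ζ' : Fin n ⊕ Fin n → R) : R :=
  ∑ j : Fin n, (ζ (Sum.inl j) * ζ' (Sum.inl j) + ζ (Sum.inr j) * ζ' (Sum.inr j))

/-- The rotation `(a, b) ↦ (-b, a)` of `ℝ²ⁿ`. -/
def rot {n : ℕ} (η : Space n) : Space n :=
  WithLp.toLp 2 (Sum.elim (fun j => -η (Sum.inr j)) (fun j => η (Sum.inl j)))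

/-- The hyperbolic cotangent (used only at nonzero arguments). -/
def coth (t : ℝ) : ℝ := Real.cosh t / Real.sinh t

/-! ### Twisted translations and twisted modulations of Schwartz functions -/

theorem hasTemperateGrowth_cexp_I :
    (fun t : ℝ => Complex.exp (Complex.I * t)).HasTemperateGrowth := by
  have hs : ∀ k : ℕ, iteratedDeriv k (fun t : ℝ => Complex.exp (Complex.I * t)) =
      fun t : ℝ => Complex.I ^ k * Complex.exp (Complex.I * t) := by
    intro k
    induction k with
    | zero => simp
    | succ k ih =>
      rw [iteratedDeriv_succ, ih]
      funext t
      have h1 : HasDerivAt (fun t : ℝ => Complex.I * (t : ℂ)) (Complex.I * 1) t :=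
        (Complex.ofRealCLM.hasDerivAt (x := t)).const_mul Complex.I
      have := (h1.cexp.const_mul (Complex.I ^ k)).deriv
      rw [this]
      ring
  refine ⟨(contDiff_const.mul Complex.ofRealCLM.contDiff).cexp, fun k => ⟨0, 1, fun t => ?_⟩⟩
  rw [norm_iteratedFDeriv_eq_norm_iteratedDeriv, hs k]
  have : ‖Complex.exp (Complex.I * t)‖ = 1 := by
    rw [mul_comm]; exact Complex.norm_exp_ofReal_mul_I t
  simp [this]

theorem hasTemperateGrowth_cexp_I_clm {n : ℕ} (L : Space n →L[ℝ] ℝ) :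
    (fun ξ : Space n => Complex.exp (Complex.I * (L ξ : ℝ))).HasTemperateGrowth :=
  hasTemperateGrowth_cexp_I.comp L.hasTemperateGrowth

/-- `ξ ↦ [ξ, η]` as a continuous linear map. -/
def sympCLM {n : ℕ} (η : Space n) : Space n →L[ℝ] ℝ :=
  LinearMap.toContinuousLinearMap
    { toFun := fun ξ => symp ξ η
      map_add' := fun a b => by
        simp only [symp, PiLp.add_apply, ← Finset.sum_add_distrib]
        exact Finset.sum_congr rfl fun j _ => by ring
      map_smul' := fun c a => by
        simp only [symp, PiLp.smul_apply, smul_eq_mul, RingHom.id_apply, Finset.mul_sum]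
        exact Finset.sum_congr rfl fun j _ => by ring }

/-- `ξ ↦ ξ · η` as a continuous linear map. -/
def dotCLM {n : ℕ} (η : Space n) : Space n →L[ℝ] ℝ :=
  LinearMap.toContinuousLinearMap
    { toFun := fun ξ => dot ξ η
      map_add' := fun a b => by
        simp only [dot, PiLp.add_apply, ← Finset.sum_add_distrib]
        exact Finset.sum_congr rfl fun j _ => by ring
      map_smul' := fun c a => by
        simp only [dot, PiLp.smul_apply, smul_eq_mul, RingHom.id_apply, Finset.mul_sum]
        exact Finset.sum_congr rfl fun j _ => by ring }

/-- The `λ`-twisted translation `τ_λ(ξ)` on Schwartz functions,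
`τ_λ(ξ) g (t) = g (t - ξ) exp (-i (λ/2) [t, ξ])`; see `twistedTranslation_apply`. -/
def twistedTranslation {n : ℕ} (lam : ℝ) (ξ : Space n) : 𝓢(Space n, ℂ) →L[ℂ] 𝓢(Space n, ℂ) :=
  SchwartzMap.smulLeftCLM ℂ
      (fun t : Space n => Complex.exp (Complex.I * ((-(lam / 2) * symp t ξ : ℝ) : ℂ))) ∘L
    SchwartzMap.compSubConstCLM ℂ ξ

/-- The `λ`-twisted modulation `e_λ(η)` on Schwartz functions, for `η = (a, b)`,
`e_λ(a, b) g (x, u) = g (x - tanh (λ/2) b, u + tanh (λ/2) a)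
  exp (-i (λ/2) coth (λ/2) (x · a + u · b))`; see `twistedModulation_apply`. -/
def twistedModulation {n : ℕ} (lam : ℝ) (η : Space n) : 𝓢(Space n, ℂ) →L[ℂ] 𝓢(Space n, ℂ) :=
  SchwartzMap.smulLeftCLM ℂ
      (fun t : Space n =>
        Complex.exp (Complex.I * ((-(lam / 2 * coth (lam / 2)) * dot t η : ℝ) : ℂ))) ∘L
    SchwartzMap.compSubConstCLM ℂ (-(Real.tanh (lam / 2) • rot η))

/-- The operators `Π_λ(ξ, η) = exp (i (λ/2) coth λ (ξ · η)) e_λ(η) τ_λ(ξ)`. These are the operators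
of the (projective) unitary representation of `ℂ²ⁿ` on `L²(ℝ²ⁿ)` that the twisted Bargmann transform
carries to the standard representation on the twisted Fock space, see `bargmann_twistedRep`. -/
def twistedRep {n : ℕ} (lam : ℝ) (ξ η : Space n) : 𝓢(Space n, ℂ) →L[ℂ] 𝓢(Space n, ℂ) :=
  Complex.exp (Complex.I * ((lam / 2 * coth lam * dot ξ η : ℝ) : ℂ)) •
    (twistedModulation lam η ∘L twistedTranslation lam ξ)

theorem twistedTranslation_apply {n : ℕ} (lam : ℝ) (ξ : Space n) (g : 𝓢(Space n, ℂ))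
    (t : Space n) :
    twistedTranslation lam ξ g t =
      Complex.exp (Complex.I * ((-(lam / 2) * symp t ξ : ℝ) : ℂ)) * g (t - ξ) := by
  have h := hasTemperateGrowth_cexp_I_clm ((-(lam / 2)) • sympCLM ξ)
  simp only [twistedTranslation, ContinuousLinearMap.comp_apply]
  erw [SchwartzMap.smulLeftCLM_apply_apply h]
  rfl

theorem twistedModulation_apply {n : ℕ} (lam : ℝ) (η : Space n) (g : 𝓢(Space n, ℂ))
    (t : Space n) :
    twistedModulation lam η g t =
      Complex.exp (Complex.I * ((-(lam / 2 * coth (lam / 2)) * dot t η : ℝ) : ℂ)) *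
        g (t + Real.tanh (lam / 2) • rot η) := by
  have h := hasTemperateGrowth_cexp_I_clm ((-(lam / 2 * coth (lam / 2))) • dotCLM η)
  simp only [twistedModulation, ContinuousLinearMap.comp_apply]
  erw [SchwartzMap.smulLeftCLM_apply_apply h]
  rw [SchwartzMap.compSubConstCLM_apply, sub_neg_eq_add]
  rfl

/-! ### The twisted Bargmann transform -/

/-- The (holomorphic extension to `ℂ²ⁿ` of the) heat kernel `p_t^λ` of the special Hermite
operator, `p_t^λ(ζ) = (4π)⁻ⁿ (λ / sinh (tλ))ⁿ exp (-(λ/4) coth (tλ) ζ · ζ)`. -/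
def heatKernel {n : ℕ} (lam t : ℝ) (ζ : Fin n ⊕ Fin n → ℂ) : ℂ :=
  (((4 * Real.pi) ^ n)⁻¹ * (lam / Real.sinh (t * lam)) ^ n : ℝ) *
    Complex.exp (-((lam / 4 * coth (t * lam) : ℝ) : ℂ) * dot ζ ζ)

/-- The twisted Bargmann transform `B_λ f(ζ) = c_λ p_1^λ(ζ)⁻¹ (f ∗_λ p_{1/2}^λ)(ζ)`, where
`c_λ = p_1^λ(0)` and `∗_λ` is the twisted convolution. -/
def bargmann {n : ℕ} (lam : ℝ) (f : Space n → ℂ) (ζ : Fin n ⊕ Fin n → ℂ) : ℂ :=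
  heatKernel lam 1 (0 : Fin n ⊕ Fin n → ℂ) * (heatKernel lam 1 ζ)⁻¹ *
    ∫ t : Space n, f t * (heatKernel lam (1 / 2) (fun j => ζ j - (t j : ℂ)) *
      Complex.exp (-Complex.I * (lam / 2 : ℝ) * symp ζ (fun j => (t j : ℂ))))

/-- The operators `ρ_λ(ζ')` on the twisted Fock space. -/
def fockRep {n : ℕ} (lam : ℝ) (ζ' : Fin n ⊕ Fin n → ℂ) (F : (Fin n ⊕ Fin n → ℂ) → ℂ)
    (ζ : Fin n ⊕ Fin n → ℂ) : ℂ :=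
  F (ζ - ζ') * Complex.exp ((lam / 2 * coth lam : ℝ) * dot ζ (star ζ')) *
    Complex.exp (-Complex.I * (lam / 2 : ℝ) * symp ζ (star ζ')) *
    Complex.exp (-(lam / 4 * coth lam : ℝ) * dot ζ' (star ζ')) *
    Complex.exp ((lam / 2 * symp (fun j => (ζ' j).re) (fun j => (ζ' j).im) : ℝ) : ℂ)

theorem twistedRep_apply {n : ℕ} (lam : ℝ) (ξ η : Space n) (g : 𝓢(Space n, ℂ)) (t : Space n) :
    twistedRep lam ξ η g t =
      Complex.exp (Complex.I * ((lam / 2 * coth lam * dot ξ η : ℝ) : ℂ)) *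
      (Complex.exp (Complex.I * ((-(lam / 2 * coth (lam / 2)) * dot t η : ℝ) : ℂ)) *
      (Complex.exp (Complex.I *
        ((-(lam / 2) * symp (t + Real.tanh (lam / 2) • rot η) ξ : ℝ) : ℂ)) *
        g (t + Real.tanh (lam / 2) • rot η - ξ))) := by
  rw [← twistedTranslation_apply, ← twistedModulation_apply]
  rfl

/-- On Schwartz functions `B_λ ∘ Π_λ(ξ, η) = ρ_λ(ξ + iη) ∘ B_λ`. -/
theorem bargmann_twistedRep {n : ℕ} {lam : ℝ} (hlam : lam ≠ 0) (ξ η : Space n)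
    (g : 𝓢(Space n, ℂ)) (ζ : Fin n ⊕ Fin n → ℂ) :
    bargmann lam (twistedRep lam ξ η g) ζ =
      fockRep lam (fun j => (ξ j : ℂ) + Complex.I * (η j : ℂ)) (bargmann lam g) ζ := by
  have hS : Real.sinh (lam / 2) ≠ 0 := by
    rw [Ne, Real.sinh_eq_zero]
    exact div_ne_zero hlam two_ne_zero
  have hCh : Real.cosh (lam / 2) ≠ 0 := (Real.cosh_pos _).ne'
  obtain ⟨C, hC⟩ : ∃ C : ℝ, C = coth (lam / 2) := ⟨_, rfl⟩
  have hC0 : C ≠ 0 := by rw [hC]; exact div_ne_zero hCh hS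
  have hT : Real.tanh (lam / 2) = C⁻¹ := by rw [hC, coth, Real.tanh_eq_sinh_div_cosh, inv_div]
  have hcoth : coth lam = (C + C⁻¹) / 2 := by
    have h2 : lam = 2 * (lam / 2) := by ring
    rw [hC, coth, coth]
    conv_lhs => rw [h2, Real.cosh_two_mul, Real.sinh_two_mul]
    field_simp
  have hhalf : (1 / 2 : ℝ) * lam = lam / 2 := by ring
  have hC0' : (C : ℂ) ≠ 0 := by exact_mod_cast hC0
  unfold fockRep bargmann
  rw [← integral_sub_right_eq_self _ (C⁻¹ • rot η - ξ)]
  simp only [twistedRep_apply, ← integral_const_mul, ← integral_mul_const, hT]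
  refine integral_congr_ae (Filter.Eventually.of_forall fun t => ?_)
  have e2 : t - (C⁻¹ • rot η - ξ) + C⁻¹ • rot η = t + ξ := by abel
  simp only [e2, add_sub_cancel_right, heatKernel, hhalf, one_mul, ← hC, hcoth, mul_inv, ← Complex.exp_neg]
  set K1 : ℂ := ((((4 * Real.pi) ^ n)⁻¹ * (lam / Real.sinh lam) ^ n : ℝ) : ℂ)
  set K2 : ℂ := ((((4 * Real.pi) ^ n)⁻¹ * (lam / Real.sinh (lam / 2)) ^ n : ℝ) : ℂ)
  set E0 := Complex.exp (-((lam / 4 * ((C + C⁻¹) / 2) : ℝ) : ℂ) *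
    dot (0 : Fin n ⊕ Fin n → ℂ) (0 : Fin n ⊕ Fin n → ℂ))
  have key : ∀ a1 a2 a3 a4 a5 a6 b1 b2 b3 b4 b5 b6 b7 G : ℂ,
      a1 + a2 + a3 + a4 + a5 + a6 = b1 + b2 + b3 + b4 + b5 + b6 + b7 →
      K1 * E0 * (K1⁻¹ * Complex.exp a1) *
        (Complex.exp a2 * (Complex.exp a3 * (Complex.exp a4 * G)) *
          (K2 * Complex.exp a5 * Complex.exp a6)) =
      K1 * E0 * (K1⁻¹ * Complex.exp b1) * (G * (K2 * Complex.exp b2 * Complex.exp b3)) *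
        Complex.exp b4 * Complex.exp b5 * Complex.exp b6 * Complex.exp b7 := by
    intro a1 a2 a3 a4 a5 a6 b1 b2 b3 b4 b5 b6 b7 G h
    have h' := congrArg Complex.exp h
    simp only [Complex.exp_add] at h'
    linear_combination (K1 * K1⁻¹ * E0 * K2 * G) * h'
  apply key
  simp only [dot, symp, rot, Complex.ofReal_mul, Complex.ofReal_sum, Complex.ofReal_add,
    Complex.ofReal_sub, Complex.ofReal_neg, PiLp.add_apply, PiLp.sub_apply, PiLp.smul_apply,
    smul_eq_mul, Sum.elim_inl, Sum.elim_inr, Pi.sub_apply, Pi.star_apply, Finset.mul_sum,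
    ← Finset.sum_add_distrib, ← Finset.sum_neg_distrib]
  refine Finset.sum_congr rfl fun j _ => ?_
  simp only [Complex.add_re, Complex.add_im, Complex.ofReal_re, Complex.ofReal_im, Complex.mul_re,
    Complex.mul_im, Complex.I_re, Complex.I_im, star_add, star_mul', RCLike.star_def,
    Complex.conj_ofReal, Complex.conj_I, Complex.ofReal_div, Complex.ofReal_inv,
    Complex.ofReal_add, Complex.ofReal_mul, Complex.ofReal_sub,
    Complex.ofReal_zero, Complex.ofReal_one, Complex.ofReal_ofNat]
  field_simp
  ring_nf
  simp only [Complex.I_sq]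
  ring_nf

/-! ### Twisted modulation spaces -/

/-- The complex conjugate of a Schwartz function. -/
def conjSchwartz {n : ℕ} (φ : 𝓢(Space n, ℂ)) : 𝓢(Space n, ℂ) :=
  SchwartzMap.postcompCLM (𝕜 := ℝ) (Complex.conjCLE : ℂ →L[ℝ] ℂ) φ

/-- The matrix coefficient `(ξ, η) ↦ ⟨f, Π_λ(ξ, η) g⟩` of a tempered distribution `f` with window
`g`; the bracket is linear in `f` and conjugate linear in the Schwartz function, that is
`⟨f, φ⟩ = f (conj φ)`. -/
def matrixCoeff {n : ℕ} (lam : ℝ) (g : 𝓢(Space n, ℂ)) (f : 𝓢'(Space n, ℂ))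
    (z : Space n × Space n) : ℂ :=
  f (conjSchwartz (twistedRep lam z.1 z.2 g))

/-- The mixed norm of `L^{p,q}(ℝ²ⁿ × ℝ²ⁿ)`: the `L^p` norm in `ξ`, then the `L^q` norm in `η`. -/
def mixedNorm {n : ℕ} (p q : ℝ≥0∞) (F : Space n × Space n → ℂ) : ℝ≥0∞ :=
  eLpNorm (fun η : Space n => eLpNorm (fun ξ : Space n => F (ξ, η)) p volume) q volume

/-- Membership in the mixed norm space `L^{p,q}(ℝ²ⁿ × ℝ²ⁿ)`. -/
def MemMixed {n : ℕ} (p q : ℝ≥0∞) (F : Space n × Space n → ℂ) : Prop :=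
  AEStronglyMeasurable F volume ∧ mixedNorm p q F < ∞

/-- The norm `‖f‖_{(p,q)}` with window `g`. -/
def modulationNorm {n : ℕ} (lam : ℝ) (p q : ℝ≥0∞) (g : 𝓢(Space n, ℂ))
    (f : 𝓢'(Space n, ℂ)) : ℝ≥0∞ :=
  mixedNorm p q (matrixCoeff lam g f)

/-- The twisted modulation space `M_λ^{p,q}(ℝ²ⁿ)`: the tempered distributions whose matrix
coefficient is in `L^{p,q}` for some nonzero Schwartz window. -/
def twistedModulationSpace (n : ℕ) (lam : ℝ) (p q : ℝ≥0∞) : Set 𝓢'(Space n, ℂ) :=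
  {f | ∃ g : 𝓢(Space n, ℂ), g ≠ 0 ∧ MemMixed p q (matrixCoeff lam g f)}

/-- The tempered distribution `ψ ↦ ∫ φ ψ` defined by a Schwartz function `φ`. -/
def ofSchwartz {n : ℕ} (φ : 𝓢(Space n, ℂ)) : 𝓢'(Space n, ℂ) :=
  SchwartzMap.toTemperedDistributionCLM (Space n) ℂ volume φ

/-- The integrand of the duality pairing of twisted modulation spaces. -/
def pairingIntegrand {n : ℕ} (lam : ℝ) (g : 𝓢(Space n, ℂ)) (f h : 𝓢'(Space n, ℂ))
    (z : Space n × Space n) : ℂ :=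
  matrixCoeff lam g f z * conj (matrixCoeff lam g h z)

/-- The duality pairing `∫∫ ⟨f, Π_λ(ξ, η) g⟩ conj ⟨h, Π_λ(ξ, η) g⟩ dξ dη`. -/
def modulationPairing {n : ℕ} (lam : ℝ) (g : 𝓢(Space n, ℂ)) (f h : 𝓢'(Space n, ℂ)) : ℂ :=
  ∫ z : Space n × Space n, pairingIntegrand lam g f h z

/-- The seminorm `N` is a norm that makes the complex vector space `V` a Banach space. -/
def IsBanachNorm {V : Type*} [AddCommGroup V] [Module ℂ V] (N : Seminorm ℂ V) : Prop :=
  (∀ f : V, N f = 0 → f = 0) ∧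
  ∀ u : ℕ → V, (∀ ε : ℝ, 0 < ε → ∃ K : ℕ, ∀ m k : ℕ, K ≤ m → K ≤ k → N (u m - u k) < ε) →
    ∃ f : V, Filter.Tendsto (fun k : ℕ => N (u k - f)) Filter.atTop (nhds 0)

/-- Under the pairing with window `g`, the dual of the subspace `M` of tempered distributions, normed
by `N`, is the set `M'` of tempered distributions normed by `N'`: pairing with `h ∈ M'` is a bounded
linear functional on `M`, every bounded linear functional on `M` arises from exactly one `h ∈ M'`,
and the functional norm is equivalent to `N'`. -/
def IsDualUnderPairing {n : ℕ} (lam : ℝ) (g : 𝓢(Space n, ℂ)) (M : Submodule ℂ 𝓢'(Space n, ℂ))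
    (N : Seminorm ℂ M) (M' : Set 𝓢'(Space n, ℂ)) (N' : 𝓢'(Space n, ℂ) → ℝ≥0∞) : Prop :=
  (∀ h ∈ M', ∃ ℓ : M →ₗ[ℂ] ℂ, ∀ f : M, Integrable (pairingIntegrand lam g f h) volume ∧
    ℓ f = modulationPairing lam g f h ∧ ‖ℓ f‖ ≤ (N' h).toReal * N f) ∧
  (∀ ℓ : M →ₗ[ℂ] ℂ, (∃ C : ℝ, ∀ f : M, ‖ℓ f‖ ≤ C * N f) →
    ∃! h : 𝓢'(Space n, ℂ), h ∈ M' ∧ ∀ f : M, ℓ f = modulationPairing lam g f h) ∧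
  (∃ A : ℝ, 0 < A ∧ ∀ h ∈ M', ∀ C : ℝ, 0 ≤ C →
    (∀ f : M, ‖modulationPairing lam g f h‖ ≤ C * N f) → N' h ≤ ENNReal.ofReal (A * C))

end TwistedMod

end

open TwistedMod

/-!
Up to a unimodular factor, `Π_λ(ξ, η)` is a time-frequency shift, after an invertible linear change
of the phase-space coordinates `(ξ, η)`. Hence `V_g f` inherits from the short-time Fourier
transform the orthogonality relations, the inversion formula and the rapid decay for Schwartz
functions `f`. Inversion with a window `γ` gives the reproducing formula
`V_g f = c⁻¹ ∫ V_γ f(z') ⟨Π_λ(z') γ, Π_λ(·) g⟩ dz'`, whose kernel is dominated by an integrable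
function of the difference of the phase-space points. Young's inequality in mixed Lebesgue norms
therefore compares all windows and gives the inclusions (iii).

A Cauchy sequence in `M_λ^{p,q}` converges weakly as a sequence of functionals on Schwartz space,
and Fatou's lemma upgrades this to convergence in norm. For finite `p` and `q`, resynthesizing `f`
from the truncations of `V_g f` to large balls approximates `f` by Schwartz functions. For the
duality, the orthogonality relations turn a bounded functional on Schwartz functions into the
pairing with a distribution `h`; since the mixed norm of `V_g h` is attained against bounded
coefficient functions `F` of bounded support and the pairing of `h` with the Schwartz function
synthesized from `F` is `∫ F conj(V_g h)`, the norm of the functional controls `V_g h`.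
-/

namespace TwistedMod

/-! ### Mixed Lebesgue norms -/

section LpNorm

open Filter Topology

variable {X Y : Type*} [MeasurableSpace X] [MeasurableSpace Y] {μ : Measure X}

theorem eLpNorm_ennreal_eq_lintegral_rpow {p : ℝ≥0∞} (hp0 : p ≠ 0) (hp : p ≠ ∞) (f : X → ℝ≥0∞) :
    eLpNorm f p μ = (∫⁻ x, f x ^ p.toReal ∂μ) ^ (1 / p.toReal) := by
  simp [eLpNorm_eq_lintegral_rpow_enorm_toReal hp0 hp]

theorem eLpNorm_ennreal_rpow_toReal {p : ℝ≥0∞} (hp0 : p ≠ 0) (hp : p ≠ ∞) (f : X → ℝ≥0∞) :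
    eLpNorm f p μ ^ p.toReal = ∫⁻ x, f x ^ p.toReal ∂μ := by
  rw [eLpNorm_ennreal_eq_lintegral_rpow hp0 hp, ← ENNReal.rpow_mul,
    one_div_mul_cancel (ENNReal.toReal_pos hp0 hp).ne', ENNReal.rpow_one]

theorem eLpNorm_ennreal_one (f : X → ℝ≥0∞) : eLpNorm f 1 μ = ∫⁻ x, f x ∂μ :=
  eLpNorm_one_eq_lintegral_enorm

theorem ae_le_eLpNorm_top (f : X → ℝ≥0∞) : ∀ᵐ x ∂μ, f x ≤ eLpNorm f ∞ μ := by
  rw [eLpNorm_exponent_top]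
  exact ae_le_eLpNormEssSup

theorem eLpNorm_top_le_iff {f : X → ℝ≥0∞} {c : ℝ≥0∞} :
    eLpNorm f ∞ μ ≤ c ↔ ∀ᵐ x ∂μ, f x ≤ c :=
  ⟨fun h => (ae_le_eLpNorm_top f).mono fun _ hx => hx.trans h, fun h => by
    rw [eLpNorm_exponent_top]
    exact eLpNormEssSup_le_of_ae_enorm_bound h⟩

theorem eLpNorm_mono_ennreal {f g : X → ℝ≥0∞} (p : ℝ≥0∞) (h : f ≤ g) :
    eLpNorm f p μ ≤ eLpNorm g p μ :=
  eLpNorm_mono_enorm h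

theorem measurable_eLpNorm_prodMk_right [SFinite μ] {F : X × Y → ℝ≥0∞} (hF : Measurable F)
    (p : ℝ≥0∞) : Measurable fun y => eLpNorm (fun x => F (x, y)) p μ := by
  rcases eq_or_ne p 0 with rfl | hp0
  · simp
  rcases eq_or_ne p ∞ with rfl | hp
  · refine measurable_of_Iic fun c => ?_
    have sublevel_eq : (fun y => eLpNorm (fun x => F (x, y)) ∞ μ) ⁻¹' Set.Iic c =
        (fun y => μ ((fun x => (x, y)) ⁻¹' {z | c < F z})) ⁻¹' {0} := by
      ext y
      simp only [Set.mem_preimage, Set.mem_Iic, eLpNorm_top_le_iff, Set.mem_singleton_iff, ae_iff,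
        not_le]
      rfl
    rw [sublevel_eq]
    exact measurable_measure_prodMk_right (measurableSet_lt measurable_const hF)
      (measurableSet_singleton _)
  · simp only [eLpNorm_ennreal_eq_lintegral_rpow hp0 hp]
    exact (hF.pow_const _).lintegral_prod_left'.pow_const _

theorem eLpNorm_iSup {f : ℕ → X → ℝ≥0∞} (hf : ∀ n, Measurable (f n)) (hm : Monotone f)
    (p : ℝ≥0∞) : eLpNorm (fun x => ⨆ n, f n x) p μ = ⨆ n, eLpNorm (f n) p μ := by
  rcases eq_or_ne p 0 with rfl | hp0
  · simp
  rcases eq_or_ne p ∞ with rfl | hp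
  · refine le_antisymm ?_ (iSup_le fun n => eLpNorm_mono_ennreal _ fun x => le_iSup (f · x) n)
    rw [eLpNorm_top_le_iff]
    filter_upwards [ae_all_iff.2 fun n => ae_le_eLpNorm_top (f n)] with x hx
    exact iSup_mono hx
  · have hpos := ENNReal.toReal_pos hp0 hp
    simp only [eLpNorm_ennreal_eq_lintegral_rpow hp0 hp]
    have iSup_rpow : ∀ x, (⨆ n, f n x) ^ p.toReal = ⨆ n, f n x ^ p.toReal := fun x =>
      (ENNReal.orderIsoRpow _ hpos).map_iSup _
    simp only [iSup_rpow]
    rw [lintegral_iSup (fun n => (hf n).pow_const _)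
      fun a b hab x => ENNReal.rpow_le_rpow (hm hab x) hpos.le]
    exact (ENNReal.orderIsoRpow _ (one_div_pos.2 hpos)).map_iSup _

theorem eLpNorm_const_mul_le {f : X → ℝ≥0∞} (hf : Measurable f) (c p : ℝ≥0∞) :
    eLpNorm (fun x => c * f x) p μ ≤ c * eLpNorm f p μ := by
  rcases eq_or_ne p 0 with rfl | hp0
  · simp
  rcases eq_or_ne p ∞ with rfl | hp
  · rw [eLpNorm_top_le_iff]
    filter_upwards [ae_le_eLpNorm_top f] with x hx
    gcongr
  · have hpos := ENNReal.toReal_pos hp0 hp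
    simp only [eLpNorm_ennreal_eq_lintegral_rpow hp0 hp, ENNReal.mul_rpow_of_nonneg _ _ hpos.le]
    rw [lintegral_const_mul _ (hf.pow_const _), ENNReal.mul_rpow_of_nonneg _ _ (by positivity),
      ← ENNReal.rpow_mul, mul_one_div_cancel hpos.ne', ENNReal.rpow_one]

theorem lintegral_mul_le_eLpNorm_top_mul_eLpNorm_one (f : X → ℝ≥0∞) {g : X → ℝ≥0∞}
    (hg : Measurable g) : ∫⁻ x, f x * g x ∂μ ≤ eLpNorm f ∞ μ * eLpNorm g 1 μ := by
  rw [eLpNorm_ennreal_one, ← lintegral_const_mul _ hg]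
  refine lintegral_mono_ae ?_
  filter_upwards [ae_le_eLpNorm_top f] with x hx
  gcongr

theorem lintegral_mul_le_eLpNorm_mul_eLpNorm (p p' : ℝ≥0∞) [p.HolderConjugate p']
    {f g : X → ℝ≥0∞} (hf : Measurable f) (hg : Measurable g) :
    ∫⁻ x, f x * g x ∂μ ≤ eLpNorm f p μ * eLpNorm g p' μ := by
  rcases eq_or_ne p ∞ with rfl | hp
  · obtain rfl : p' = 1 := (ENNReal.HolderConjugate.eq_top_iff_eq_one ∞ p').1 rfl
    exact lintegral_mul_le_eLpNorm_top_mul_eLpNorm_one f hg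
  rcases eq_or_ne p' ∞ with rfl | hp'
  · have : (∞ : ℝ≥0∞).HolderConjugate p := .symm
    obtain rfl : p = 1 := (ENNReal.HolderConjugate.eq_top_iff_eq_one ∞ p).1 rfl
    simpa only [mul_comm] using lintegral_mul_le_eLpNorm_top_mul_eLpNorm_one g hf
  have : p'.HolderConjugate p := .symm
  rw [eLpNorm_ennreal_eq_lintegral_rpow (ENNReal.HolderConjugate.pos p p').ne' hp,
    eLpNorm_ennreal_eq_lintegral_rpow (ENNReal.HolderConjugate.pos p' p).ne' hp']
  exact ENNReal.lintegral_mul_le_Lp_mul_Lq μ (ENNReal.HolderConjugate.toReal_of_ne_top hp hp')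
    hf.aemeasurable hg.aemeasurable

theorem eLpNorm_ne_top_of_le_indicator_const {p : ℝ≥0∞} {f : X → ℝ≥0∞} {S : Set X} (hS : μ S ≠ ∞)
    {b : ℝ≥0∞} (hb : b ≠ ∞) (hf : f ≤ S.indicator fun _ => b) : eLpNorm f p μ ≠ ∞ := by
  refine ne_top_of_le_ne_top ?_ ((eLpNorm_mono_ennreal p hf).trans (eLpNorm_indicator_const_le b p))
  exact ENNReal.mul_ne_top hb (ENNReal.rpow_ne_top_of_nonneg (by positivity) hS)

theorem eLpNorm_le_eLpNorm_top_add {f : X → ℝ≥0∞} {p r : ℝ≥0∞} (hp : p ≠ 0) (hpr : p ≤ r) :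
    eLpNorm f r μ ≤ eLpNorm f ∞ μ + eLpNorm f p μ := by
  rcases eq_or_ne r ∞ with rfl | hr
  · exact le_self_add
  have hp' : p ≠ ∞ := ne_top_of_le_ne_top hr hpr
  have hr0 : r ≠ 0 := ((pos_iff_ne_zero.2 hp).trans_le hpr).ne'
  have hle : 0 ≤ r.toReal - p.toReal := sub_nonneg.2 (ENNReal.toReal_mono hr hpr)
  set M := eLpNorm f ∞ μ + eLpNorm f p μ
  rcases eq_or_ne M ∞ with hM | hM
  · exact hM ▸ le_top
  have rpow_split : ∀ t : ℝ≥0∞, t ^ r.toReal = t ^ p.toReal * t ^ (r.toReal - p.toReal) :=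
    fun t => by
      rw [← ENNReal.rpow_add_of_nonneg _ _ ENNReal.toReal_nonneg hle, add_sub_cancel]
  rw [← ENNReal.rpow_le_rpow_iff (ENNReal.toReal_pos hr0 hr), eLpNorm_ennreal_rpow_toReal hr0 hr]
  calc ∫⁻ x, f x ^ r.toReal ∂μ ≤ ∫⁻ x, f x ^ p.toReal * M ^ (r.toReal - p.toReal) ∂μ := by
        refine lintegral_mono_ae ?_
        filter_upwards [ae_le_eLpNorm_top f] with x hx
        rw [rpow_split]
        gcongr
        exact hx.trans le_self_add
    _ = eLpNorm f p μ ^ p.toReal * M ^ (r.toReal - p.toReal) := by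
        rw [lintegral_mul_const' _ _ (ENNReal.rpow_ne_top_of_nonneg hle hM),
          eLpNorm_ennreal_rpow_toReal hp hp']
    _ ≤ M ^ r.toReal := by
        rw [rpow_split M]
        gcongr
        exact le_add_self

theorem ae_lt_top_of_eLpNorm_ne_top {f : X → ℝ≥0∞} (hf : Measurable f) {p : ℝ≥0∞} (hp0 : p ≠ 0)
    (hp : p ≠ ∞) (hfin : eLpNorm f p μ ≠ ∞) : ∀ᵐ x ∂μ, f x < ∞ := by
  have hpos := ENNReal.toReal_pos hp0 hp
  have lintegral_ne_top : ∫⁻ x, f x ^ p.toReal ∂μ ≠ ∞ := by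
    rw [← eLpNorm_ennreal_rpow_toReal hp0 hp]
    exact ENNReal.rpow_ne_top_of_nonneg hpos.le hfin
  filter_upwards [ae_lt_top (hf.pow_const _) lintegral_ne_top] with x hx
  exact (ENNReal.rpow_lt_top_iff_of_pos hpos).1 hx

theorem tendsto_eLpNorm_zero_of_dominated {f : ℕ → X → ℝ≥0∞} (hf : ∀ n, Measurable (f n))
    {g : X → ℝ≥0∞} (hfg : ∀ n, f n ≤ g) {p : ℝ≥0∞} (hp0 : p ≠ 0) (hp : p ≠ ∞)
    (hg : eLpNorm g p μ ≠ ∞) (hlim : ∀ᵐ x ∂μ, Tendsto (fun n => f n x) atTop (𝓝 0)) :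
    Tendsto (fun n => eLpNorm (f n) p μ) atTop (𝓝 0) := by
  have hpos := ENNReal.toReal_pos hp0 hp
  simp only [eLpNorm_ennreal_eq_lintegral_rpow hp0 hp]
  rw [show (0 : ℝ≥0∞) = (∫⁻ _, 0 ∂μ) ^ (1 / p.toReal) by
    simp [ENNReal.zero_rpow_of_pos (inv_pos.2 hpos)]]
  refine (ENNReal.continuous_rpow_const.tendsto _).comp
    (tendsto_lintegral_of_dominated_convergence (fun x => g x ^ p.toReal)
      (fun n => (hf n).pow_const _)
      (fun n => .of_forall fun x => ENNReal.rpow_le_rpow (hfg n x) hpos.le) ?_ ?_)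
  · rw [← eLpNorm_ennreal_rpow_toReal hp0 hp]
    exact ENNReal.rpow_ne_top_of_nonneg hpos.le hg
  · filter_upwards [hlim] with x hx
    have := ((ENNReal.continuous_rpow_const (y := p.toReal)).tendsto 0).comp hx
    rwa [ENNReal.zero_rpow_of_pos hpos] at this

end LpNorm

section Truncation

variable {Z : Type*}

/-- The restriction of `F` to `B n`, cut off at height `n`: along an exhausting sequence `B` these
functions are bounded, supported in the sets of the sequence, and increase to `F`. -/
noncomputable def truncation (B : ℕ → Set Z) (F : Z → ℝ≥0∞) (n : ℕ) : Z → ℝ≥0∞ :=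
  (B n).indicator fun z => min (F z) n

theorem measurable_truncation [MeasurableSpace Z] {B : ℕ → Set Z} (hB : ∀ n, MeasurableSet (B n))
    {F : Z → ℝ≥0∞} (hF : Measurable F) (n : ℕ) : Measurable (truncation B F n) :=
  (hF.min measurable_const).indicator (hB n)

theorem truncation_le_self (B : ℕ → Set Z) (F : Z → ℝ≥0∞) (n : ℕ) : truncation B F n ≤ F :=
  fun _ => Set.indicator_apply_le' (fun _ => min_le_left _ _) fun _ => zero_le

theorem truncation_le_indicator_const (B : ℕ → Set Z) (F : Z → ℝ≥0∞) (n : ℕ) :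
    truncation B F n ≤ (B n).indicator fun _ => (n : ℝ≥0∞) :=
  fun _ => Set.indicator_le_indicator (min_le_right _ _)

theorem monotone_truncation {B : ℕ → Set Z} (hB : Monotone B) (F : Z → ℝ≥0∞) :
    Monotone (truncation B F) := by
  intro a b hab z
  by_cases hz : z ∈ B a
  · simp only [truncation, Set.indicator_of_mem hz, Set.indicator_of_mem (hB hab hz)]
    gcongr
  · simp [truncation, Set.indicator_of_notMem hz]

theorem iSup_truncation {B : ℕ → Set Z} (hB : Monotone B) (hU : ⋃ n, B n = Set.univ)
    (F : Z → ℝ≥0∞) (z : Z) : ⨆ n, truncation B F n z = F z := by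
  refine le_antisymm (iSup_le fun n => truncation_le_self _ _ _ _) ?_
  obtain ⟨k, hk⟩ := Set.iUnion_eq_univ_iff.1 hU z
  refine le_of_forall_lt fun c hc => ?_
  obtain ⟨m, hm⟩ := ENNReal.exists_nat_gt hc.ne_top
  refine lt_of_lt_of_le ?_ (le_iSup _ (max k m))
  rw [truncation, Set.indicator_of_mem (hB (le_max_left k m) hk)]
  exact lt_min hc (hm.trans_le (by exact_mod_cast le_max_right k m))

end Truncation

section NormingFamily

variable {X Y : Type*} [MeasurableSpace X] [MeasurableSpace Y] {μ : Measure X}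

/-- The equality case of Hölder's inequality for `1 < p < ∞`: the function of norm one in the dual
space that norms `f`. -/
noncomputable def powerDual (μ : Measure X) (p : ℝ≥0∞) (f : X → ℝ≥0∞) (x : X) : ℝ≥0∞ :=
  f x ^ (p.toReal - 1) * (eLpNorm f p μ ^ (p.toReal - 1))⁻¹

theorem eLpNorm_powerDual_le_one {p p' : ℝ≥0∞} [p.HolderConjugate p'] (hp : p ≠ ∞) (hp' : p' ≠ ∞)
    {f : X → ℝ≥0∞} (hf : Measurable f) : eLpNorm (powerDual μ p f) p' μ ≤ 1 := by
  have : p'.HolderConjugate p := .symm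
  have hr := ENNReal.HolderConjugate.toReal_of_ne_top (p := p) (q := p') hp hp'
  have powerDual_rpow : ∀ x, powerDual μ p f x ^ p'.toReal =
      f x ^ p.toReal * (eLpNorm f p μ ^ p.toReal)⁻¹ := fun x => by
    rw [powerDual, ENNReal.mul_rpow_of_nonneg _ _ hr.symm.nonneg, ENNReal.inv_rpow,
      ← ENNReal.rpow_mul, ← ENNReal.rpow_mul, hr.sub_one_mul_conj]
  rw [eLpNorm_ennreal_eq_lintegral_rpow (ENNReal.HolderConjugate.pos p' p).ne' hp']
  refine ENNReal.rpow_le_one ?_ (by positivity)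
  simp only [powerDual_rpow]
  rw [lintegral_mul_const _ (hf.pow_const _),
    ← eLpNorm_ennreal_rpow_toReal (ENNReal.HolderConjugate.pos p p').ne' hp]
  exact ENNReal.mul_inv_le_one _

theorem eLpNorm_eq_lintegral_mul_powerDual {p : ℝ≥0∞} (hp1 : 1 ≤ p) (hp : p ≠ ∞) {f : X → ℝ≥0∞}
    (hf : Measurable f) (hfin : eLpNorm f p μ ≠ ∞) :
    eLpNorm f p μ = ∫⁻ x, f x * powerDual μ p f x ∂μ := by
  have hp0 : p ≠ 0 := (zero_lt_one.trans_le hp1).ne'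
  have hr : 0 ≤ p.toReal - 1 := sub_nonneg.2 (by simpa using ENNReal.toReal_mono hp hp1)
  have mul_rpow_sub_one : ∀ t : ℝ≥0∞, t * t ^ (p.toReal - 1) = t ^ p.toReal := fun t => by
    nth_rw 1 [← ENNReal.rpow_one t]
    rw [← ENNReal.rpow_add_of_nonneg _ _ zero_le_one hr, add_sub_cancel]
  simp only [powerDual, ← mul_assoc, mul_rpow_sub_one]
  rw [lintegral_mul_const _ (hf.pow_const _), ← eLpNorm_ennreal_rpow_toReal hp0 hp]
  rcases eq_or_ne (eLpNorm f p μ) 0 with h0 | h0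
  · simp [h0, ENNReal.zero_rpow_of_pos (ENNReal.toReal_pos hp0 hp)]
  · rw [← ENNReal.rpow_neg, ← ENNReal.rpow_add _ _ h0 hfin]
    simp

/-- A near-extremizer of Hölder's inequality for `p = ∞`: the normalized indicator function of the
set where `f` exceeds `c` times its essential supremum. -/
noncomputable def levelDual (μ : Measure X) (c : ℝ≥0∞) (f : X → ℝ≥0∞) : X → ℝ≥0∞ :=
  {x | c * eLpNorm f ∞ μ < f x}.indicator fun _ => (μ {x | c * eLpNorm f ∞ μ < f x})⁻¹

theorem measurableSet_const_mul_eLpNorm_top_lt {f : X → ℝ≥0∞} (hf : Measurable f) (c : ℝ≥0∞) :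
    MeasurableSet {x | c * eLpNorm f ∞ μ < f x} :=
  measurableSet_lt measurable_const hf

theorem eLpNorm_levelDual_le_one {f : X → ℝ≥0∞} (hf : Measurable f) (c : ℝ≥0∞) :
    eLpNorm (levelDual μ c f) 1 μ ≤ 1 := by
  rw [eLpNorm_ennreal_one, levelDual,
    lintegral_indicator_const (measurableSet_const_mul_eLpNorm_top_lt hf c), mul_comm]
  exact ENNReal.mul_inv_le_one _

theorem const_mul_eLpNorm_top_le_lintegral_mul_levelDual {f : X → ℝ≥0∞} (hf : Measurable f)
    {S : Set X} (hS : μ S ≠ ∞) {b : ℝ≥0∞} (hb : b ≠ ∞) (hfb : f ≤ S.indicator fun _ => b)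
    {c : ℝ≥0∞} (hc : c < 1) :
    c * eLpNorm f ∞ μ ≤ ∫⁻ x, f x * levelDual μ c f x ∂μ := by
  set N := eLpNorm f ∞ μ with hN
  set E := {x | c * N < f x} with hE
  rcases eq_or_ne N 0 with h0 | h0
  · simp [h0]
  have measure_ne_zero : μ E ≠ 0 := fun hE0 => by
    have N_le : N ≤ c * N := eLpNorm_top_le_iff.2 (by simpa only [ae_iff, not_le] using hE0)
    refine N_le.not_gt ?_
    simpa using
      (ENNReal.mul_lt_mul_iff_left h0 (eLpNorm_ne_top_of_le_indicator_const hS hb hfb)).2 hc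
  have E_subset : E ⊆ S := fun x hx => by
    by_contra hxS
    have := hfb x
    rw [Set.indicator_of_notMem hxS] at this
    exact absurd (lt_of_lt_of_le hx this) (by simp)
  have measure_ne_top : μ E ≠ ∞ := measure_ne_top_of_subset E_subset hS
  calc c * N = c * N * (μ E)⁻¹ * μ E := by
        rw [mul_assoc, ENNReal.inv_mul_cancel measure_ne_zero measure_ne_top, mul_one]
    _ = ∫⁻ x, E.indicator (fun _ => c * N * (μ E)⁻¹) x ∂μ := by
        rw [lintegral_indicator_const (measurableSet_const_mul_eLpNorm_top_lt hf c)]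
    _ ≤ ∫⁻ x, f x * levelDual μ c f x ∂μ := lintegral_mono fun x => by
        by_cases hx : x ∈ E
        · simp only [levelDual, ← hN, ← hE, Set.indicator_of_mem hx]
          gcongr
          exact le_of_lt hx
        · simp [Set.indicator_of_notMem hx]

/-- A measurable family of functions `H (·, y)` in the unit ball of `L^{p'}` that norm the slices
`F (·, y)` in `L^p` up to the factor `c`. -/
structure IsNormingFamily (μ : Measure X) (p p' c : ℝ≥0∞) (F H : X × Y → ℝ≥0∞) : Prop where
  measurable : Measurable H
  eLpNorm_le_one : ∀ y, eLpNorm (fun x => H (x, y)) p' μ ≤ 1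
  const_mul_eLpNorm_le : ∀ y,
    c * eLpNorm (fun x => F (x, y)) p μ ≤ ∫⁻ x, F (x, y) * H (x, y) ∂μ

theorem exists_isNormingFamily [SFinite μ] (p p' : ℝ≥0∞) [p.HolderConjugate p']
    {F : X × Y → ℝ≥0∞} (hF : Measurable F) {S : Set X} (hS : μ S ≠ ∞) {b : ℝ≥0∞} (hb : b ≠ ∞)
    (hFb : ∀ y, (fun x => F (x, y)) ≤ S.indicator fun _ => b) {c : ℝ≥0∞} (hc : c < 1) :
    ∃ H, IsNormingFamily μ p p' c F H := by
  have hFy : ∀ y, Measurable fun x => F (x, y) := fun y => hF.comp measurable_prodMk_right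
  have hN : ∀ s, Measurable fun z : X × Y => eLpNorm (fun x => F (x, z.2)) s μ := fun s =>
    (measurable_eLpNorm_prodMk_right hF s).comp measurable_snd
  rcases eq_or_ne p' ∞ with rfl | hp'
  · have : (∞ : ℝ≥0∞).HolderConjugate p := .symm
    obtain rfl : p = 1 := (ENNReal.HolderConjugate.eq_top_iff_eq_one ∞ p).1 rfl
    refine ⟨fun _ => 1, measurable_const, fun _ => eLpNorm_top_le_iff.2 (by simp), fun y => ?_⟩
    simpa only [mul_one, eLpNorm_ennreal_one] using mul_le_of_le_one_left' hc.le
  rcases eq_or_ne p ∞ with rfl | hp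
  · obtain rfl : p' = 1 := (ENNReal.HolderConjugate.eq_top_iff_eq_one ∞ p').1 rfl
    have hE : MeasurableSet {z : X × Y | c * eLpNorm (fun x => F (x, z.2)) ∞ μ < F z} :=
      measurableSet_lt ((hN ∞).const_mul c) hF
    exact ⟨fun z => levelDual μ c (fun x => F (x, z.2)) z.1,
      ((measurable_measure_prodMk_right hE).comp measurable_snd).inv.indicator hE,
      fun y => eLpNorm_levelDual_le_one (hFy y) c,
      fun y => const_mul_eLpNorm_top_le_lintegral_mul_levelDual (hFy y) hS hb (hFb y) hc⟩
  · refine ⟨fun z => powerDual μ p (fun x => F (x, z.2)) z.1,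
      (hF.pow_const _).mul ((hN p).pow_const _).inv,
      fun y => eLpNorm_powerDual_le_one hp hp' (hFy y), fun y => ?_⟩
    rw [← eLpNorm_eq_lintegral_mul_powerDual (ENNReal.HolderConjugate.one_le p p') hp (hFy y)
      (eLpNorm_ne_top_of_le_indicator_const hS hb (hFb y))]
    exact mul_le_of_le_one_left' hc.le

end NormingFamily

section MixedNorm

open Filter Topology

variable {X Y : Type*} [MeasurableSpace X] [MeasurableSpace Y] {μ : Measure X} {ν : Measure Y}

/-- The norm of `L^{p,q}(μ, ν)`, that is, the `L^q` norm in the second variable of the `L^p` norm in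
the first, for functions with values in `[0, ∞]`. -/
noncomputable def mixedENorm (μ : Measure X) (ν : Measure Y) (p q : ℝ≥0∞) (F : X × Y → ℝ≥0∞) :
    ℝ≥0∞ :=
  eLpNorm (fun y => eLpNorm (fun x => F (x, y)) p μ) q ν

theorem mixedENorm_mono {F G : X × Y → ℝ≥0∞} (p q : ℝ≥0∞) (h : F ≤ G) :
    mixedENorm μ ν p q F ≤ mixedENorm μ ν p q G :=
  eLpNorm_mono_ennreal _ fun _ => eLpNorm_mono_ennreal _ fun _ => h _

theorem mixedENorm_const_mul_le [SFinite μ] {F : X × Y → ℝ≥0∞} (hF : Measurable F)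
    (c p q : ℝ≥0∞) : mixedENorm μ ν p q (fun z => c * F z) ≤ c * mixedENorm μ ν p q F :=
  (eLpNorm_mono_ennreal _ fun _ =>
    eLpNorm_const_mul_le (hF.comp measurable_prodMk_right) c p).trans
    (eLpNorm_const_mul_le (measurable_eLpNorm_prodMk_right hF p) c q)

theorem mixedENorm_tensor_le [SFinite μ] {v : X → ℝ≥0∞} (hv : Measurable v) {w : Y → ℝ≥0∞}
    (hw : Measurable w) (p q : ℝ≥0∞) :
    mixedENorm μ ν p q (fun z => v z.1 * w z.2) ≤ eLpNorm v p μ * eLpNorm w q ν :=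
  (eLpNorm_mono_ennreal q fun y => by
    simpa only [mul_comm] using eLpNorm_const_mul_le hv (w y) p).trans
    (eLpNorm_const_mul_le hw _ q)

theorem mixedENorm_add_le [SFinite μ] {F G : X × Y → ℝ≥0∞} (hF : Measurable F)
    (hG : Measurable G) {p q : ℝ≥0∞} (hp : 1 ≤ p) (hq : 1 ≤ q) :
    mixedENorm μ ν p q (F + G) ≤ mixedENorm μ ν p q F + mixedENorm μ ν p q G :=
  (eLpNorm_mono_ennreal _ fun _ =>
    eLpNorm_add_le (hF.comp measurable_prodMk_right).aestronglyMeasurable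
      (hG.comp measurable_prodMk_right).aestronglyMeasurable hp).trans
    (eLpNorm_add_le (measurable_eLpNorm_prodMk_right hF p).aestronglyMeasurable
      (measurable_eLpNorm_prodMk_right hG p).aestronglyMeasurable hq)

theorem mixedENorm_iSup [SFinite μ] {F : ℕ → X × Y → ℝ≥0∞} (hF : ∀ n, Measurable (F n))
    (hm : Monotone F) (p q : ℝ≥0∞) :
    mixedENorm μ ν p q (fun z => ⨆ n, F n z) = ⨆ n, mixedENorm μ ν p q (F n) := by
  simp only [mixedENorm, ← eLpNorm_iSup (fun n => measurable_eLpNorm_prodMk_right (hF n) p)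
    fun _ _ hab y => eLpNorm_mono_ennreal p fun x => hm hab (x, y)]
  congr 1
  funext y
  exact eLpNorm_iSup (fun n => (hF n).comp measurable_prodMk_right)
    (fun a b hab x => hm hab (x, y)) p

/-- Fatou's lemma: the pointwise limit is the supremum of the increasing sequence of the infima
over the tails. -/
theorem mixedENorm_le_of_tendsto [SFinite μ] {F : ℕ → X × Y → ℝ≥0∞} (hF : ∀ n, Measurable (F n))
    {G : X × Y → ℝ≥0∞} (hG : ∀ z, Tendsto (fun n => F n z) atTop (𝓝 (G z))) {p q b : ℝ≥0∞}
    (hb : ∀ᶠ n in atTop, mixedENorm μ ν p q (F n) ≤ b) : mixedENorm μ ν p q G ≤ b := by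
  obtain rfl : G = fun z => ⨆ n, ⨅ i, F (n + i) z := by
    funext z
    rw [← (hG z).liminf_eq, liminf_eq_iSup_iInf_of_nat']
    simp only [add_comm]
  rw [mixedENorm_iSup (fun n => Measurable.iInf fun i => hF _)]
  · refine iSup_le fun n => ?_
    obtain ⟨m, hm⟩ := eventually_atTop.1 hb
    exact (mixedENorm_mono p q fun z => iInf_le _ m).trans (hm _ (by lia))
  · intro a b hab z
    refine le_iInf fun i => (iInf_le _ (b - a + i)).trans_eq ?_
    rw [← add_assoc, Nat.add_sub_of_le hab]

theorem tendsto_mixedENorm_indicator_compl [SFinite μ] {V : X × Y → ℝ≥0∞} (hV : Measurable V)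
    {B : ℕ → Set (X × Y)} (hB : ∀ n, MeasurableSet (B n)) (hm : Monotone B)
    (hU : ⋃ n, B n = Set.univ) {p q : ℝ≥0∞} (hp0 : p ≠ 0) (hp : p ≠ ∞) (hq0 : q ≠ 0) (hq : q ≠ ∞)
    (hfin : mixedENorm μ ν p q V ≠ ∞) :
    Tendsto (fun n => mixedENorm μ ν p q ((B n)ᶜ.indicator V)) atTop (𝓝 0) := by
  have hVn : ∀ n, Measurable ((B n)ᶜ.indicator V) := fun n => hV.indicator (hB n).compl
  have hle : ∀ n, (B n)ᶜ.indicator V ≤ V := fun n => Set.indicator_le_self _ _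
  have hNorm := measurable_eLpNorm_prodMk_right (μ := μ) hV p
  refine tendsto_eLpNorm_zero_of_dominated
    (fun n => measurable_eLpNorm_prodMk_right (hVn n) p)
    (fun n y => eLpNorm_mono_ennreal p fun x => hle n (x, y)) hq0 hq hfin ?_
  filter_upwards [ae_lt_top_of_eLpNorm_ne_top hNorm hq0 hq hfin] with y hy
  refine tendsto_eLpNorm_zero_of_dominated (fun n => (hVn n).comp measurable_prodMk_right)
    (fun n x => hle n (x, y)) hp0 hp hy.ne (.of_forall fun x => ?_)
  obtain ⟨k, hk⟩ := Set.iUnion_eq_univ_iff.1 hU (x, y)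
  refine tendsto_const_nhds.congr' ?_
  filter_upwards [eventually_ge_atTop k] with n hn
  exact (Set.indicator_of_notMem (Set.notMem_compl_iff.2 (hm hn hk)) V).symm

theorem lintegral_mul_le_mixedENorm_mul_mixedENorm [SFinite μ] [SFinite ν] (p p' q q' : ℝ≥0∞)
    [p.HolderConjugate p'] [q.HolderConjugate q'] {F G : X × Y → ℝ≥0∞} (hF : Measurable F)
    (hG : Measurable G) :
    ∫⁻ z, F z * G z ∂(μ.prod ν) ≤ mixedENorm μ ν p q F * mixedENorm μ ν p' q' G := by
  rw [lintegral_prod_symm (fun z => F z * G z) (hF.mul hG).aemeasurable]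
  refine (lintegral_mono fun y => ?_).trans (lintegral_mul_le_eLpNorm_mul_eLpNorm q q'
    (measurable_eLpNorm_prodMk_right hF p) (measurable_eLpNorm_prodMk_right hG p'))
  exact lintegral_mul_le_eLpNorm_mul_eLpNorm p p' (hF.comp measurable_prodMk_right)
    (hG.comp measurable_prodMk_right)

theorem eLpNorm_le_of_forall_lintegral_mul_le [SigmaFinite μ] (p p' : ℝ≥0∞)
    [p.HolderConjugate p'] {F : X → ℝ≥0∞} (hF : Measurable F) {A : ℝ≥0∞}
    (h : ∀ H : X → ℝ≥0∞, Measurable H → ∫⁻ x, F x * H x ∂μ ≤ A * eLpNorm H p' μ) :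
    eLpNorm F p μ ≤ A := by
  set T := truncation (spanningSets μ) F
  have hTm : ∀ n, Measurable (T n) := measurable_truncation (measurableSet_spanningSets μ) hF
  have hTF : F = fun x => ⨆ n, T n x := funext fun x =>
    (iSup_truncation (monotone_spanningSets μ) (iUnion_spanningSets μ) F x).symm
  rw [hTF, eLpNorm_iSup hTm (monotone_truncation (monotone_spanningSets μ) F)]
  refine iSup_le fun n => ENNReal.le_of_forall_lt_one_mul_le fun c hc => ?_
  obtain ⟨H, hH⟩ := exists_isNormingFamily (Y := Unit) (μ := μ) p p'
    ((hTm n).comp measurable_fst) (measure_spanningSets_lt_top μ n).ne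
    (ENNReal.natCast_ne_top n) (fun _ => truncation_le_indicator_const _ F n) hc
  calc c * eLpNorm (T n) p μ ≤ ∫⁻ x, T n x * H (x, ()) ∂μ := hH.const_mul_eLpNorm_le ()
    _ ≤ ∫⁻ x, F x * H (x, ()) ∂μ := by
        gcongr
        exact truncation_le_self _ F n _
    _ ≤ A * eLpNorm (fun x => H (x, ())) p' μ := h _ (hH.measurable.comp measurable_prodMk_right)
    _ ≤ A := mul_le_of_le_one_right' (hH.eLpNorm_le_one ())

theorem IsNormingFamily.mixedENorm_mul_le {p p' c : ℝ≥0∞} {F H : X × Y → ℝ≥0∞}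
    (hH : IsNormingFamily μ p p' c F H) (q : ℝ≥0∞) (k : Y → ℝ≥0∞) :
    mixedENorm μ ν p' q (fun z => k z.2 * H z) ≤ eLpNorm k q ν :=
  eLpNorm_mono_ennreal _ fun y =>
    (eLpNorm_const_mul_le (hH.measurable.comp measurable_prodMk_right) (k y) p').trans
      (mul_le_of_le_one_right' (hH.eLpNorm_le_one y))

theorem IsNormingFamily.const_mul_lintegral_le [SFinite μ] [SFinite ν] {p p' c : ℝ≥0∞}
    {F H : X × Y → ℝ≥0∞} (hF : Measurable F) (hH : IsNormingFamily μ p p' c F H)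
    {k : Y → ℝ≥0∞} (hk : Measurable k) :
    c * ∫⁻ y, eLpNorm (fun x => F (x, y)) p μ * k y ∂ν ≤
      ∫⁻ z, F z * (k z.2 * H z) ∂(μ.prod ν) := by
  have hHk : Measurable fun z : X × Y => k z.2 * H z := (hk.comp measurable_snd).mul hH.measurable
  have hFH : ∀ y, Measurable fun x => F (x, y) * H (x, y) := fun y =>
    (hF.mul hH.measurable).comp measurable_prodMk_right
  rw [lintegral_prod_symm (fun z => F z * (k z.2 * H z)) (hF.mul hHk).aemeasurable,
    ← lintegral_const_mul _ (Measurable.fun_mul (measurable_eLpNorm_prodMk_right hF p) hk)]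
  refine lintegral_mono fun y => ?_
  simp only [← mul_assoc, mul_right_comm _ (k y)]
  rw [lintegral_mul_const _ (hFH y)]
  gcongr
  exact hH.const_mul_eLpNorm_le y

theorem mixedENorm_le_of_forall_lintegral_mul_le [SigmaFinite μ] [SigmaFinite ν]
    (p p' q q' : ℝ≥0∞) [p.HolderConjugate p'] [q.HolderConjugate q'] {F : X × Y → ℝ≥0∞}
    (hF : Measurable F) {A : ℝ≥0∞}
    (h : ∀ H : X × Y → ℝ≥0∞, Measurable H →
      ∫⁻ z, F z * H z ∂(μ.prod ν) ≤ A * mixedENorm μ ν p' q' H) :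
    mixedENorm μ ν p q F ≤ A := by
  set B : ℕ → Set (X × Y) := fun n => Prod.fst ⁻¹' spanningSets μ n
  have hB : ∀ n, MeasurableSet (B n) := fun n => measurable_fst (measurableSet_spanningSets μ n)
  have hBm : Monotone B := fun a b hab => Set.preimage_mono (monotone_spanningSets μ hab)
  have hBU : ⋃ n, B n = Set.univ := by
    rw [← Set.preimage_iUnion, iUnion_spanningSets, Set.preimage_univ]
  have hT := measurable_truncation hB hF
  rw [show F = fun z => ⨆ n, truncation B F n z from
    funext fun z => (iSup_truncation hBm hBU F z).symm,
    mixedENorm_iSup hT (monotone_truncation hBm F)]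
  refine iSup_le fun n => eLpNorm_le_of_forall_lintegral_mul_le q q'
    (measurable_eLpNorm_prodMk_right (hT n) p) fun k hk =>
      ENNReal.le_of_forall_lt_one_mul_le fun c hc => ?_
  obtain ⟨H, hH⟩ := exists_isNormingFamily (μ := μ) p p' (hT n)
    (measure_spanningSets_lt_top μ n).ne (ENNReal.natCast_ne_top n)
    (fun y x => truncation_le_indicator_const B F n (x, y)) hc
  calc c * ∫⁻ y, eLpNorm (fun x => truncation B F n (x, y)) p μ * k y ∂ν
      ≤ ∫⁻ z, truncation B F n z * (k z.2 * H z) ∂(μ.prod ν) := hH.const_mul_lintegral_le (hT n) hk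
    _ ≤ ∫⁻ z, F z * (k z.2 * H z) ∂(μ.prod ν) := by
        gcongr
        exact truncation_le_self B F n _
    _ ≤ A * mixedENorm μ ν p' q' (fun z => k z.2 * H z) :=
        h _ ((hk.comp measurable_snd).mul hH.measurable)
    _ ≤ A * eLpNorm k q' ν := by
        gcongr
        exact hH.mixedENorm_mul_le q' k

theorem mixedENorm_le_of_forall_bounded [SigmaFinite μ] [SigmaFinite ν]
    (p p' q q' : ℝ≥0∞) [p.HolderConjugate p'] [q.HolderConjugate q'] {F : X × Y → ℝ≥0∞}
    (hF : Measurable F) {A : ℝ≥0∞} {B : ℕ → Set (X × Y)} (hB : ∀ n, MeasurableSet (B n))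
    (hm : Monotone B) (hU : ⋃ n, B n = Set.univ)
    (h : ∀ H : X × Y → ℝ≥0∞, Measurable H → ∀ n : ℕ, (H ≤ (B n).indicator fun _ => (n : ℝ≥0∞)) →
      ∫⁻ z, F z * H z ∂(μ.prod ν) ≤ A * mixedENorm μ ν p' q' H) :
    mixedENorm μ ν p q F ≤ A := by
  refine mixedENorm_le_of_forall_lintegral_mul_le p p' q q' hF fun H hH => ?_
  have mul_eq_iSup : ∀ z, F z * H z = ⨆ n, F z * truncation B H n z := fun z => by
    rw [← ENNReal.mul_iSup, iSup_truncation hm hU]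
  have hT := measurable_truncation hB hH
  simp only [mul_eq_iSup]
  rw [lintegral_iSup (f := fun n z => F z * truncation B H n z) (fun n => hF.mul (hT n))
    fun a b hab z => mul_le_mul_right (monotone_truncation hm H hab z) _]
  refine iSup_le fun n => (h _ (hT n) n (truncation_le_indicator_const B H n)).trans ?_
  gcongr
  exact mixedENorm_mono _ _ (truncation_le_self B H n)

theorem eLpNorm_lintegral_le_lintegral_eLpNorm [SigmaFinite μ] [SFinite ν] {p : ℝ≥0∞} (hp : 1 ≤ p)
    {F : X × Y → ℝ≥0∞} (hF : Measurable F) :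
    eLpNorm (fun x => ∫⁻ y, F (x, y) ∂ν) p μ ≤ ∫⁻ y, eLpNorm (fun x => F (x, y)) p μ ∂ν := by
  have := ENNReal.HolderConjugate.conjExponent hp
  refine eLpNorm_le_of_forall_lintegral_mul_le p p.conjExponent hF.lintegral_prod_right'
    fun H hH => ?_
  have hFH : Measurable fun z : X × Y => F z * H z.1 := hF.mul (hH.comp measurable_fst)
  calc ∫⁻ x, (∫⁻ y, F (x, y) ∂ν) * H x ∂μ = ∫⁻ x, ∫⁻ y, F (x, y) * H x ∂ν ∂μ :=
        lintegral_congr fun x =>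
          (lintegral_mul_const _ (hF.comp measurable_prodMk_left)).symm
    _ = ∫⁻ y, ∫⁻ x, F (x, y) * H x ∂μ ∂ν := lintegral_lintegral_swap hFH.aemeasurable
    _ ≤ ∫⁻ y, eLpNorm (fun x => F (x, y)) p μ * eLpNorm H p.conjExponent μ ∂ν :=
        lintegral_mono fun y => lintegral_mul_le_eLpNorm_mul_eLpNorm p _
          (hF.comp measurable_prodMk_right) hH
    _ = _ := lintegral_mul_const _ (measurable_eLpNorm_prodMk_right hF p)

end MixedNorm

section Young

variable {X Y : Type*} [MeasurableSpace X] [AddCommGroup X] [MeasurableAdd₂ X] [MeasurableNeg X]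
  [MeasurableSpace Y] {μ : Measure X} {ν : Measure Y}

theorem eLpNorm_top_lconvolution_le [μ.IsAddLeftInvariant] [μ.IsNegInvariant] {N w : X → ℝ≥0∞}
    (hN : Measurable N) (hw : Measurable w) (p p' : ℝ≥0∞) [p.HolderConjugate p'] :
    eLpNorm (N ⋆ₗ[μ] w) ∞ μ ≤ eLpNorm w p' μ * eLpNorm N p μ := by
  refine eLpNorm_top_le_iff.2 (.of_forall fun x => ?_)
  have hwx : eLpNorm (fun y => w (-y + x)) p' μ = eLpNorm w p' μ := by
    simpa only [Function.comp_def, neg_add_eq_sub] using eLpNorm_comp_measurePreserving (p := p')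
      hw.aestronglyMeasurable (Measure.measurePreserving_sub_left μ x)
  rw [← hwx, mul_comm]
  exact lintegral_mul_le_eLpNorm_mul_eLpNorm p p' hN
    (hw.comp (measurable_neg.add measurable_const))

variable [SigmaFinite μ] [SigmaFinite ν]

theorem measurable_lconvolution_prodMk {V : X × Y → ℝ≥0∞} (hV : Measurable V) {v : X → ℝ≥0∞}
    (hv : Measurable v) :
    Measurable fun z : X × Y => ((fun x' => V (x', z.2)) ⋆ₗ[μ] v) z.1 :=
  Measurable.lintegral_prod_right' (f := fun t : (X × Y) × X => V (t.2, t.1.2) * v (-t.2 + t.1.1))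
    ((hV.comp (by fun_prop)).mul (hv.comp (by fun_prop)))

variable [AddCommGroup Y] [MeasurableAdd₂ Y] [MeasurableNeg Y]

theorem lconvolution_tensor_apply {V : X × Y → ℝ≥0∞} (hV : Measurable V) {v : X → ℝ≥0∞}
    (hv : Measurable v) {w : Y → ℝ≥0∞} (hw : Measurable w) (x : X) (y : Y) :
    (V ⋆ₗ[μ.prod ν] fun z => v z.1 * w z.2) (x, y) =
      ∫⁻ y', ((fun x' => V (x', y')) ⋆ₗ[μ] v) x * w (-y' + y) ∂ν := by
  have hvx : Measurable fun x' => v (-x' + x) := hv.comp (measurable_neg.add measurable_const)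
  have hwy : Measurable fun y' => w (-y' + y) := hw.comp (measurable_neg.add measurable_const)
  refine (lintegral_prod_symm (fun z : X × Y => V z * (v (-z.1 + x) * w (-z.2 + y)))
    (hV.mul ((hvx.comp measurable_fst).mul (hwy.comp measurable_snd))).aemeasurable).trans ?_
  refine lintegral_congr fun y' => ?_
  simp only [← mul_assoc, lconvolution_def]
  exact lintegral_mul_const _ ((hV.comp measurable_prodMk_right).mul hvx)

variable [μ.IsAddLeftInvariant] [μ.IsNegInvariant]

theorem eLpNorm_lconvolution_le_eLpNorm_one_mul {N w : X → ℝ≥0∞} (hN : Measurable N)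
    (hw : Measurable w) {p : ℝ≥0∞} (hp : 1 ≤ p) :
    eLpNorm (N ⋆ₗ[μ] w) p μ ≤ eLpNorm w 1 μ * eLpNorm N p μ := by
  have hNu : ∀ u, eLpNorm (fun x => N (-u + x)) p μ = eLpNorm N p μ := fun u =>
    eLpNorm_comp_measurePreserving hN.aestronglyMeasurable (measurePreserving_add_left μ (-u))
  have hF : Measurable fun z : X × X => w z.2 * N (-z.2 + z.1) :=
    (hw.comp measurable_snd).mul (hN.comp (measurable_snd.neg.add measurable_fst))
  rw [lconvolution_comm]
  calc eLpNorm (w ⋆ₗ[μ] N) p μ ≤ ∫⁻ u, eLpNorm (fun x => w u * N (-u + x)) p μ ∂μ :=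
        eLpNorm_lintegral_le_lintegral_eLpNorm (F := fun z => w z.2 * N (-z.2 + z.1)) hp hF
    _ ≤ ∫⁻ u, w u * eLpNorm N p μ ∂μ := lintegral_mono fun u =>
        (eLpNorm_const_mul_le (hN.comp (measurable_const_add _)) _ _).trans_eq
          (congrArg (w u * ·) (hNu u))
    _ = eLpNorm w 1 μ * eLpNorm N p μ := by rw [eLpNorm_ennreal_one, lintegral_mul_const _ hw]

theorem eLpNorm_lconvolution_le {N w : X → ℝ≥0∞} (hN : Measurable N) (hw : Measurable w)
    {p p' : ℝ≥0∞} [p.HolderConjugate p'] {r : ℝ≥0∞} (hpr : p ≤ r) :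
    eLpNorm (N ⋆ₗ[μ] w) r μ ≤ (eLpNorm w p' μ + eLpNorm w 1 μ) * eLpNorm N p μ := by
  refine (eLpNorm_le_eLpNorm_top_add (ENNReal.HolderConjugate.pos p p').ne' hpr).trans ?_
  rw [add_mul]
  exact add_le_add (eLpNorm_top_lconvolution_le hN hw p p')
    (eLpNorm_lconvolution_le_eLpNorm_one_mul hN hw (ENNReal.HolderConjugate.one_le p p'))

theorem eLpNorm_lconvolution_tensor_le {V : X × Y → ℝ≥0∞} (hV : Measurable V) {v : X → ℝ≥0∞}
    (hv : Measurable v) {w : Y → ℝ≥0∞} (hw : Measurable w) {p p' r : ℝ≥0∞} [p.HolderConjugate p']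
    (hpr : p ≤ r) (y : Y) :
    eLpNorm (fun x => (V ⋆ₗ[μ.prod ν] fun z => v z.1 * w z.2) (x, y)) r μ ≤
      (eLpNorm v p' μ + eLpNorm v 1 μ) *
        ((fun y' => eLpNorm (fun x => V (x, y')) p μ) ⋆ₗ[ν] w) y := by
  have hr : 1 ≤ r := (ENNReal.HolderConjugate.one_le p p').trans hpr
  have hwy : Measurable fun y' => w (-y' + y) := hw.comp (measurable_neg.add measurable_const)
  have hG := measurable_lconvolution_prodMk (μ := μ) hV hv
  simp only [lconvolution_tensor_apply hV hv hw]
  refine (eLpNorm_lintegral_le_lintegral_eLpNorm hr (F := fun z : X × Y =>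
    ((fun x' => V (x', z.2)) ⋆ₗ[μ] v) z.1 * w (-z.2 + y))
    (hG.mul (hwy.comp measurable_snd))).trans ?_
  rw [lconvolution_def,
    ← lintegral_const_mul _ ((measurable_eLpNorm_prodMk_right hV p).fun_mul hwy)]
  refine lintegral_mono fun y' => ?_
  simp only [mul_comm _ (w (-y' + y)), mul_left_comm _ (w (-y' + y))]
  refine (eLpNorm_const_mul_le (hG.comp measurable_prodMk_right) _ _).trans ?_
  gcongr
  exact eLpNorm_lconvolution_le (hV.comp measurable_prodMk_right) hv hpr

variable [ν.IsAddLeftInvariant] [ν.IsNegInvariant]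

theorem mixedENorm_lconvolution_tensor_le {V : X × Y → ℝ≥0∞} (hV : Measurable V) {v : X → ℝ≥0∞}
    (hv : Measurable v) {w : Y → ℝ≥0∞} (hw : Measurable w) {p p' q q' r s : ℝ≥0∞}
    [p.HolderConjugate p'] [q.HolderConjugate q'] (hpr : p ≤ r) (hqs : q ≤ s) :
    mixedENorm μ ν r s (V ⋆ₗ[μ.prod ν] fun z => v z.1 * w z.2) ≤
      (eLpNorm v p' μ + eLpNorm v 1 μ) *
        ((eLpNorm w q' ν + eLpNorm w 1 ν) * mixedENorm μ ν p q V) := by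
  have hN := measurable_eLpNorm_prodMk_right (μ := μ) hV p
  calc mixedENorm μ ν r s (V ⋆ₗ[μ.prod ν] fun z => v z.1 * w z.2)
      ≤ eLpNorm (fun y => (eLpNorm v p' μ + eLpNorm v 1 μ) *
          ((fun y' => eLpNorm (fun x => V (x, y')) p μ) ⋆ₗ[ν] w) y) s ν :=
        eLpNorm_mono_ennreal s (eLpNorm_lconvolution_tensor_le hV hv hw hpr)
    _ ≤ (eLpNorm v p' μ + eLpNorm v 1 μ) *
          eLpNorm ((fun y' => eLpNorm (fun x => V (x, y')) p μ) ⋆ₗ[ν] w) s ν :=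
        eLpNorm_const_mul_le (measurable_lconvolution ν hN hw) _ _
    _ ≤ _ := by
        gcongr
        exact eLpNorm_lconvolution_le hN hw hqs

end Young

/-! ### Integrals with values in Schwartz space -/

section SchwartzIntegral

open Filter Topology

theorem exists_clm_comp_eq_of_norm_le {𝕜 V W : Type*} [RCLike 𝕜] [AddCommGroup V]
    [Module 𝕜 V] [NormedAddCommGroup W] [NormedSpace 𝕜 W] (f : V →ₗ[𝕜] 𝕜) (J : V →ₗ[𝕜] W) (C : ℝ)
    (h : ∀ v, ‖f v‖ ≤ C * ‖J v‖) : ∃ g : W →L[𝕜] 𝕜, ∀ v, g (J v) = f v := by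
  have hker : LinearMap.ker J ≤ LinearMap.ker f := fun v hv => by
    rw [LinearMap.mem_ker] at hv ⊢
    simpa only [hv, norm_zero, mul_zero, norm_le_zero_iff] using h v
  let f₀ : LinearMap.range J →ₗ[𝕜] 𝕜 :=
    (LinearMap.ker J).liftQ f hker ∘ₗ J.quotKerEquivRange.symm.toLinearMap
  have hf₀ (v : V) : f₀ ⟨J v, LinearMap.mem_range_self J v⟩ = f v := by
    simp only [f₀, LinearMap.comp_apply, LinearEquiv.coe_coe,
      LinearMap.quotKerEquivRange_symm_apply_image, Submodule.liftQ_apply, Submodule.mkQ_apply]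
  obtain ⟨g, hg, -⟩ := exists_extension_norm_eq (LinearMap.range J) (f₀.mkContinuous C (by
    rintro ⟨_, v, rfl⟩
    exact (congrArg norm (hf₀ v)).trans_le (h v)))
  exact ⟨g, fun v => (hg ⟨J v, LinearMap.mem_range_self J v⟩).trans (hf₀ v)⟩

variable {E : Type*} [NormedAddCommGroup E] [NormedSpace ℝ E]

/-- The space of `l`-th derivatives of complex functions on `E`. A type synonym of the continuous
multilinear maps, so that the topology comes from the norm without unfolding. -/
def DerivSpace (E : Type*) [NormedAddCommGroup E] [NormedSpace ℝ E] (l : ℕ) : Type _ :=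
  ContinuousMultilinearMap ℝ (fun _ : Fin l => E) ℂ

noncomputable instance (l : ℕ) : NormedAddCommGroup (DerivSpace E l) :=
  inferInstanceAs (NormedAddCommGroup (ContinuousMultilinearMap ℝ (fun _ : Fin l => E) ℂ))

noncomputable instance (l : ℕ) : NormedSpace ℝ (DerivSpace E l) :=
  inferInstanceAs (NormedSpace ℝ (ContinuousMultilinearMap ℝ (fun _ : Fin l => E) ℂ))

noncomputable instance (l : ℕ) : NormedSpace ℂ (DerivSpace E l) :=
  inferInstanceAs (NormedSpace ℂ (ContinuousMultilinearMap ℝ (fun _ : Fin l => E) ℂ))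

instance (l : ℕ) : SMulCommClass ℝ ℂ (DerivSpace E l) :=
  inferInstanceAs (SMulCommClass ℝ ℂ (ContinuousMultilinearMap ℝ (fun _ : Fin l => E) ℂ))

instance (l : ℕ) : CompleteSpace (DerivSpace E l) :=
  inferInstanceAs (CompleteSpace (ContinuousMultilinearMap ℝ (fun _ : Fin l => E) ℂ))

/-- The `l`-th derivative of a Schwartz function, with values in `DerivSpace`. -/
noncomputable def schwartzDeriv (l : ℕ) (φ : 𝓢(E, ℂ)) (t : E) : DerivSpace E l :=
  iteratedFDeriv ℝ l φ t

theorem continuous_schwartzDeriv (l : ℕ) (φ : 𝓢(E, ℂ)) : Continuous (schwartzDeriv l φ) :=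
  (φ.smooth l).continuous_iteratedFDeriv le_rfl

theorem schwartzDeriv_add (l : ℕ) (φ ψ : 𝓢(E, ℂ)) (t : E) :
    schwartzDeriv l (φ + ψ) t = schwartzDeriv l φ t + schwartzDeriv l ψ t :=
  iteratedFDeriv_add_apply (φ.smooth l).contDiffAt (ψ.smooth l).contDiffAt

theorem schwartzDeriv_sub (l : ℕ) (φ ψ : 𝓢(E, ℂ)) (t : E) :
    schwartzDeriv l (φ - ψ) t = schwartzDeriv l φ t - schwartzDeriv l ψ t :=
  iteratedFDeriv_sub_apply (φ.smooth l).contDiffAt (ψ.smooth l).contDiffAt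

theorem schwartzDeriv_smul (l : ℕ) (a : ℂ) (φ : 𝓢(E, ℂ)) (t : E) :
    schwartzDeriv l (a • φ) t = a • schwartzDeriv l φ t :=
  iteratedFDeriv_const_smul_apply (φ.smooth l).contDiffAt

/-- The weighted derivative `t ↦ ‖t‖ ^ k • D^l φ(t)` as a bounded continuous function. -/
noncomputable def weightedDeriv (E : Type*) [NormedAddCommGroup E] [NormedSpace ℝ E] (k l : ℕ) :
    𝓢(E, ℂ) →L[ℂ] BoundedContinuousFunction E (DerivSpace E l) :=
  SchwartzMap.mkCLMtoNormedSpace (σ := RingHom.id ℂ)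
    (fun φ => BoundedContinuousFunction.ofNormedAddCommGroup
      (fun t => ‖t‖ ^ k • schwartzDeriv l φ t)
      ((continuous_norm.pow k).smul (continuous_schwartzDeriv l φ))
      (SchwartzMap.seminorm ℂ k l φ)
      fun t => by
        rw [norm_smul, norm_pow, norm_norm]
        exact SchwartzMap.le_seminorm ℂ k l φ t)
    (fun φ ψ => by
      ext1 t
      simp only [BoundedContinuousFunction.coe_ofNormedAddCommGroup,
        BoundedContinuousFunction.coe_add, Pi.add_apply, schwartzDeriv_add, smul_add])
    (fun a φ => by
      ext1 t
      simp only [BoundedContinuousFunction.coe_ofNormedAddCommGroup,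
        BoundedContinuousFunction.coe_smul, RingHom.id_apply]
      rw [schwartzDeriv_smul, smul_comm])
    ⟨{(k, l)}, 1, zero_le_one, fun φ => by
      rw [one_mul, Finset.sup_singleton]
      exact BoundedContinuousFunction.norm_ofNormedAddCommGroup_le _ (apply_nonneg _ _) _⟩

theorem weightedDeriv_apply (k l : ℕ) (φ : 𝓢(E, ℂ)) (t : E) :
    weightedDeriv E k l φ t = ‖t‖ ^ k • schwartzDeriv l φ t := rfl

theorem norm_weightedDeriv (k l : ℕ) (φ : 𝓢(E, ℂ)) :
    ‖weightedDeriv E k l φ‖ = SchwartzMap.seminorm ℂ k l φ := by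
  have hnorm (t : E) : ‖weightedDeriv E k l φ t‖ = ‖t‖ ^ k * ‖iteratedFDeriv ℝ l φ t‖ := by
    rw [weightedDeriv_apply, norm_smul, norm_pow, norm_norm, schwartzDeriv]
    rfl
  refine le_antisymm ((BoundedContinuousFunction.norm_le (apply_nonneg _ _)).2 fun t => ?_) ?_
  · exact (hnorm t).trans_le (SchwartzMap.le_seminorm ℂ k l φ t)
  · exact SchwartzMap.seminorm_le_bound ℂ k l φ (norm_nonneg _) fun t =>
      (hnorm t).ge.trans ((weightedDeriv E k l φ).norm_coe_le_norm t)

theorem exists_eq_sum_weightedDeriv (f : 𝓢(E, ℂ) →L[ℂ] ℂ) :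
    ∃ (s : Finset (ℕ × ℕ)) (g : ∀ i : s, BoundedContinuousFunction E (DerivSpace E i.1.2) →L[ℂ] ℂ),
      ∀ φ, f φ = ∑ i : s, g i (weightedDeriv E i.1.1 i.1.2 φ) := by
  classical
  obtain ⟨s, C, -, hC⟩ := Seminorm.bound_of_continuous (schwartz_withSeminorms ℂ E ℂ)
    ((normSeminorm ℂ ℂ).comp f.toLinearMap) (continuous_norm.comp f.continuous)
  let J : 𝓢(E, ℂ) →ₗ[ℂ] (∀ i : s, BoundedContinuousFunction E (DerivSpace E i.1.2)) :=
    LinearMap.pi fun i => (weightedDeriv E i.1.1 i.1.2).toLinearMap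
  have hJ (φ : 𝓢(E, ℂ)) : ‖f φ‖ ≤ C * ‖J φ‖ := by
    refine (hC φ).trans (mul_le_mul_of_nonneg_left ?_ C.2)
    exact Seminorm.finset_sup_apply_le (norm_nonneg _) fun i hi =>
      (norm_weightedDeriv i.1 i.2 φ).symm.trans_le (norm_le_pi_norm (J φ) ⟨i, hi⟩)
  obtain ⟨g, hg⟩ := exists_clm_comp_eq_of_norm_le f.toLinearMap J C hJ
  refine ⟨s, fun i => g ∘L ContinuousLinearMap.single ℂ
    (fun i : s => BoundedContinuousFunction E (DerivSpace E i.1.2)) i, fun φ => ?_⟩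
  simp only [ContinuousLinearMap.comp_apply]
  rw [← map_sum]
  exact (hg φ).symm.trans (congrArg g (Finset.univ_sum_single (J φ)).symm)

variable {Z : Type*} [MeasurableSpace Z] {ν : Measure Z}

/-- Absolute integrability of a function with values in Schwartz space, tested on the weighted
derivatives, which generate the topology. -/
def SchwartzIntegrable (K : Z → 𝓢(E, ℂ)) (ν : Measure Z) : Prop :=
  ∀ k l : ℕ, Integrable (fun z => weightedDeriv E k l (K z)) ν

/-- Currying of the first variable of a derivative. -/
noncomputable def curryDeriv (E : Type*) [NormedAddCommGroup E] [NormedSpace ℝ E] (l : ℕ) :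
    DerivSpace E (l + 1) ≃ₗᵢ[ℝ] (E →L[ℝ] DerivSpace E l) :=
  continuousMultilinearCurryLeftEquiv ℝ (fun _ : Fin (l + 1) => E) ℂ

theorem hasFDerivAt_schwartzDeriv (l : ℕ) (φ : 𝓢(E, ℂ)) (t : E) :
    HasFDerivAt (schwartzDeriv l φ) (curryDeriv E l (schwartzDeriv (l + 1) φ t)) t := by
  have hcurry : curryDeriv E l (schwartzDeriv (l + 1) φ t) = fderiv ℝ (iteratedFDeriv ℝ l φ) t := by
    rw [schwartzDeriv, iteratedFDeriv_succ_eq_comp_left]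
    exact LinearIsometryEquiv.apply_symm_apply _ _
  rw [hcurry]
  exact ((φ.smooth ⊤).differentiable_iteratedFDeriv
    (by exact_mod_cast WithTop.coe_lt_top l) t).hasFDerivAt

namespace SchwartzIntegrable

variable {K : Z → 𝓢(E, ℂ)}

theorem integrable_schwartzDeriv (hK : SchwartzIntegrable K ν) (l : ℕ) (t : E) :
    Integrable (fun z => schwartzDeriv l (K z) t) ν := by
  have hpointwise : Integrable (fun z => weightedDeriv E 0 l (K z) t) ν :=
    (BoundedContinuousFunction.evalCLM ℝ t).integrable_comp (hK 0 l)
  simpa only [weightedDeriv_apply, pow_zero, one_smul] using hpointwise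

theorem hasFDerivAt_integral (hK : SchwartzIntegrable K ν) (l : ℕ) (t : E) :
    HasFDerivAt (fun t => ∫ z, schwartzDeriv l (K z) t ∂ν)
      (curryDeriv E l (∫ z, schwartzDeriv (l + 1) (K z) t ∂ν)) t := by
  have hcurry : ∫ z, curryDeriv E l (schwartzDeriv (l + 1) (K z) t) ∂ν =
      curryDeriv E l (∫ z, schwartzDeriv (l + 1) (K z) t ∂ν) :=
    (curryDeriv E l).toContinuousLinearEquiv.toContinuousLinearMap.integral_comp_comm
      (hK.integrable_schwartzDeriv (l + 1) t)
  have hbound (z : Z) (t : E) :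
      ‖curryDeriv E l (schwartzDeriv (l + 1) (K z) t)‖ ≤ ‖weightedDeriv E 0 (l + 1) (K z)‖ := by
    rw [LinearIsometryEquiv.norm_map, norm_weightedDeriv]
    exact SchwartzMap.norm_iteratedFDeriv_le_seminorm ℂ (K z) (l + 1) t
  rw [← hcurry]
  exact hasFDerivAt_integral_of_dominated_of_fderiv_le (s := Set.univ) (𝕜 := ℝ)
    (F := fun t z => schwartzDeriv l (K z) t)
    (F' := fun t z => curryDeriv E l (schwartzDeriv (l + 1) (K z) t)) univ_mem
    (Eventually.of_forall fun t => (hK.integrable_schwartzDeriv l t).aestronglyMeasurable)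
    (hK.integrable_schwartzDeriv l t)
    ((curryDeriv E l).continuous.comp_aestronglyMeasurable
      (hK.integrable_schwartzDeriv (l + 1) t).aestronglyMeasurable)
    (Eventually.of_forall fun z t _ => hbound z t) (hK 0 (l + 1)).norm
    (Eventually.of_forall fun z t _ => hasFDerivAt_schwartzDeriv l (K z) t)

theorem iteratedFDeriv_integral (hK : SchwartzIntegrable K ν) (l : ℕ) (t : E) :
    iteratedFDeriv ℝ l (fun t => ∫ z, K z t ∂ν) t = ∫ z, schwartzDeriv l (K z) t ∂ν := by
  induction l generalizing t with
  | zero =>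
    rw [iteratedFDeriv_zero_eq_comp]
    exact ((continuousMultilinearCurryFin0 ℝ E ℂ).symm.toContinuousLinearEquiv
      |>.integral_comp_comm (μ := ν) fun z => K z t).symm
  | succ l ih =>
    rw [iteratedFDeriv_succ_eq_comp_left, Function.comp_apply]
    have hfderiv : fderiv ℝ (iteratedFDeriv ℝ l (fun t => ∫ z, K z t ∂ν)) t =
        curryDeriv E l (∫ z, schwartzDeriv (l + 1) (K z) t ∂ν) := by
      rw [funext ih]
      exact (hK.hasFDerivAt_integral l t).fderiv
    rw [hfderiv]
    exact (curryDeriv E l).symm_apply_apply _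

theorem differentiable_iteratedFDeriv_integral (hK : SchwartzIntegrable K ν) (l : ℕ) :
    Differentiable ℝ (iteratedFDeriv ℝ l (fun t => ∫ z, K z t ∂ν)) := by
  rw [funext (hK.iteratedFDeriv_integral l)]
  exact fun t => (hK.hasFDerivAt_integral l t).differentiableAt

theorem integral_weightedDeriv_apply (k l : ℕ) (t : E) :
    ∫ z, weightedDeriv E k l (K z) t ∂ν = ‖t‖ ^ k • ∫ z, schwartzDeriv l (K z) t ∂ν := by
  simp only [weightedDeriv_apply]
  exact integral_smul _ _

/-- The integral of a function with values in Schwartz space, taken pointwise. -/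
noncomputable def integral (hK : SchwartzIntegrable K ν) : 𝓢(E, ℂ) where
  toFun := fun t => ∫ z, K z t ∂ν
  smooth' := contDiff_of_differentiable_iteratedFDeriv
    fun m _ => hK.differentiable_iteratedFDeriv_integral m
  decay' := fun k l => ⟨∫ z, ‖weightedDeriv E k l (K z)‖ ∂ν, fun t => by
    calc ‖t‖ ^ k * ‖iteratedFDeriv ℝ l (fun t => ∫ z, K z t ∂ν) t‖
        = ‖∫ z, weightedDeriv E k l (K z) t ∂ν‖ := by
          rw [integral_weightedDeriv_apply, norm_smul, norm_pow, norm_norm,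
            hK.iteratedFDeriv_integral]
          rfl
      _ ≤ _ := norm_integral_le_of_norm_le (hK k l).norm
          (Eventually.of_forall fun z => BoundedContinuousFunction.norm_coe_le_norm _ t)⟩

theorem weightedDeriv_integral (hK : SchwartzIntegrable K ν) (k l : ℕ) :
    weightedDeriv E k l hK.integral = ∫ z, weightedDeriv E k l (K z) ∂ν := by
  ext1 t
  calc weightedDeriv E k l hK.integral t = ‖t‖ ^ k • ∫ z, schwartzDeriv l (K z) t ∂ν :=
        congrArg (‖t‖ ^ k • · : DerivSpace E l → DerivSpace E l) (hK.iteratedFDeriv_integral l t)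
    _ = ∫ z, weightedDeriv E k l (K z) t ∂ν := (integral_weightedDeriv_apply k l t).symm
    _ = (∫ z, weightedDeriv E k l (K z) ∂ν) t :=
        (BoundedContinuousFunction.evalCLM ℝ t).integral_comp_comm (hK k l)

theorem integrable_clm_apply (hK : SchwartzIntegrable K ν) (f : 𝓢(E, ℂ) →L[ℂ] ℂ) :
    Integrable (fun z => f (K z)) ν := by
  obtain ⟨s, g, hg⟩ := exists_eq_sum_weightedDeriv f
  simp only [hg]
  exact integrable_finsetSum _ fun i _ => (g i).integrable_comp (hK _ _)

theorem clm_apply_integral (hK : SchwartzIntegrable K ν) (f : 𝓢(E, ℂ) →L[ℂ] ℂ) :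
    f hK.integral = ∫ z, f (K z) ∂ν := by
  obtain ⟨s, g, hg⟩ := exists_eq_sum_weightedDeriv f
  simp only [hg, hK.weightedDeriv_integral]
  rw [integral_finsetSum _ fun i _ => (g i).integrable_comp (hK _ _)]
  exact Finset.sum_congr rfl fun i _ => ((g i).integral_comp_comm (hK _ _)).symm

theorem of_continuous [TopologicalSpace Z] [SecondCountableTopology Z]
    [OpensMeasurableSpace Z] (hK : Continuous K) {F : Z → ℂ} (hF : AEStronglyMeasurable F ν)
    (h : ∀ k l, ∃ b : Z → ℝ, Integrable b ν ∧
      ∀ z, ‖F z‖ * SchwartzMap.seminorm ℂ k l (K z) ≤ b z) :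
    SchwartzIntegrable (fun z => F z • K z) ν := by
  intro k l
  obtain ⟨b, hb, hbd⟩ := h k l
  refine hb.mono' ?_ (Eventually.of_forall fun z => ?_)
  · simp only [map_smul]
    exact hF.smul ((weightedDeriv E k l).continuous.comp hK).aestronglyMeasurable
  · rw [norm_weightedDeriv, map_smul_eq_mul]
    exact hbd z

end SchwartzIntegrable

end SchwartzIntegral

/-! ### Time-frequency shifts -/

section Translation

open Filter Topology

variable {V : Type*} [NormedAddCommGroup V] [NormedSpace ℝ V]

theorem continuous_sup_schwartzSeminormFamily (i : ℕ × ℕ) :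
    Continuous ((Finset.Iic i).sup (schwartzSeminormFamily ℂ V ℂ) : Seminorm ℂ 𝓢(V, ℂ)) :=
  Seminorm.continuous_finsetSup fun j _ => (schwartz_withSeminorms ℂ V ℂ).continuous_seminorm j

theorem tendsto_schwartz_of_seminorm {α : Type*} {f : Filter α} {u : α → 𝓢(V, ℂ)} {y : 𝓢(V, ℂ)}
    (h : ∀ k l, Tendsto (fun x => SchwartzMap.seminorm ℂ k l (u x - y)) f (𝓝 0)) :
    Tendsto u f (𝓝 y) := by
  rw [(schwartz_withSeminorms ℂ V ℂ).tendsto_nhds]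
  exact fun i ε hε => (h i.1 i.2).eventually_lt_const hε

theorem exists_seminorm_le_of_forall_schwartzSeminorm {α : Type*} {w : α → ℝ} (hw : ∀ a, 1 ≤ w a)
    {T : α → 𝓢(V, ℂ) → 𝓢(V, ℂ)}
    (h : ∀ k l, ∃ (N : ℕ) (Q : Seminorm ℂ 𝓢(V, ℂ)), Continuous Q ∧
      ∀ a φ, SchwartzMap.seminorm ℂ k l (T a φ) ≤ w a ^ N * Q φ)
    (P : Seminorm ℂ 𝓢(V, ℂ)) (hP : Continuous P) :
    ∃ (N : ℕ) (Q : Seminorm ℂ 𝓢(V, ℂ)), Continuous Q ∧ ∀ a φ, P (T a φ) ≤ w a ^ N * Q φ := by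
  obtain ⟨s, C, -, hC⟩ := Seminorm.bound_of_continuous (schwartz_withSeminorms ℂ V ℂ) P hP
  choose N Q hQ hle using h
  let Q' : Seminorm ℂ 𝓢(V, ℂ) := s.sup fun i => Q i.1 i.2
  have hQ' : Continuous Q' := Seminorm.continuous_finsetSup fun i _ => hQ i.1 i.2
  refine ⟨s.sup fun i => N i.1 i.2, C • Q', hQ'.const_smul C, fun a φ => (hC (T a φ)).trans ?_⟩
  have hw0 : 0 ≤ w a := zero_le_one.trans (hw a)
  have hsup : (s.sup (schwartzSeminormFamily ℂ V ℂ) : Seminorm ℂ 𝓢(V, ℂ)) (T a φ) ≤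
      (w a ^ s.sup fun i => N i.1 i.2) * Q' φ := by
    refine Seminorm.finset_sup_apply_le (by positivity) fun i hi => (hle i.1 i.2 a φ).trans ?_
    exact mul_le_mul (pow_le_pow_right₀ (hw a) (Finset.le_sup (f := fun i => N i.1 i.2) hi))
      (Seminorm.le_finset_sup_apply (p := fun i => Q i.1 i.2) hi) (apply_nonneg _ _) (by positivity)
  calc (C : ℝ) * (s.sup (schwartzSeminormFamily ℂ V ℂ) : Seminorm ℂ 𝓢(V, ℂ)) (T a φ)
      ≤ C * ((w a ^ s.sup fun i => N i.1 i.2) * Q' φ) := by gcongr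
    _ = (w a ^ s.sup fun i => N i.1 i.2) * (C * Q' φ) := by ring

theorem norm_pow_mul_norm_iteratedFDeriv_le (k l : ℕ) (φ : 𝓢(V, ℂ)) {t x : V} {A : ℝ}
    (h : ‖t‖ ≤ A * (1 + ‖x‖)) :
    ‖t‖ ^ k * ‖iteratedFDeriv ℝ l φ x‖ ≤
      A ^ k * (2 ^ k * (Finset.Iic (k, l)).sup (schwartzSeminormFamily ℂ V ℂ) φ) := by
  have hA : 0 ≤ A := nonneg_of_mul_nonneg_left ((norm_nonneg t).trans h) (by positivity)
  calc ‖t‖ ^ k * ‖iteratedFDeriv ℝ l φ x‖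
      ≤ (A * (1 + ‖x‖)) ^ k * ‖iteratedFDeriv ℝ l φ x‖ := by gcongr
    _ = A ^ k * ((1 + ‖x‖) ^ k * ‖iteratedFDeriv ℝ l φ x‖) := by rw [mul_pow, mul_assoc]
    _ ≤ _ := mul_le_mul_of_nonneg_left (SchwartzMap.one_add_le_sup_seminorm_apply (𝕜 := ℂ)
        (m := (k, l)) le_rfl le_rfl φ x) (by positivity)

theorem schwartzDeriv_compSubConst (l : ℕ) (φ : 𝓢(V, ℂ)) (a t : V) :
    schwartzDeriv l (SchwartzMap.compSubConstCLM ℂ a φ) t = schwartzDeriv l φ (t - a) :=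
  iteratedFDeriv_comp_sub l a t

theorem seminorm_compSubConst_le (k l : ℕ) (φ : 𝓢(V, ℂ)) (a : V) :
    SchwartzMap.seminorm ℂ k l (SchwartzMap.compSubConstCLM ℂ a φ) ≤
      (1 + ‖a‖) ^ k * (2 ^ k * (Finset.Iic (k, l)).sup (schwartzSeminormFamily ℂ V ℂ) φ) := by
  refine SchwartzMap.seminorm_le_bound ℂ k l _ (by positivity) fun t => ?_
  have hderiv : ‖iteratedFDeriv ℝ l (SchwartzMap.compSubConstCLM ℂ a φ) t‖ =
      ‖iteratedFDeriv ℝ l φ (t - a)‖ := congrArg norm (schwartzDeriv_compSubConst l φ a t)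
  rw [hderiv]
  refine norm_pow_mul_norm_iteratedFDeriv_le k l φ ?_
  nlinarith [norm_sub_norm_le t a, norm_nonneg a, norm_nonneg (t - a)]

theorem exists_seminorm_compSubConst_le (P : Seminorm ℂ 𝓢(V, ℂ)) (hP : Continuous P) :
    ∃ (N : ℕ) (Q : Seminorm ℂ 𝓢(V, ℂ)), Continuous Q ∧
      ∀ a φ, P (SchwartzMap.compSubConstCLM ℂ a φ) ≤ (1 + ‖a‖) ^ N * Q φ := by
  refine exists_seminorm_le_of_forall_schwartzSeminorm
    (fun a => le_add_of_nonneg_right (norm_nonneg a)) (fun k l => ?_) P hP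
  exact ⟨k, (2 ^ k : NNReal) • (Finset.Iic (k, l)).sup (schwartzSeminormFamily ℂ V ℂ),
    (continuous_sup_schwartzSeminormFamily (k, l)).const_smul (2 ^ k : NNReal),
    fun a φ => seminorm_compSubConst_le k l φ a⟩

theorem mul_norm_schwartzDeriv_sub_le (l : ℕ) (φ : 𝓢(V, ℂ)) {x y : V} {c M : ℝ} (hc : 0 ≤ c)
    (h : ∀ s ∈ segment ℝ x y, c * ‖iteratedFDeriv ℝ (l + 1) φ s‖ ≤ M) :
    c * ‖schwartzDeriv l φ y - schwartzDeriv l φ x‖ ≤ M * ‖y - x‖ := by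
  have hderiv (s : V) : HasFDerivAt (fun s => c • schwartzDeriv l φ s)
      (c • curryDeriv V l (schwartzDeriv (l + 1) φ s)) s :=
    (hasFDerivAt_schwartzDeriv l φ s).const_smul c
  have hmean := Convex.norm_image_sub_le_of_norm_hasFDerivWithin_le (𝕜 := ℝ)
    (f := fun s => c • schwartzDeriv l φ s) (C := M)
    (fun s _ => (hderiv s).hasFDerivWithinAt)
    (fun s hs => by
      rw [norm_smul, Real.norm_of_nonneg hc, LinearIsometryEquiv.norm_map]
      exact h s hs)
    (convex_segment x y) (left_mem_segment ℝ x y) (right_mem_segment ℝ x y)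
  rwa [← smul_sub, norm_smul, Real.norm_of_nonneg hc] at hmean

theorem norm_le_of_mem_segment_sub {a b t s : V} (hb : ‖b - a‖ ≤ 1)
    (hs : s ∈ segment ℝ (t - a) (t - b)) : ‖t‖ ≤ (2 + ‖a‖) * (1 + ‖s‖) := by
  have hdist : ‖s - (t - a)‖ ≤ 1 := by
    refine (norm_sub_le_of_mem_segment hs).trans ?_
    rwa [sub_sub_sub_cancel_left, norm_sub_rev]
  have htri : ‖t‖ ≤ ‖s‖ + ‖a‖ + ‖s - (t - a)‖ := by
    calc ‖t‖ = ‖s + a - (s - (t - a))‖ := by congr 1; abel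
      _ ≤ _ := (norm_sub_le _ _).trans (add_le_add_left (norm_add_le s a) _)
  nlinarith [norm_nonneg a, norm_nonneg s]

theorem seminorm_compSubConst_sub_le (k l : ℕ) (φ : 𝓢(V, ℂ)) (a : V) {b : V} (hb : ‖b - a‖ ≤ 1) :
    SchwartzMap.seminorm ℂ k l
      (SchwartzMap.compSubConstCLM ℂ b φ - SchwartzMap.compSubConstCLM ℂ a φ) ≤
      ((2 + ‖a‖) ^ k * (2 ^ k * (Finset.Iic (k, l + 1)).sup (schwartzSeminormFamily ℂ V ℂ) φ)) *
        ‖b - a‖ := by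
  refine SchwartzMap.seminorm_le_bound ℂ k l _ (by positivity) fun t => ?_
  have hderiv : ‖iteratedFDeriv ℝ l
      (SchwartzMap.compSubConstCLM ℂ b φ - SchwartzMap.compSubConstCLM ℂ a φ : 𝓢(V, ℂ)) t‖ =
      ‖schwartzDeriv l φ (t - b) - schwartzDeriv l φ (t - a)‖ := by
    rw [← schwartzDeriv_compSubConst, ← schwartzDeriv_compSubConst, ← schwartzDeriv_sub]
    rfl
  have hnorm : ‖b - a‖ = ‖(t - b) - (t - a)‖ := by rw [sub_sub_sub_cancel_left, norm_sub_rev]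
  rw [hderiv, hnorm]
  exact mul_norm_schwartzDeriv_sub_le l φ (by positivity) fun s hs =>
    norm_pow_mul_norm_iteratedFDeriv_le k (l + 1) φ (norm_le_of_mem_segment_sub hb hs)

theorem continuous_compSubConst (φ : 𝓢(V, ℂ)) :
    Continuous fun a : V => SchwartzMap.compSubConstCLM ℂ a φ := by
  refine continuous_iff_continuousAt.2 fun a => tendsto_schwartz_of_seminorm fun k l => ?_
  have hlim : Tendsto (fun b : V => ((2 + ‖a‖) ^ k * (2 ^ k *
      (Finset.Iic (k, l + 1)).sup (schwartzSeminormFamily ℂ V ℂ) φ)) * ‖b - a‖) (𝓝 a) (𝓝 0) := by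
    simpa only [mul_zero] using (tendsto_norm_sub_self a).const_mul _
  refine squeeze_zero' (Eventually.of_forall fun _ => apply_nonneg _ _) ?_ hlim
  filter_upwards [Metric.closedBall_mem_nhds a one_pos] with b hb
  exact seminorm_compSubConst_sub_le k l φ a (mem_closedBall_iff_norm.1 hb)

end Translation

section TimeFrequency

open Filter Topology FourierTransform

variable {V : Type*} [NormedAddCommGroup V] [InnerProductSpace ℝ V] [FiniteDimensional ℝ V]
  [MeasurableSpace V] [BorelSpace V]

/-- The modulation `φ ↦ exp (2πi ⟨·, ω⟩) φ` of Schwartz functions, defined as the conjugate of a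
translation by the Fourier transform so that its continuity in `ω` follows from that of
translations; see `modulate_apply`. -/
noncomputable def modulate (ω : V) : 𝓢(V, ℂ) →L[ℂ] 𝓢(V, ℂ) :=
  fourierInvCLM ℂ 𝓢(V, ℂ) ∘L SchwartzMap.compSubConstCLM ℂ ω ∘L fourierCLM ℂ 𝓢(V, ℂ)

theorem modulate_apply (ω : V) (φ : 𝓢(V, ℂ)) (t : V) :
    modulate ω φ t = Complex.exp (Complex.I * (2 * Real.pi * inner ℝ t ω : ℝ)) * φ t := by
  have hmodulate : modulate ω φ = 𝓕⁻ (SchwartzMap.compSubConstCLM ℂ ω (𝓕 φ)) := rfl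
  have hinv : φ = 𝓕⁻ (𝓕 φ) := (fourierInv_fourier_eq φ).symm
  conv_rhs => rw [hinv]
  rw [hmodulate, SchwartzMap.fourierInv_coe, SchwartzMap.fourierInv_coe, Real.fourierInv_eq',
    Real.fourierInv_eq', ← integral_add_right_eq_self _ ω, ← integral_const_mul]
  refine integral_congr_ae (Eventually.of_forall fun x => ?_)
  simp only [SchwartzMap.compSubConstCLM_apply, add_sub_cancel_right, smul_eq_mul, ← mul_assoc,
    ← Complex.exp_add, inner_add_left, real_inner_comm ω t]
  congr 2
  push_cast
  ring

/-- The time-frequency shift by `z = (a, ω)`: translation by `a`, then modulation by `ω`. -/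
noncomputable def tfShift (z : V × V) : 𝓢(V, ℂ) →L[ℂ] 𝓢(V, ℂ) :=
  modulate z.2 ∘L SchwartzMap.compSubConstCLM ℂ z.1

theorem tfShift_apply (z : V × V) (φ : 𝓢(V, ℂ)) (t : V) :
    tfShift z φ t =
      Complex.exp (Complex.I * (2 * Real.pi * inner ℝ t z.2 : ℝ)) * φ (t - z.1) := by
  rw [tfShift, ContinuousLinearMap.comp_apply, modulate_apply, SchwartzMap.compSubConstCLM_apply]

theorem exists_seminorm_modulate_le (P : Seminorm ℂ 𝓢(V, ℂ)) (hP : Continuous P) :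
    ∃ (N : ℕ) (Q : Seminorm ℂ 𝓢(V, ℂ)), Continuous Q ∧
      ∀ ω φ, P (modulate ω φ) ≤ (1 + ‖ω‖) ^ N * Q φ := by
  obtain ⟨N, Q, hQ, h⟩ := exists_seminorm_compSubConst_le
    (P.comp (fourierInvCLM ℂ 𝓢(V, ℂ)).toLinearMap) (hP.comp (fourierInvCLM ℂ 𝓢(V, ℂ)).continuous)
  exact ⟨N, Q.comp (fourierCLM ℂ 𝓢(V, ℂ)).toLinearMap, hQ.comp (fourierCLM ℂ 𝓢(V, ℂ)).continuous,
    fun ω φ => h ω (fourierCLM ℂ 𝓢(V, ℂ) φ)⟩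

theorem continuous_modulate (φ : 𝓢(V, ℂ)) : Continuous fun ω : V => modulate ω φ :=
  (fourierInvCLM ℂ 𝓢(V, ℂ)).continuous.comp (continuous_compSubConst (fourierCLM ℂ 𝓢(V, ℂ) φ))

theorem exists_seminorm_tfShift_le (P : Seminorm ℂ 𝓢(V, ℂ)) (hP : Continuous P) :
    ∃ (N : ℕ) (Q : Seminorm ℂ 𝓢(V, ℂ)), Continuous Q ∧
      ∀ z φ, P (tfShift z φ) ≤ (1 + ‖z‖) ^ N * Q φ := by
  obtain ⟨N, Q, hQ, hmod⟩ := exists_seminorm_modulate_le P hP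
  obtain ⟨N', Q', hQ', htrans⟩ := exists_seminorm_compSubConst_le Q hQ
  refine ⟨N + N', Q', hQ', fun z φ => ?_⟩
  calc P (tfShift z φ)
      ≤ (1 + ‖z.2‖) ^ N * ((1 + ‖z.1‖) ^ N' * Q' φ) :=
        (hmod z.2 _).trans (mul_le_mul_of_nonneg_left (htrans z.1 φ) (by positivity))
    _ ≤ (1 + ‖z‖) ^ N * ((1 + ‖z‖) ^ N' * Q' φ) := by
        have := apply_nonneg Q' φ
        gcongr
        exacts [norm_snd_le z, norm_fst_le z]
    _ = (1 + ‖z‖) ^ (N + N') * Q' φ := by rw [pow_add, mul_assoc]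

theorem continuous_tfShift (φ : 𝓢(V, ℂ)) : Continuous fun z : V × V => tfShift z φ := by
  refine continuous_iff_continuousAt.2 fun z => tendsto_schwartz_of_seminorm fun k l => ?_
  have hp : Continuous (SchwartzMap.seminorm ℂ k l : Seminorm ℂ 𝓢(V, ℂ)) :=
    (schwartz_withSeminorms ℂ V ℂ).continuous_seminorm (k, l)
  obtain ⟨N, Q, hQ, hmod⟩ := exists_seminorm_modulate_le (V := V) _ hp
  set ψ := SchwartzMap.compSubConstCLM ℂ z.1 φ
  have hbound (y : V × V) : SchwartzMap.seminorm ℂ k l (tfShift y φ - tfShift z φ) ≤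
      (1 + ‖y.2‖) ^ N * Q (SchwartzMap.compSubConstCLM ℂ y.1 φ - ψ) +
        SchwartzMap.seminorm ℂ k l (modulate y.2 ψ - modulate z.2 ψ) := by
    have hsplit : tfShift y φ - tfShift z φ =
        modulate y.2 (SchwartzMap.compSubConstCLM ℂ y.1 φ - ψ) +
          (modulate y.2 ψ - modulate z.2 ψ) := by
      rw [map_sub, sub_add_sub_cancel]
      rfl
    rw [hsplit]
    exact (map_add_le_add _ _ _).trans (add_le_add_left (hmod y.2 _) _)
  have hcont : Continuous fun y : V × V =>
      (1 + ‖y.2‖) ^ N * Q (SchwartzMap.compSubConstCLM ℂ y.1 φ - ψ) +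
        SchwartzMap.seminorm ℂ k l (modulate y.2 ψ - modulate z.2 ψ) :=
    ((by fun_prop : Continuous fun y : V × V => (1 + ‖y.2‖) ^ N).mul
      (hQ.comp (((continuous_compSubConst φ).comp continuous_fst).sub continuous_const))).add
      (hp.comp (((continuous_modulate ψ).comp continuous_snd).sub continuous_const))
  have hlim := hcont.tendsto z
  rw [sub_self, sub_self, map_zero, map_zero, mul_zero, add_zero] at hlim
  exact squeeze_zero (fun _ => apply_nonneg _ _) hbound hlim

end TimeFrequency

section Decay

open Filter

theorem exists_continuous_seminorm_eq_mul {E : Type*} [AddCommGroup E] [Module ℂ E]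
    [TopologicalSpace E] {c : ℝ} (hc : 0 ≤ c) {Q : Seminorm ℂ E} (hQ : Continuous Q) :
    ∃ P : Seminorm ℂ E, Continuous P ∧ ∀ x, P x = c * Q x :=
  ⟨c.toNNReal • Q, hQ.const_smul c.toNNReal, fun x => by
    rw [smul_apply, NNReal.smul_def, Real.coe_toNNReal c hc, smul_eq_mul]⟩

theorem le_mul_one_add_norm_rpow_neg {E : Type*} [NormedAddCommGroup E] {z : E} {N : ℕ} {a b : ℝ}
    (h : (1 + ‖z‖) ^ N * a ≤ b) : a ≤ b * (1 + ‖z‖) ^ (-(N : ℝ)) := by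
  have hpos : (0 : ℝ) < 1 + ‖z‖ := by positivity
  rw [Real.rpow_neg hpos.le, Real.rpow_natCast, ← div_eq_mul_inv, le_div_iff₀ (by positivity)]
  linarith

theorem exists_one_add_norm_map_le {E F : Type*} [NormedAddCommGroup E] [NormedSpace ℝ E]
    [NormedAddCommGroup F] [NormedSpace ℝ F] (L : E →L[ℝ] F) :
    ∃ c : ℝ, 0 ≤ c ∧ ∀ z, 1 + ‖L z‖ ≤ c * (1 + ‖z‖) := by
  refine ⟨1 + ‖L‖, by positivity, fun z => ?_⟩
  nlinarith [L.le_opNorm z, norm_nonneg z, norm_nonneg L]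

theorem one_add_norm_le_mul_sub {E : Type*} [NormedAddCommGroup E] (a t : E) :
    1 + ‖a‖ ≤ (1 + ‖t‖) * (1 + ‖t - a‖) := by
  have htri : ‖a‖ ≤ ‖t‖ + ‖t - a‖ := by
    simpa only [sub_sub_cancel] using norm_sub_le t (t - a)
  nlinarith [norm_nonneg t, norm_nonneg (t - a)]

variable {V : Type*} [NormedAddCommGroup V] [NormedSpace ℝ V]

theorem one_add_norm_pow_mul_norm_le (k : ℕ) (φ : 𝓢(V, ℂ)) (x : V) :
    (1 + ‖x‖) ^ k * ‖φ x‖ ≤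
      2 ^ k * (Finset.Iic (k, 0)).sup (schwartzSeminormFamily ℂ V ℂ) φ := by
  have hseminorm := SchwartzMap.one_add_le_sup_seminorm_apply (𝕜 := ℂ) (m := (k, 0)) (k := k)
    (n := 0) le_rfl le_rfl φ x
  rwa [norm_iteratedFDeriv_zero] at hseminorm

theorem one_add_norm_pow_mul_norm_mul_norm_sub_le (N m : ℕ) (φ g : 𝓢(V, ℂ)) (a t : V) :
    (1 + ‖a‖) ^ N * (‖φ t‖ * ‖g (t - a)‖) ≤
      2 ^ (N + m) * (Finset.Iic (N + m, 0)).sup (schwartzSeminormFamily ℂ V ℂ) φ *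
        (2 ^ N * (Finset.Iic (N, 0)).sup (schwartzSeminormFamily ℂ V ℂ) g) *
          (1 + ‖t‖) ^ (-(m : ℝ)) := by
  refine le_mul_one_add_norm_rpow_neg ?_
  calc (1 + ‖t‖) ^ m * ((1 + ‖a‖) ^ N * (‖φ t‖ * ‖g (t - a)‖))
      ≤ (1 + ‖t‖) ^ m * (((1 + ‖t‖) * (1 + ‖t - a‖)) ^ N * (‖φ t‖ * ‖g (t - a)‖)) := by
        gcongr
        exact one_add_norm_le_mul_sub a t
    _ = ((1 + ‖t‖) ^ (N + m) * ‖φ t‖) * ((1 + ‖t - a‖) ^ N * ‖g (t - a)‖) := by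
        rw [mul_pow, pow_add]; ring
    _ ≤ _ := mul_le_mul (one_add_norm_pow_mul_norm_le (N + m) φ t)
        (one_add_norm_pow_mul_norm_le N g (t - a)) (by positivity) (by positivity)

end Decay

section ShortTimeFourier

open Filter FourierTransform

variable {V : Type*} [NormedAddCommGroup V] [InnerProductSpace ℝ V] [FiniteDimensional ℝ V]
  [MeasurableSpace V] [BorelSpace V]

/-- The `L²` inner product of Schwartz functions, linear in the first argument. -/
noncomputable def schwartzInner (φ ψ : 𝓢(V, ℂ)) : ℂ := ∫ t, φ t * conj (ψ t)

theorem integrable_mul_conj (φ ψ : 𝓢(V, ℂ)) : Integrable fun t => φ t * conj (ψ t) := by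
  refine (φ.integrable (μ := volume)).mul_bdd (c := SchwartzMap.seminorm ℂ 0 0 ψ)
    (Complex.continuous_conj.comp ψ.continuous).aestronglyMeasurable
    (Eventually.of_forall fun t => ?_)
  rw [RCLike.norm_conj]
  exact SchwartzMap.norm_le_seminorm ℂ ψ t

theorem conj_schwartzInner (φ ψ : 𝓢(V, ℂ)) : conj (schwartzInner φ ψ) = schwartzInner ψ φ := by
  simp only [schwartzInner, ← integral_conj, map_mul, Complex.conj_conj, mul_comm]

theorem schwartzInner_smul_left (c : ℂ) (φ ψ : 𝓢(V, ℂ)) :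
    schwartzInner (c • φ) ψ = c * schwartzInner φ ψ := by
  simp only [schwartzInner, smul_apply, smul_eq_mul, mul_assoc, integral_const_mul]

theorem schwartzInner_smul_right (c : ℂ) (φ ψ : 𝓢(V, ℂ)) :
    schwartzInner φ (c • ψ) = conj c * schwartzInner φ ψ := by
  rw [← conj_schwartzInner, schwartzInner_smul_left, map_mul, conj_schwartzInner]

theorem schwartzInner_self (γ : 𝓢(V, ℂ)) : schwartzInner γ γ = ((∫ t, ‖γ t‖ ^ 2 : ℝ) : ℂ) := by
  simp only [schwartzInner, ← integral_complex_ofReal, Complex.mul_conj, Complex.normSq_eq_norm_sq]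

theorem integral_norm_sq_pos {γ : 𝓢(V, ℂ)} (hγ : γ ≠ 0) : 0 < ∫ t, ‖γ t‖ ^ 2 := by
  have hint : Integrable fun t => ‖γ t‖ ^ 2 := by
    simpa only [norm_mul, RCLike.norm_conj, ← sq] using (integrable_mul_conj γ γ).norm
  obtain ⟨t, ht⟩ : ∃ t, γ t ≠ 0 := by
    by_contra! h
    exact hγ (SchwartzMap.ext h)
  exact integral_pos_of_integrable_nonneg_nonzero (x := t) (by have := γ.continuous; fun_prop)
    hint (fun t => sq_nonneg _) (by positivity)

theorem schwartzInner_fourier (φ ψ : 𝓢(V, ℂ)) :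
    schwartzInner (𝓕 φ) (𝓕 ψ) = schwartzInner φ ψ := by
  have hparseval := SchwartzMap.integral_inner_fourier_fourier ψ φ
  simp only [RCLike.inner_apply] at hparseval
  exact hparseval

theorem norm_schwartzInner_le {φ ψ g : 𝓢(V, ℂ)} {a : V} (h : ∀ t, ‖ψ t‖ = ‖g (t - a)‖) :
    ‖schwartzInner φ ψ‖ ≤ ∫ t, ‖φ t‖ * ‖g (t - a)‖ := by
  refine (norm_integral_le_integral_norm _).trans_eq ?_
  simp only [norm_mul, RCLike.norm_conj, h]

theorem integrable_norm_mul_norm_sub (φ g : 𝓢(V, ℂ)) (a : V) :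
    Integrable fun t => ‖φ t‖ * ‖g (t - a)‖ := by
  simpa only [norm_mul, RCLike.norm_conj, SchwartzMap.compSubConstCLM_apply] using
    (integrable_mul_conj φ (SchwartzMap.compSubConstCLM ℂ a g)).norm

theorem exists_seminorm_integral_norm_mul_norm_sub_le (g : 𝓢(V, ℂ)) (N : ℕ) :
    ∃ P : Seminorm ℂ 𝓢(V, ℂ), Continuous P ∧
      ∀ φ a, (1 + ‖a‖) ^ N * ∫ t, ‖φ t‖ * ‖g (t - a)‖ ≤ P φ := by
  set m := Module.finrank ℝ V + 1
  set I : ℝ := ∫ t : V, (1 + ‖t‖) ^ (-(m : ℝ))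
  have hint : Integrable (fun t : V => (1 + ‖t‖) ^ (-(m : ℝ))) :=
    integrable_one_add_norm (by simp [m])
  obtain ⟨P, hP, hP_apply⟩ := exists_continuous_seminorm_eq_mul
    (c := 2 ^ (N + m) * (2 ^ N * (Finset.Iic (N, 0)).sup (schwartzSeminormFamily ℂ V ℂ) g) * I)
    (mul_nonneg (by positivity) (integral_nonneg fun t => by positivity))
    (continuous_sup_schwartzSeminormFamily (V := V) (N + m, 0))
  refine ⟨P, hP, fun φ a => ?_⟩
  rw [hP_apply, ← integral_const_mul]
  refine (integral_mono ((integrable_norm_mul_norm_sub φ g a).const_mul _) (hint.const_mul _)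
    (one_add_norm_pow_mul_norm_mul_norm_sub_le N m φ g a)).trans_eq ?_
  rw [integral_const_mul]
  ring

theorem norm_exp_I_mul_ofReal (r : ℝ) : ‖Complex.exp (Complex.I * (r : ℂ))‖ = 1 := by
  rw [mul_comm, Complex.norm_exp_ofReal_mul_I]

theorem norm_tfShift (z : V × V) (g : 𝓢(V, ℂ)) (t : V) : ‖tfShift z g t‖ = ‖g (t - z.1)‖ := by
  rw [tfShift_apply, norm_mul, norm_exp_I_mul_ofReal, one_mul]

theorem fourier_compSubConst_apply (a : V) (g : 𝓢(V, ℂ)) (x : V) :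
    𝓕 (SchwartzMap.compSubConstCLM ℂ a g) x =
      Complex.exp (Complex.I * (-2 * Real.pi * inner ℝ a x : ℝ)) * 𝓕 g x := by
  rw [SchwartzMap.fourier_coe, SchwartzMap.fourier_coe, Real.fourier_eq', Real.fourier_eq',
    ← integral_add_right_eq_self _ a, ← integral_const_mul]
  refine integral_congr_ae (Eventually.of_forall fun v => ?_)
  simp only [SchwartzMap.compSubConstCLM_apply, add_sub_cancel_right, smul_eq_mul, ← mul_assoc,
    ← Complex.exp_add, inner_add_left]
  congr 2
  push_cast
  ring

theorem norm_fourier_tfShift (z : V × V) (g : 𝓢(V, ℂ)) (t : V) :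
    ‖𝓕 (tfShift z g) t‖ = ‖𝓕 g (t - z.2)‖ := by
  have hfourier : 𝓕 (tfShift z g) =
      SchwartzMap.compSubConstCLM ℂ z.2 (𝓕 (SchwartzMap.compSubConstCLM ℂ z.1 g)) :=
    fourier_fourierInv_eq _
  rw [hfourier, SchwartzMap.compSubConstCLM_apply, fourier_compSubConst_apply, norm_mul,
    norm_exp_I_mul_ofReal, one_mul]

-- Decay in the translation parameter is visible directly, decay in the modulation parameter
-- after a Fourier transform, and `‖z‖` is the larger of the two.
theorem exists_seminorm_schwartzInner_tfShift_le (g : 𝓢(V, ℂ)) (N : ℕ) :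
    ∃ P : Seminorm ℂ 𝓢(V, ℂ), Continuous P ∧
      ∀ φ z, (1 + ‖z‖) ^ N * ‖schwartzInner φ (tfShift z g)‖ ≤ P φ := by
  obtain ⟨P, hP, hP_le⟩ := exists_seminorm_integral_norm_mul_norm_sub_le g N
  obtain ⟨Q, hQ, hQ_le⟩ := exists_seminorm_integral_norm_mul_norm_sub_le (𝓕 g) N
  have hQF : Continuous (Q.comp (fourierCLM ℂ 𝓢(V, ℂ)).toLinearMap) :=
    hQ.comp (fourierCLM ℂ 𝓢(V, ℂ)).continuous
  refine ⟨P + Q.comp (fourierCLM ℂ 𝓢(V, ℂ)).toLinearMap, hP.add hQF, fun φ z => ?_⟩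
  change _ ≤ P φ + Q (𝓕 φ)
  rcases le_total ‖z.1‖ ‖z.2‖ with h | h
  · have hle : (1 + ‖z.2‖) ^ N * ‖schwartzInner φ (tfShift z g)‖ ≤ Q (𝓕 φ) := by
      rw [← schwartzInner_fourier]
      exact (mul_le_mul_of_nonneg_left (norm_schwartzInner_le (norm_fourier_tfShift z g))
        (by positivity)).trans (hQ_le (𝓕 φ) z.2)
    rw [Prod.norm_def, max_eq_right h]
    linarith [apply_nonneg P φ]
  · have hle : (1 + ‖z.1‖) ^ N * ‖schwartzInner φ (tfShift z g)‖ ≤ P φ :=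
      (mul_le_mul_of_nonneg_left (norm_schwartzInner_le (norm_tfShift z g))
        (by positivity)).trans (hP_le φ z.1)
    rw [Prod.norm_def, max_eq_left h]
    linarith [apply_nonneg Q (𝓕 φ)]

theorem schwartzInner_tfShift_tfShift (z z' : V × V) (g g' : 𝓢(V, ℂ)) :
    schwartzInner (tfShift z g') (tfShift z' g) =
      Complex.exp (Complex.I * (2 * Real.pi * inner ℝ z.1 (z.2 - z'.2) : ℝ)) *
        schwartzInner g' (tfShift (z' - z) g) := by
  rw [schwartzInner, schwartzInner, ← integral_add_right_eq_self _ z.1, ← integral_const_mul]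
  refine integral_congr_ae (Eventually.of_forall fun t => ?_)
  have hsub : t + z.1 - z'.1 = t - (z' - z).1 := by
    rw [Prod.fst_sub]
    abel
  simp only [tfShift_apply, add_sub_cancel_right, map_mul, ← Complex.exp_conj,
    Complex.conj_I, Complex.conj_ofReal, hsub]
  have hexp : ∀ x y u v G H : ℂ, x + y = u + v →
      Complex.exp x * G * (Complex.exp y * H) =
        Complex.exp u * (G * (Complex.exp v * H)) := by
    intro x y u v G H h
    have hmul := congrArg Complex.exp h
    simp only [Complex.exp_add] at hmul
    linear_combination (G * H) * hmul
  apply hexp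
  simp only [Prod.snd_sub, inner_sub_right, inner_add_left]
  push_cast
  ring

theorem norm_schwartzInner_tfShift_tfShift (z z' : V × V) (g g' : 𝓢(V, ℂ)) :
    ‖schwartzInner (tfShift z g') (tfShift z' g)‖ = ‖schwartzInner g' (tfShift (z' - z) g)‖ := by
  rw [schwartzInner_tfShift_tfShift, norm_mul, norm_exp_I_mul_ofReal, one_mul]

end ShortTimeFourier

section Inversion

open Filter FourierTransform

/-- Complex conjugation of Schwartz functions as a continuous real-linear map; on `Space n` it is
`conjSchwartz`. -/
noncomputable def schwartzConj {V : Type*} [NormedAddCommGroup V] [NormedSpace ℝ V] :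
    𝓢(V, ℂ) →L[ℝ] 𝓢(V, ℂ) :=
  SchwartzMap.postcompCLM (𝕜 := ℝ) (Complex.conjCLE : ℂ →L[ℝ] ℂ)

theorem schwartzConj_apply {V : Type*} [NormedAddCommGroup V] [NormedSpace ℝ V] (φ : 𝓢(V, ℂ))
    (t : V) : schwartzConj φ t = conj (φ t) := rfl

variable {V : Type*} [NormedAddCommGroup V] [InnerProductSpace ℝ V] [FiniteDimensional ℝ V]
  [MeasurableSpace V] [BorelSpace V]

theorem toTemperedDistribution_schwartzConj (φ ψ : 𝓢(V, ℂ)) :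
    SchwartzMap.toTemperedDistributionCLM V ℂ volume φ (schwartzConj ψ) = schwartzInner φ ψ := by
  simp [schwartzInner, schwartzConj_apply, mul_comm]

theorem continuous_schwartzInner_comp {Z : Type*} [TopologicalSpace Z] (φ : 𝓢(V, ℂ))
    {K : Z → 𝓢(V, ℂ)} (hK : Continuous K) : Continuous fun z => schwartzInner φ (K z) := by
  simp only [← toTemperedDistribution_schwartzConj]
  exact (SchwartzMap.toTemperedDistributionCLM V ℂ volume φ).continuous.comp
    (schwartzConj.continuous.comp hK)

variable (V) in
theorem integrable_one_add_norm_prod :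
    Integrable fun z : V × V => (1 + ‖z‖) ^ (-((Module.finrank ℝ (V × V) + 1 : ℕ) : ℝ)) :=
  haveI : (volume : Measure (V × V)).IsAddHaarMeasure := Measure.prod.instIsAddHaarMeasure _ _
  integrable_one_add_norm (by simp)

theorem schwartzInner_tfShift_eq_fourier (φ g : 𝓢(V, ℂ)) (a ω : V) :
    schwartzInner φ (tfShift (a, ω) g) =
      𝓕 (SchwartzMap.pairing (ContinuousLinearMap.mul ℂ ℂ) φ
        (schwartzConj (SchwartzMap.compSubConstCLM ℂ a g))) ω := by
  rw [SchwartzMap.fourier_coe, Real.fourier_eq', schwartzInner]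
  refine integral_congr_ae (Eventually.of_forall fun t => ?_)
  simp only [tfShift_apply, map_mul, ← Complex.exp_conj, Complex.conj_I, Complex.conj_ofReal,
    SchwartzMap.pairing_apply_apply, ContinuousLinearMap.mul_apply', schwartzConj_apply,
    SchwartzMap.compSubConstCLM_apply, smul_eq_mul]
  have hexp : -Complex.I * ((2 * Real.pi * inner ℝ t ω : ℝ) : ℂ) =
      ((-2 * Real.pi * inner ℝ t ω : ℝ) : ℂ) * Complex.I := by
    push_cast
    ring
  rw [hexp]
  ring

theorem integral_schwartzInner_mul_tfShift_snd (φ g γ : 𝓢(V, ℂ)) (a t : V) :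
    ∫ ω, schwartzInner φ (tfShift (a, ω) g) * tfShift (a, ω) γ t =
      φ t * (γ (t - a) * conj (g (t - a))) := by
  set h := SchwartzMap.pairing (ContinuousLinearMap.mul ℂ ℂ) φ
      (schwartzConj (SchwartzMap.compSubConstCLM ℂ a g))
  have hinv : h t = ∫ ω, Complex.exp (((2 * Real.pi * inner ℝ ω t : ℝ) : ℂ) * Complex.I) *
      𝓕 h ω := by
    conv_lhs => rw [← fourierInv_fourier_eq (F := 𝓢(V, ℂ)) h]
    rw [SchwartzMap.fourierInv_coe, Real.fourierInv_eq']
    rfl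
  calc ∫ ω, schwartzInner φ (tfShift (a, ω) g) * tfShift (a, ω) γ t
      = ∫ ω, γ (t - a) * (Complex.exp (((2 * Real.pi * inner ℝ ω t : ℝ) : ℂ) * Complex.I) *
          𝓕 h ω) := by
        refine integral_congr_ae (Eventually.of_forall fun ω => ?_)
        simp only [schwartzInner_tfShift_eq_fourier, tfShift_apply, real_inner_comm t ω]
        rw [mul_comm Complex.I]
        ring
    _ = γ (t - a) * h t := by rw [integral_const_mul, ← hinv]
    _ = γ (t - a) * (φ t * conj (g (t - a))) := rfl
    _ = φ t * (γ (t - a) * conj (g (t - a))) := by ring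

theorem integrable_schwartzInner_mul_tfShift (φ g γ : 𝓢(V, ℂ)) (t : V) :
    Integrable fun z : V × V => schwartzInner φ (tfShift z g) * tfShift z γ t := by
  obtain ⟨P, -, hP⟩ := exists_seminorm_schwartzInner_tfShift_le g (Module.finrank ℝ (V × V) + 1)
  have hdecay : Integrable fun z : V × V => schwartzInner φ (tfShift z g) :=
    ((integrable_one_add_norm_prod V).const_mul (P φ)).mono'
      (continuous_schwartzInner_comp φ (continuous_tfShift g)).aestronglyMeasurable
      (Eventually.of_forall fun z => le_mul_one_add_norm_rpow_neg (hP φ z))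
  refine hdecay.mul_bdd (c := SchwartzMap.seminorm ℂ 0 0 γ) ?_ (Eventually.of_forall fun z => ?_)
  · simp only [tfShift_apply]
    have := γ.continuous
    exact Continuous.aestronglyMeasurable (by fun_prop)
  · rw [norm_tfShift]
    exact SchwartzMap.norm_le_seminorm ℂ γ _

theorem integral_schwartzInner_mul_tfShift (φ g γ : 𝓢(V, ℂ)) (t : V) :
    ∫ z : V × V, schwartzInner φ (tfShift z g) * tfShift z γ t = schwartzInner γ g * φ t := by
  have hint := integrable_schwartzInner_mul_tfShift φ g γ t
  rw [Measure.volume_eq_prod] at hint ⊢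
  rw [integral_prod _ hint]
  simp only [integral_schwartzInner_mul_tfShift_snd]
  rw [integral_const_mul, schwartzInner, mul_comm]
  congr 1
  exact integral_sub_left_eq_self (fun s => γ s * conj (g s)) volume t

end Inversion

/-! ### The twisted representation -/

section Representation

variable {n : ℕ}

/-- The rotation `rot` as a linear map. -/
noncomputable def rotLinear (n : ℕ) : Space n →ₗ[ℝ] Space n where
  toFun := rot
  map_add' a b := by
    ext j
    rcases j with j | j <;> simp [rot, add_comm]
  map_smul' c a := by
    ext j
    rcases j with j | j <;> simp [rot]

theorem rotLinear_apply (ξ : Space n) : rotLinear n ξ = rot ξ := rfl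

theorem rot_rot (ξ : Space n) : rot (rot ξ) = -ξ := by
  ext j
  rcases j with j | j <;> simp [rot]

theorem dot_eq_inner (t η : Space n) : dot (t : Fin n ⊕ Fin n → ℝ) η = inner ℝ t η := by
  simp [dot, PiLp.inner_apply, Finset.sum_add_distrib, mul_comm]

theorem symp_eq_inner (t ξ : Space n) : symp (t : Fin n ⊕ Fin n → ℝ) ξ = inner ℝ t (rot ξ) := by
  simp only [symp, rot, PiLp.inner_apply, Fintype.sum_sum_type, Sum.elim_inl, Sum.elim_inr,
    RCLike.inner_apply, conj_trivial, ← Finset.sum_add_distrib]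
  exact Finset.sum_congr rfl fun j _ => by ring

theorem coth_sub_tanh_ne_zero {s : ℝ} (hs : s ≠ 0) : coth s - Real.tanh s ≠ 0 := by
  have hsinh : Real.sinh s ≠ 0 := Real.sinh_eq_zero.not.2 hs
  have hcosh : Real.cosh s ≠ 0 := (Real.cosh_pos s).ne'
  rw [coth, Real.tanh_eq_sinh_div_cosh, div_sub_div _ _ hsinh hcosh, ← sq, ← sq,
    Real.cosh_sq_sub_sinh_sq]
  exact one_div_ne_zero (mul_ne_zero hsinh hcosh)

/-- The linear change of phase-space coordinates carrying `twistedRep` to `tfShift`, see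
`twistedRep_eq_tfShift`. -/
noncomputable def phaseMap (n : ℕ) (lam : ℝ) :
    (Space n × Space n) →ₗ[ℝ] (Space n × Space n) :=
  LinearMap.prod
    (LinearMap.fst ℝ _ _ - Real.tanh (lam / 2) • (rotLinear n ∘ₗ LinearMap.snd ℝ _ _))
    ((-(lam / (4 * Real.pi))) •
      (coth (lam / 2) • LinearMap.snd ℝ _ _ + rotLinear n ∘ₗ LinearMap.fst ℝ _ _))

theorem phaseMap_apply (lam : ℝ) (z : Space n × Space n) :
    phaseMap n lam z = (z.1 - Real.tanh (lam / 2) • rot z.2,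
      (-(lam / (4 * Real.pi))) • (coth (lam / 2) • z.2 + rot z.1)) := rfl

theorem injective_phaseMap {lam : ℝ} (hlam : lam ≠ 0) : Function.Injective (phaseMap n lam) := by
  rw [← LinearMap.ker_eq_bot, LinearMap.ker_eq_bot']
  rintro ⟨ξ, η⟩ h
  rw [phaseMap_apply, Prod.mk_eq_zero, sub_eq_zero, smul_eq_zero_iff_right
    (neg_ne_zero.2 (div_ne_zero hlam (by positivity)))] at h
  obtain ⟨hξ, hη⟩ : ξ = Real.tanh (lam / 2) • rot η ∧ coth (lam / 2) • η + rot ξ = 0 := h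
  have hrot : rot ξ = -(Real.tanh (lam / 2) • η) := by
    rw [hξ, ← rotLinear_apply, map_smul, rotLinear_apply, rot_rot, smul_neg]
  rw [hrot, ← sub_eq_add_neg, ← sub_smul,
    smul_eq_zero_iff_right (coth_sub_tanh_ne_zero (div_ne_zero hlam two_ne_zero))] at hη
  rw [hξ, hη, ← rotLinear_apply, map_zero, smul_zero, Prod.mk_zero_zero]

/-- The invertible linear change of coordinates `phaseMap`. -/
noncomputable def phaseEquiv (n : ℕ) {lam : ℝ} (hlam : lam ≠ 0) :
    (Space n × Space n) ≃L[ℝ] (Space n × Space n) :=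
  (LinearEquiv.ofInjectiveEndo (phaseMap n lam) (injective_phaseMap hlam)).toContinuousLinearEquiv

theorem phaseEquiv_apply {lam : ℝ} (hlam : lam ≠ 0) (z : Space n × Space n) :
    phaseEquiv n hlam z = phaseMap n lam z := rfl

/-- The unimodular factor by which `twistedRep` differs from a time-frequency shift, see
`twistedRep_eq_tfShift`. -/
noncomputable def phaseFactor (lam : ℝ) (z : Space n × Space n) : ℂ :=
  Complex.exp (Complex.I * ((lam / 2 * coth lam * inner ℝ z.1 z.2 -
    lam / 2 * Real.tanh (lam / 2) * inner ℝ (rot z.2) (rot z.1) : ℝ) : ℂ))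

theorem continuous_phaseFactor (lam : ℝ) :
    Continuous (phaseFactor lam : Space n × Space n → ℂ) := by
  have : Continuous (rot (n := n)) := (rotLinear n).continuous_of_finiteDimensional
  unfold phaseFactor
  fun_prop

theorem norm_phaseFactor (lam : ℝ) (z : Space n × Space n) : ‖phaseFactor lam z‖ = 1 :=
  norm_exp_I_mul_ofReal _

theorem twistedRep_eq_tfShift {lam : ℝ} (hlam : lam ≠ 0) (z : Space n × Space n)
    (g : 𝓢(Space n, ℂ)) :
    twistedRep lam z.1 z.2 g = phaseFactor lam z • tfShift (phaseEquiv n hlam z) g := by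
  ext t
  have hsub : t + Real.tanh (lam / 2) • rot z.2 - z.1 =
      t - (z.1 - Real.tanh (lam / 2) • rot z.2) := by abel
  have hpi : (Real.pi : ℂ) ≠ 0 := Complex.ofReal_ne_zero.2 Real.pi_ne_zero
  rw [phaseEquiv_apply, phaseMap_apply, smul_apply, twistedRep_apply, tfShift_apply, smul_eq_mul,
    hsub, phaseFactor]
  simp only [← mul_assoc, ← Complex.exp_add]
  congr 2
  simp only [dot_eq_inner, symp_eq_inner, inner_add_left, inner_add_right, inner_smul_left,
    inner_smul_right, conj_trivial]
  push_cast
  field_simp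
  ring

theorem continuous_twistedRep {lam : ℝ} (hlam : lam ≠ 0) (g : 𝓢(Space n, ℂ)) :
    Continuous fun z : Space n × Space n => twistedRep lam z.1 z.2 g := by
  simp only [twistedRep_eq_tfShift hlam]
  exact (continuous_phaseFactor lam).smul
    ((continuous_tfShift g).comp (phaseEquiv n hlam).continuous)

theorem exists_seminorm_twistedRep_le {lam : ℝ} (hlam : lam ≠ 0)
    (P : Seminorm ℂ 𝓢(Space n, ℂ)) (hP : Continuous P) :
    ∃ (N : ℕ) (Q : Seminorm ℂ 𝓢(Space n, ℂ)), Continuous Q ∧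
      ∀ (z : Space n × Space n) φ, P (twistedRep lam z.1 z.2 φ) ≤ (1 + ‖z‖) ^ N * Q φ := by
  obtain ⟨N, Q, hQ, hPQ⟩ := exists_seminorm_tfShift_le P hP
  obtain ⟨c, hc, hL⟩ := exists_one_add_norm_map_le
    (phaseEquiv n hlam : (Space n × Space n) →L[ℝ] (Space n × Space n))
  obtain ⟨Q', hQ', hQ'_apply⟩ := exists_continuous_seminorm_eq_mul (pow_nonneg hc N) hQ
  refine ⟨N, Q', hQ', fun z φ => ?_⟩
  rw [twistedRep_eq_tfShift hlam, map_smul_eq_mul, norm_phaseFactor, one_mul]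
  calc P (tfShift (phaseEquiv n hlam z) φ)
      ≤ (1 + ‖phaseEquiv n hlam z‖) ^ N * Q φ := hPQ _ _
    _ ≤ (c * (1 + ‖z‖)) ^ N * Q φ := by
        gcongr
        exact hL z
    _ = (1 + ‖z‖) ^ N * Q' φ := by
        rw [hQ'_apply, mul_pow]
        ring

theorem exists_seminorm_schwartzInner_twistedRep_le {lam : ℝ} (hlam : lam ≠ 0)
    (g : 𝓢(Space n, ℂ)) (N : ℕ) :
    ∃ P : Seminorm ℂ 𝓢(Space n, ℂ), Continuous P ∧ ∀ φ (z : Space n × Space n),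
      (1 + ‖z‖) ^ N * ‖schwartzInner φ (twistedRep lam z.1 z.2 g)‖ ≤ P φ := by
  obtain ⟨Q, hQ, hQ_le⟩ := exists_seminorm_schwartzInner_tfShift_le g N
  obtain ⟨c, hc, hL⟩ := exists_one_add_norm_map_le
    ((phaseEquiv n hlam).symm : (Space n × Space n) →L[ℝ] (Space n × Space n))
  obtain ⟨P, hP, hP_apply⟩ := exists_continuous_seminorm_eq_mul (pow_nonneg hc N) hQ
  refine ⟨P, hP, fun φ z => ?_⟩
  have hz : 1 + ‖z‖ ≤ c * (1 + ‖phaseEquiv n hlam z‖) := by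
    simpa only [ContinuousLinearEquiv.coe_coe, ContinuousLinearEquiv.symm_apply_apply] using
      hL (phaseEquiv n hlam z)
  rw [twistedRep_eq_tfShift hlam, schwartzInner_smul_right, norm_mul, RCLike.norm_conj,
    norm_phaseFactor, one_mul]
  calc (1 + ‖z‖) ^ N * ‖schwartzInner φ (tfShift (phaseEquiv n hlam z) g)‖
      ≤ (c * (1 + ‖phaseEquiv n hlam z‖)) ^ N *
          ‖schwartzInner φ (tfShift (phaseEquiv n hlam z) g)‖ := by gcongr
    _ = c ^ N * ((1 + ‖phaseEquiv n hlam z‖) ^ N *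
          ‖schwartzInner φ (tfShift (phaseEquiv n hlam z) g)‖) := by rw [mul_pow, mul_assoc]
    _ ≤ c ^ N * Q φ := mul_le_mul_of_nonneg_left (hQ_le φ _) (pow_nonneg hc N)
    _ = P φ := (hP_apply φ).symm

theorem norm_schwartzInner_twistedRep_twistedRep {lam : ℝ} (hlam : lam ≠ 0)
    (z z' : Space n × Space n) (g g' : 𝓢(Space n, ℂ)) :
    ‖schwartzInner (twistedRep lam z.1 z.2 g') (twistedRep lam z'.1 z'.2 g)‖ =
      ‖schwartzInner g' (twistedRep lam (z' - z).1 (z' - z).2 g)‖ := by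
  simp only [twistedRep_eq_tfShift hlam, schwartzInner_smul_right, schwartzInner_smul_left,
    norm_mul, RCLike.norm_conj, norm_phaseFactor, one_mul, norm_schwartzInner_tfShift_tfShift,
    map_sub]

/-- The factor by which the coordinates of `phaseMap` rescale Lebesgue measure; it is the constant
in the inversion formula for `twistedRep`. -/
noncomputable def phaseDensity (n : ℕ) (lam : ℝ) : ℝ := |(LinearMap.det (phaseMap n lam))⁻¹|

theorem det_phaseMap_ne_zero {lam : ℝ} (hlam : lam ≠ 0) : LinearMap.det (phaseMap n lam) ≠ 0 :=
  (LinearEquiv.ofInjectiveEndo (phaseMap n lam) (injective_phaseMap hlam)).isUnit_det'.ne_zero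

theorem phaseDensity_pos {lam : ℝ} (hlam : lam ≠ 0) : 0 < phaseDensity n lam :=
  abs_pos.2 (inv_ne_zero (det_phaseMap_ne_zero hlam))

theorem integral_comp_phaseEquiv {lam : ℝ} (hlam : lam ≠ 0) (f : Space n × Space n → ℂ) :
    ∫ z, f (phaseEquiv n hlam z) = phaseDensity n lam * ∫ z, f z := by
  have : (volume : Measure (Space n × Space n)).IsAddHaarMeasure :=
    Measure.prod.instIsAddHaarMeasure _ _
  have hmap : Measure.map (phaseEquiv n hlam).toHomeomorph.toMeasurableEquiv volume =
      ENNReal.ofReal (phaseDensity n lam) • volume :=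
    Measure.map_linearMap_addHaar_eq_smul_addHaar _ (det_phaseMap_ne_zero hlam)
  calc ∫ z, f (phaseEquiv n hlam z)
      = ∫ z, f z ∂Measure.map (phaseEquiv n hlam).toHomeomorph.toMeasurableEquiv volume :=
        (integral_map_equiv (phaseEquiv n hlam).toHomeomorph.toMeasurableEquiv f).symm
    _ = phaseDensity n lam * ∫ z, f z := by
        rw [hmap, integral_smul_measure, ENNReal.toReal_ofReal (phaseDensity_pos hlam).le,
          Complex.real_smul]

theorem integral_schwartzInner_mul_twistedRep {lam : ℝ} (hlam : lam ≠ 0)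
    (φ g γ : 𝓢(Space n, ℂ)) (t : Space n) :
    ∫ z : Space n × Space n,
        schwartzInner φ (twistedRep lam z.1 z.2 g) * twistedRep lam z.1 z.2 γ t =
      phaseDensity n lam * (schwartzInner γ g * φ t) := by
  have hcancel : ∀ z : Space n × Space n, conj (phaseFactor lam z) * phaseFactor lam z = 1 := by
    intro z
    rw [mul_comm, Complex.mul_conj, Complex.normSq_eq_norm_sq, norm_phaseFactor, one_pow,
      Complex.ofReal_one]
  rw [← integral_schwartzInner_mul_tfShift,
    ← integral_comp_phaseEquiv hlam fun z => schwartzInner φ (tfShift z g) * tfShift z γ t]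
  refine integral_congr_ae (Filter.Eventually.of_forall fun z => ?_)
  simp only [twistedRep_eq_tfShift hlam, schwartzInner_smul_right, smul_apply, smul_eq_mul]
  linear_combination (schwartzInner φ (tfShift (phaseEquiv n hlam z) g) *
    tfShift (phaseEquiv n hlam z) γ t) * hcancel z

end Representation

/-! ### Matrix coefficients and synthesis -/

section MatrixCoefficients

variable {n : ℕ}

theorem conjSchwartz_apply (φ : 𝓢(Space n, ℂ)) (t : Space n) :
    conjSchwartz φ t = conj (φ t) := rfl

theorem continuous_conjSchwartz : Continuous (conjSchwartz (n := n)) :=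
  (schwartzConj (V := Space n)).continuous

theorem conjSchwartz_conjSchwartz (φ : 𝓢(Space n, ℂ)) : conjSchwartz (conjSchwartz φ) = φ := by
  ext t
  simp only [conjSchwartz_apply, Complex.conj_conj]

theorem conjSchwartz_add (φ ψ : 𝓢(Space n, ℂ)) :
    conjSchwartz (φ + ψ) = conjSchwartz φ + conjSchwartz ψ := by
  ext t
  simp only [conjSchwartz_apply, add_apply, map_add]

theorem conjSchwartz_smul (c : ℂ) (φ : 𝓢(Space n, ℂ)) :
    conjSchwartz (c • φ) = conj c • conjSchwartz φ := by
  ext t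
  simp only [conjSchwartz_apply, smul_apply, smul_eq_mul, map_mul]

theorem ofSchwartz_conjSchwartz (φ ψ : 𝓢(Space n, ℂ)) :
    ofSchwartz φ (conjSchwartz ψ) = schwartzInner φ ψ :=
  toTemperedDistribution_schwartzConj φ ψ

theorem ofSchwartz_comm (φ ψ : 𝓢(Space n, ℂ)) : ofSchwartz φ ψ = ofSchwartz ψ φ := by
  simp only [ofSchwartz, SchwartzMap.toTemperedDistributionCLM_apply_apply, smul_eq_mul, mul_comm]

theorem matrixCoeff_ofSchwartz (lam : ℝ) (g φ : 𝓢(Space n, ℂ)) (z : Space n × Space n) :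
    matrixCoeff lam g (ofSchwartz φ) z = schwartzInner φ (twistedRep lam z.1 z.2 g) :=
  ofSchwartz_conjSchwartz _ _

theorem matrixCoeff_add (lam : ℝ) (g : 𝓢(Space n, ℂ)) (f h : 𝓢'(Space n, ℂ))
    (z : Space n × Space n) :
    matrixCoeff lam g (f + h) z = matrixCoeff lam g f z + matrixCoeff lam g h z := rfl

theorem matrixCoeff_sub (lam : ℝ) (g : 𝓢(Space n, ℂ)) (f h : 𝓢'(Space n, ℂ))
    (z : Space n × Space n) :
    matrixCoeff lam g (f - h) z = matrixCoeff lam g f z - matrixCoeff lam g h z := rfl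

theorem matrixCoeff_smul (lam : ℝ) (g : 𝓢(Space n, ℂ)) (c : ℂ) (f : 𝓢'(Space n, ℂ))
    (z : Space n × Space n) :
    matrixCoeff lam g (c • f) z = c * matrixCoeff lam g f z := rfl

theorem continuous_matrixCoeff {lam : ℝ} (hlam : lam ≠ 0) (g : 𝓢(Space n, ℂ))
    (f : 𝓢'(Space n, ℂ)) : Continuous (matrixCoeff lam g f) :=
  f.continuous.comp (continuous_conjSchwartz.comp (continuous_twistedRep hlam g))

/-- The linear functional `φ ↦ conj ⟨h, φ⟩` on Schwartz functions. -/
noncomputable def conjFunctional (h : 𝓢'(Space n, ℂ)) : 𝓢(Space n, ℂ) →L[ℂ] ℂ where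
  toFun φ := conj (h (conjSchwartz φ))
  map_add' φ ψ := by rw [conjSchwartz_add, map_add, map_add]
  map_smul' c φ := by
    rw [conjSchwartz_smul, map_smul, smul_eq_mul, map_mul, Complex.conj_conj, smul_eq_mul,
      RingHom.id_apply]
  cont := Complex.continuous_conj.comp (h.continuous.comp continuous_conjSchwartz)

theorem conjFunctional_apply (h : 𝓢'(Space n, ℂ)) (φ : 𝓢(Space n, ℂ)) :
    conjFunctional h φ = conj (h (conjSchwartz φ)) := rfl

end MatrixCoefficients

section Synthesis

open Filter

variable {n : ℕ} {lam : ℝ} (hlam : lam ≠ 0)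

/-- Measurable functions with finite moments of all orders; they are the coefficient functions from
which `synthesis` builds Schwartz functions. -/
structure RapidlyDecreasing {E : Type*} [NormedAddCommGroup E] [MeasureSpace E] (F : E → ℂ) :
    Prop where
  aestronglyMeasurable : AEStronglyMeasurable F volume
  integrable_pow_mul_norm : ∀ N : ℕ, Integrable fun z => (1 + ‖z‖) ^ N * ‖F z‖

include hlam in
theorem RapidlyDecreasing.schwartzIntegrable_smul_twistedRep {F : Space n × Space n → ℂ}
    (hF : RapidlyDecreasing F) (γ : 𝓢(Space n, ℂ)) :
    SchwartzIntegrable (fun z => F z • twistedRep lam z.1 z.2 γ) volume := by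
  refine SchwartzIntegrable.of_continuous (continuous_twistedRep hlam γ) hF.aestronglyMeasurable
    fun k l => ?_
  obtain ⟨N, Q, -, hQ⟩ := exists_seminorm_twistedRep_le hlam _
    ((schwartz_withSeminorms ℂ (Space n) ℂ).continuous_seminorm (k, l))
  refine ⟨_, (hF.integrable_pow_mul_norm N).mul_const (Q γ), fun z => ?_⟩
  refine (mul_le_mul_of_nonneg_left (hQ z γ) (norm_nonneg (F z))).trans_eq ?_
  ring

/-- The Schwartz function `∫ F(z) Π_λ(z) γ dz` with rapidly decreasing coefficients `F`. -/
noncomputable def synthesis (γ : 𝓢(Space n, ℂ)) {F : Space n × Space n → ℂ}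
    (hF : RapidlyDecreasing F) : 𝓢(Space n, ℂ) :=
  (hF.schwartzIntegrable_smul_twistedRep hlam γ).integral

include hlam in
theorem integrable_mul_clm_twistedRep (f : 𝓢(Space n, ℂ) →L[ℂ] ℂ) (γ : 𝓢(Space n, ℂ))
    {F : Space n × Space n → ℂ} (hF : RapidlyDecreasing F) :
    Integrable fun z : Space n × Space n => F z * f (twistedRep lam z.1 z.2 γ) := by
  simpa only [map_smul, smul_eq_mul] using
    (hF.schwartzIntegrable_smul_twistedRep hlam γ).integrable_clm_apply f

theorem clm_apply_synthesis (f : 𝓢(Space n, ℂ) →L[ℂ] ℂ) (γ : 𝓢(Space n, ℂ))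
    {F : Space n × Space n → ℂ} (hF : RapidlyDecreasing F) :
    f (synthesis hlam γ hF) = ∫ z, F z * f (twistedRep lam z.1 z.2 γ) := by
  rw [synthesis, SchwartzIntegrable.clm_apply_integral]
  simp only [map_smul, smul_eq_mul]

theorem conj_apply_conjSchwartz_synthesis (h : 𝓢'(Space n, ℂ)) (γ : 𝓢(Space n, ℂ))
    {F : Space n × Space n → ℂ} (hF : RapidlyDecreasing F) :
    conj (h (conjSchwartz (synthesis hlam γ hF))) = ∫ z, F z * conj (matrixCoeff lam γ h z) :=
  clm_apply_synthesis hlam (conjFunctional h) γ hF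

/-- The kernel of the projection onto the matrix coefficients: it carries matrix coefficients with
window `γ` to matrix coefficients with window `g`. -/
noncomputable def reproducingKernel (lam : ℝ) (γ g : 𝓢(Space n, ℂ)) (z' z : Space n × Space n) :
    ℂ :=
  schwartzInner (twistedRep lam z'.1 z'.2 γ) (twistedRep lam z.1 z.2 g)

theorem matrixCoeff_ofSchwartz_synthesis (g γ : 𝓢(Space n, ℂ)) {F : Space n × Space n → ℂ}
    (hF : RapidlyDecreasing F) (z : Space n × Space n) :
    matrixCoeff lam g (ofSchwartz (synthesis hlam γ hF)) z =
      ∫ z', F z' * reproducingKernel lam γ g z' z := by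
  have hcomm (ψ : 𝓢(Space n, ℂ)) : ofSchwartz (conjSchwartz (twistedRep lam z.1 z.2 g)) ψ =
      schwartzInner ψ (twistedRep lam z.1 z.2 g) := by
    rw [ofSchwartz_comm, ofSchwartz_conjSchwartz]
  have hsynth := clm_apply_synthesis hlam
    (ContinuousLinearMap.mk (ofSchwartz (conjSchwartz (twistedRep lam z.1 z.2 g))).toLinearMap
      (ofSchwartz (conjSchwartz (twistedRep lam z.1 z.2 g))).continuous) γ hF
  rw [matrixCoeff_ofSchwartz, ← hcomm]
  refine hsynth.trans (integral_congr_ae (Eventually.of_forall fun z' => ?_))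
  exact congrArg (F z' * ·) (hcomm _)

include hlam in
theorem rapidlyDecreasing_matrixCoeff_ofSchwartz (g φ : 𝓢(Space n, ℂ)) :
    RapidlyDecreasing (matrixCoeff lam g (ofSchwartz φ)) := by
  have hcont := continuous_matrixCoeff hlam g (ofSchwartz φ)
  refine ⟨hcont.aestronglyMeasurable, fun N => ?_⟩
  obtain ⟨P, -, hP⟩ := exists_seminorm_schwartzInner_twistedRep_le hlam g
    (Module.finrank ℝ (Space n × Space n) + 1 + N)
  refine ((integrable_one_add_norm_prod (Space n)).const_mul (P φ)).mono'
    (by fun_prop) (Eventually.of_forall fun z => ?_)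
  rw [Real.norm_of_nonneg (by positivity), matrixCoeff_ofSchwartz]
  refine le_mul_one_add_norm_rpow_neg ?_
  rw [← mul_assoc, ← pow_add]
  exact hP φ z

/-- Evaluation at a point as a continuous linear functional on Schwartz functions. -/
noncomputable def evalSchwartz (t : Space n) : 𝓢(Space n, ℂ) →L[ℂ] ℂ :=
  BoundedContinuousFunction.evalCLM ℂ t ∘L SchwartzMap.toBoundedContinuousFunctionCLM ℂ (Space n) ℂ

theorem evalSchwartz_apply (t : Space n) (φ : 𝓢(Space n, ℂ)) : evalSchwartz t φ = φ t := rfl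

theorem synthesis_matrixCoeff_ofSchwartz (g γ φ : 𝓢(Space n, ℂ)) :
    synthesis hlam γ (rapidlyDecreasing_matrixCoeff_ofSchwartz hlam g φ) =
      (phaseDensity n lam * schwartzInner γ g) • φ := by
  ext t
  rw [← evalSchwartz_apply, clm_apply_synthesis]
  simp only [evalSchwartz_apply, matrixCoeff_ofSchwartz]
  rw [integral_schwartzInner_mul_twistedRep hlam, smul_apply, smul_eq_mul, mul_assoc]

include hlam in
theorem integrable_matrixCoeff_mul_conj (φ g γ : 𝓢(Space n, ℂ)) (h : 𝓢'(Space n, ℂ)) :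
    Integrable fun z => matrixCoeff lam g (ofSchwartz φ) z * conj (matrixCoeff lam γ h z) :=
  integrable_mul_clm_twistedRep hlam (conjFunctional h) γ
    (rapidlyDecreasing_matrixCoeff_ofSchwartz hlam g φ)

include hlam in
theorem integral_matrixCoeff_mul_conj (φ g γ : 𝓢(Space n, ℂ)) (h : 𝓢'(Space n, ℂ)) :
    ∫ z, matrixCoeff lam g (ofSchwartz φ) z * conj (matrixCoeff lam γ h z) =
      phaseDensity n lam * schwartzInner γ g * conj (h (conjSchwartz φ)) := by
  rw [← conj_apply_conjSchwartz_synthesis hlam h γ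
    (rapidlyDecreasing_matrixCoeff_ofSchwartz hlam g φ), synthesis_matrixCoeff_ofSchwartz,
    ← conjFunctional_apply, map_smul, smul_eq_mul, conjFunctional_apply]

/-- The constant `c` of the frame identity `∫ |V_γ φ|² = c ‖φ‖²`. -/
noncomputable def frameConst (lam : ℝ) (γ : 𝓢(Space n, ℂ)) : ℝ :=
  phaseDensity n lam * ∫ t, ‖γ t‖ ^ 2

include hlam in
theorem frameConst_pos {γ : 𝓢(Space n, ℂ)} (hγ : γ ≠ 0) : 0 < frameConst lam γ :=
  mul_pos (phaseDensity_pos hlam) (integral_norm_sq_pos hγ)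

theorem ofReal_frameConst (lam : ℝ) (γ : 𝓢(Space n, ℂ)) :
    (frameConst lam γ : ℂ) = phaseDensity n lam * schwartzInner γ γ := by
  rw [frameConst, Complex.ofReal_mul, schwartzInner_self]

include hlam in
theorem integrable_matrixCoeff_mul_reproducingKernel (g γ : 𝓢(Space n, ℂ)) (f : 𝓢'(Space n, ℂ))
    (z : Space n × Space n) :
    Integrable fun z' => matrixCoeff lam γ f z' * reproducingKernel lam γ g z' z := by
  have hint := (LinearIsometryEquiv.integrable_comp_iff Complex.conjLIE).2
    (integrable_matrixCoeff_mul_conj hlam (twistedRep lam z.1 z.2 g) γ γ f)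
  simpa only [Function.comp_def, Complex.conjLIE_apply, map_mul, Complex.conj_conj,
    matrixCoeff_ofSchwartz, conj_schwartzInner, reproducingKernel, mul_comm] using hint

include hlam in
theorem integral_matrixCoeff_mul_reproducingKernel (g γ : 𝓢(Space n, ℂ)) (f : 𝓢'(Space n, ℂ))
    (z : Space n × Space n) :
    ∫ z', matrixCoeff lam γ f z' * reproducingKernel lam γ g z' z =
      frameConst lam γ * matrixCoeff lam g f z := by
  have horth := congrArg conj
    (integral_matrixCoeff_mul_conj hlam (twistedRep lam z.1 z.2 g) γ γ f)
  rw [← ofReal_frameConst, map_mul, Complex.conj_ofReal, Complex.conj_conj, ← integral_conj]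
    at horth
  rw [matrixCoeff, ← horth]
  simp only [map_mul, Complex.conj_conj, matrixCoeff_ofSchwartz, conj_schwartzInner,
    reproducingKernel, mul_comm]

end Synthesis

section DecayWeight

open Filter

variable {V : Type*} [NormedAddCommGroup V] [NormedSpace ℝ V]

/-- The weight `(1 + ‖x‖)^(-(dim V + 1))`, the generic integrable majorant of matrix coefficients of
Schwartz functions. -/
noncomputable def decayWeight (x : V) : ℝ≥0∞ :=
  ENNReal.ofReal ((1 + ‖x‖) ^ (-((Module.finrank ℝ V + 1 : ℕ) : ℝ)))

variable [MeasurableSpace V] [BorelSpace V]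

@[fun_prop]
theorem measurable_decayWeight : Measurable (decayWeight (V := V)) := by
  unfold decayWeight
  fun_prop

theorem eLpNorm_decayWeight_lt_top [FiniteDimensional ℝ V] (μ : Measure V) [μ.IsAddHaarMeasure]
    {p : ℝ≥0∞} (hp : 1 ≤ p) :
    eLpNorm decayWeight p μ < ∞ := by
  have hbounded : eLpNorm decayWeight ∞ μ ≤ 1 :=
    eLpNorm_top_le_iff.2 (Eventually.of_forall fun x =>
      ENNReal.ofReal_le_one.2 (Real.rpow_le_one_of_one_le_of_nonpos
        (le_add_of_nonneg_right (norm_nonneg x)) (neg_nonpos.2 (Nat.cast_nonneg _))))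
  have hintegrable : eLpNorm decayWeight 1 μ < ∞ := by
    have hint : Integrable (fun x : V => (1 + ‖x‖) ^ (-((Module.finrank ℝ V + 1 : ℕ) : ℝ))) μ :=
      integrable_one_add_norm (by push_cast; exact lt_add_one _)
    rw [eLpNorm_ennreal_one]
    exact (hasFiniteIntegral_iff_ofReal (Eventually.of_forall fun x => by positivity)).1
      hint.hasFiniteIntegral
  exact (eLpNorm_le_eLpNorm_top_add one_ne_zero hp).trans_lt
    (ENNReal.add_lt_top.2 ⟨hbounded.trans_lt ENNReal.one_lt_top, hintegrable⟩)

end DecayWeight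

section ChangeOfWindow

variable {n : ℕ} {lam : ℝ} (hlam : lam ≠ 0)

include hlam in
theorem exists_seminorm_enorm_schwartzInner_twistedRep_le (g : 𝓢(Space n, ℂ)) :
    ∃ P : Seminorm ℂ 𝓢(Space n, ℂ), Continuous P ∧ ∀ φ (z : Space n × Space n),
      ‖schwartzInner φ (twistedRep lam z.1 z.2 g)‖ₑ ≤
        ENNReal.ofReal (P φ) * (decayWeight z.1 * decayWeight z.2) := by
  obtain ⟨P, hP, hP_le⟩ := exists_seminorm_schwartzInner_twistedRep_le hlam g
    ((Module.finrank ℝ (Space n) + 1) + (Module.finrank ℝ (Space n) + 1))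
  refine ⟨P, hP, fun φ z => ?_⟩
  set m := Module.finrank ℝ (Space n) + 1 with hm
  have hprod : (1 + ‖z.2‖) ^ m * ((1 + ‖z.1‖) ^ m *
      ‖schwartzInner φ (twistedRep lam z.1 z.2 g)‖) ≤ P φ := by
    refine le_trans ?_ (hP_le φ z)
    have hfst := norm_fst_le z
    have hsnd := norm_snd_le z
    clear_value m
    rw [pow_add, mul_assoc]
    gcongr
  have hbound : ‖schwartzInner φ (twistedRep lam z.1 z.2 g)‖ ≤
      P φ * ((1 + ‖z.1‖) ^ (-(m : ℝ)) * (1 + ‖z.2‖) ^ (-(m : ℝ))) := by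
    refine (le_mul_one_add_norm_rpow_neg (le_mul_one_add_norm_rpow_neg hprod)).trans_eq ?_
    ring
  rw [← ofReal_norm, decayWeight, decayWeight, ← hm, ← ENNReal.ofReal_mul (by positivity),
    ← ENNReal.ofReal_mul (apply_nonneg P φ)]
  exact ENNReal.ofReal_le_ofReal hbound

include hlam in
theorem exists_enorm_reproducingKernel_le (γ g : 𝓢(Space n, ℂ)) :
    ∃ c : ℝ≥0∞, c < ∞ ∧ ∀ z' z : Space n × Space n,
      ‖reproducingKernel lam γ g z' z‖ₑ ≤
        c * (decayWeight (-z' + z).1 * decayWeight (-z' + z).2) := by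
  obtain ⟨P, -, hP⟩ := exists_seminorm_enorm_schwartzInner_twistedRep_le hlam g
  refine ⟨ENNReal.ofReal (P γ), ENNReal.ofReal_lt_top, fun z' z => ?_⟩
  rw [reproducingKernel, ← ofReal_norm, norm_schwartzInner_twistedRep_twistedRep hlam, ofReal_norm,
    neg_add_eq_sub]
  exact hP γ (z - z')

theorem mixedNorm_eq_mixedENorm (p q : ℝ≥0∞) (F : Space n × Space n → ℂ) :
    mixedNorm p q F = mixedENorm volume volume p q fun z => ‖F z‖ₑ := by
  simp only [mixedNorm, mixedENorm, eLpNorm_enorm]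

include hlam in
theorem exists_mixedNorm_le_of_enorm_le_reproducingKernel (γ g : 𝓢(Space n, ℂ)) {p q r s : ℝ≥0∞}
    (hp : 1 ≤ p) (hq : 1 ≤ q) (hpr : p ≤ r) (hqs : q ≤ s) :
    ∃ C : ℝ≥0∞, C < ∞ ∧ ∀ F G : Space n × Space n → ℂ, Measurable F →
      (∀ z, ‖G z‖ₑ ≤ ∫⁻ z', ‖F z'‖ₑ * ‖reproducingKernel lam γ g z' z‖ₑ) →
      mixedNorm r s G ≤ C * mixedNorm p q F := by
  have := ENNReal.HolderConjugate.conjExponent hp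
  have := ENNReal.HolderConjugate.conjExponent hq
  obtain ⟨c, hc, hkernel⟩ := exists_enorm_reproducingKernel_le hlam γ g
  let w : Space n → ℝ≥0∞ := decayWeight
  let W (p : ℝ≥0∞) := eLpNorm w p.conjExponent volume + eLpNorm w 1 volume
  have hW {p p' : ℝ≥0∞} [p.HolderConjugate p'] :
      eLpNorm w p' volume + eLpNorm w 1 volume < ∞ :=
    ENNReal.add_lt_top.2 ⟨eLpNorm_decayWeight_lt_top _ (ENNReal.HolderConjugate.one_le p' p),
      eLpNorm_decayWeight_lt_top _ le_rfl⟩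
  refine ⟨W p * (W q * c), ENNReal.mul_lt_top (hW (p := p)) (ENNReal.mul_lt_top (hW (p := q)) hc),
    fun F G hF hG => ?_⟩
  have hdom (z) : ‖G z‖ₑ ≤ ((fun z' => c * ‖F z'‖ₑ) ⋆ₗ[volume.prod volume]
      fun z => w z.1 * w z.2) z := by
    refine (hG z).trans (lintegral_mono fun z' => ?_)
    calc ‖F z'‖ₑ * ‖reproducingKernel lam γ g z' z‖ₑ
        ≤ ‖F z'‖ₑ * (c * (w (-z' + z).1 * w (-z' + z).2)) := by gcongr; exact hkernel z' z
      _ = c * ‖F z'‖ₑ * (w (-z' + z).1 * w (-z' + z).2) := by ring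
  rw [mixedNorm_eq_mixedENorm, mixedNorm_eq_mixedENorm]
  calc mixedENorm volume volume r s (fun z => ‖G z‖ₑ)
      ≤ W p * (W q * mixedENorm volume volume p q fun z => c * ‖F z‖ₑ) :=
        (mixedENorm_mono r s hdom).trans (mixedENorm_lconvolution_tensor_le
          (hF.enorm.const_mul c) measurable_decayWeight measurable_decayWeight hpr hqs)
    _ ≤ W p * (W q * (c * mixedENorm volume volume p q fun z => ‖F z‖ₑ)) := by
        gcongr
        exact mixedENorm_const_mul_le hF.enorm c p q
    _ = W p * (W q * c) * mixedENorm volume volume p q fun z => ‖F z‖ₑ := by ring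

theorem modulationNorm_eq_mixedENorm (lam : ℝ) (p q : ℝ≥0∞) (g : 𝓢(Space n, ℂ))
    (f : 𝓢'(Space n, ℂ)) :
    modulationNorm lam p q g f = mixedENorm volume volume p q fun z => ‖matrixCoeff lam g f z‖ₑ :=
  mixedNorm_eq_mixedENorm p q _

include hlam in
theorem measurable_enorm_matrixCoeff (g : 𝓢(Space n, ℂ)) (f : 𝓢'(Space n, ℂ)) :
    Measurable fun z => ‖matrixCoeff lam g f z‖ₑ :=
  (continuous_matrixCoeff hlam g f).measurable.enorm

include hlam in
theorem exists_modulationNorm_le {γ : 𝓢(Space n, ℂ)} (hγ : γ ≠ 0) (g : 𝓢(Space n, ℂ))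
    {p q r s : ℝ≥0∞} (hp : 1 ≤ p) (hq : 1 ≤ q) (hpr : p ≤ r) (hqs : q ≤ s) :
    ∃ C : ℝ≥0∞, C < ∞ ∧ ∀ f, modulationNorm lam r s g f ≤ C * modulationNorm lam p q γ f := by
  obtain ⟨C, hC, hnorm⟩ :=
    exists_mixedNorm_le_of_enorm_le_reproducingKernel hlam γ g hp hq hpr hqs
  let κ : ℂ := frameConst lam γ
  have hκ : κ ≠ 0 := Complex.ofReal_ne_zero.2 (frameConst_pos hlam hγ).ne'
  refine ⟨C * ‖κ⁻¹‖ₑ, ENNReal.mul_lt_top hC enorm_lt_top, fun f => ?_⟩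
  have hreproduce (z) : ‖matrixCoeff lam g f z‖ₑ ≤
      ∫⁻ z', ‖κ⁻¹ * matrixCoeff lam γ f z'‖ₑ * ‖reproducingKernel lam γ g z' z‖ₑ := by
    have heq : matrixCoeff lam g f z =
        ∫ z', κ⁻¹ * matrixCoeff lam γ f z' * reproducingKernel lam γ g z' z := by
      simp only [mul_assoc]
      rw [integral_const_mul, integral_matrixCoeff_mul_reproducingKernel hlam,
        inv_mul_cancel_left₀ hκ]
    rw [heq]
    exact (enorm_integral_le_lintegral_enorm _).trans_eq (by simp only [enorm_mul])
  calc modulationNorm lam r s g f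
      ≤ C * mixedNorm p q fun z => κ⁻¹ * matrixCoeff lam γ f z :=
        hnorm _ _ ((continuous_matrixCoeff hlam γ f).measurable.const_mul _) hreproduce
    _ ≤ C * (‖κ⁻¹‖ₑ * modulationNorm lam p q γ f) := by
        rw [mixedNorm_eq_mixedENorm, modulationNorm_eq_mixedENorm]
        simp only [enorm_mul]
        gcongr
        exact mixedENorm_const_mul_le (measurable_enorm_matrixCoeff hlam γ f) _ p q
    _ = C * ‖κ⁻¹‖ₑ * modulationNorm lam p q γ f := (mul_assoc _ _ _).symm

include hlam in
theorem exists_modulationNorm_ofSchwartz_le (g : 𝓢(Space n, ℂ)) {p q : ℝ≥0∞} (hp : 1 ≤ p)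
    (hq : 1 ≤ q) :
    ∃ P : Seminorm ℂ 𝓢(Space n, ℂ), Continuous P ∧
      ∀ φ, modulationNorm lam p q g (ofSchwartz φ) ≤ ENNReal.ofReal (P φ) := by
  obtain ⟨Q, hQ, hQ_le⟩ := exists_seminorm_enorm_schwartzInner_twistedRep_le hlam g
  let w : Space n → ℝ≥0∞ := decayWeight
  have hw : Measurable w := measurable_decayWeight
  have hfinite : eLpNorm w p volume * eLpNorm w q volume < ∞ :=
    ENNReal.mul_lt_top (eLpNorm_decayWeight_lt_top _ hp) (eLpNorm_decayWeight_lt_top _ hq)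
  obtain ⟨P, hP, hP_apply⟩ := exists_continuous_seminorm_eq_mul
    (c := (eLpNorm w p volume * eLpNorm w q volume).toReal) ENNReal.toReal_nonneg hQ
  refine ⟨P, hP, fun φ => ?_⟩
  rw [hP_apply, ENNReal.ofReal_mul ENNReal.toReal_nonneg, ENNReal.ofReal_toReal hfinite.ne,
    modulationNorm_eq_mixedENorm, mul_comm]
  simp only [matrixCoeff_ofSchwartz]
  refine (mixedENorm_mono p q (hQ_le φ)).trans
    ((mixedENorm_const_mul_le (by fun_prop) _ p q).trans ?_)
  gcongr
  exact mixedENorm_tensor_le hw hw p q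

end ChangeOfWindow

/-! ### Banach space structure -/

section WeakLimits

open Filter Topology

variable {V : Type*} [NormedAddCommGroup V] [NormedSpace ℝ V]

theorem exists_schwartz_ne_zero [FiniteDimensional ℝ V] : ∃ g : 𝓢(V, ℂ), g ≠ 0 := by
  obtain ⟨b⟩ : Nonempty (ContDiffBump (0 : V)) := inferInstance
  have hcompact : HasCompactSupport fun x => (b x : ℂ) :=
    b.hasCompactSupport.comp_left (g := Complex.ofReal) Complex.ofReal_zero
  have hsmooth : ContDiff ℝ (⊤ : ℕ∞) fun x => (b x : ℂ) :=
    Complex.ofRealCLM.contDiff.comp b.contDiff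
  refine ⟨hcompact.toSchwartzMap hsmooth, fun hzero => ?_⟩
  have hb_zero : (b 0 : ℂ) = 0 := DFunLike.congr_fun hzero 0
  have hb_one : b 0 = 1 := b.one_of_mem_closedBall (Metric.mem_closedBall_self b.rIn_pos.le)
  norm_num [hb_one] at hb_zero

theorem exists_distribution_eq_of_norm_le (ℓ : 𝓢(V, ℂ) →ₗ[ℂ] ℂ) {P : Seminorm ℂ 𝓢(V, ℂ)}
    (hP : Continuous P) (hle : ∀ ψ, ‖ℓ ψ‖ ≤ P ψ) : ∃ f : 𝓢'(V, ℂ), ∀ ψ, f ψ = ℓ ψ := by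
  have hzero : Tendsto P (𝓝 0) (𝓝 0) := by simpa only [map_zero] using hP.tendsto 0
  have hcont : Continuous ℓ := by
    refine continuous_of_continuousAt_zero ℓ ?_
    rw [ContinuousAt, map_zero]
    exact squeeze_zero_norm hle hzero
  exact ⟨ContinuousLinearMap.toPointwiseConvergenceCLM ℂ (RingHom.id ℂ) _ _ ⟨ℓ, hcont⟩,
    fun ψ => rfl⟩

theorem exists_distribution_tendsto {u : ℕ → 𝓢'(V, ℂ)} {P : Seminorm ℂ 𝓢(V, ℂ)}
    (hP : Continuous P) (hle : ∀ ψ, ∀ᶠ k in atTop, ‖u k ψ‖ ≤ P ψ)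
    (hcauchy : ∀ ψ, CauchySeq fun k => u k ψ) :
    ∃ f : 𝓢'(V, ℂ), ∀ ψ, Tendsto (fun k => u k ψ) atTop (𝓝 (f ψ)) := by
  choose ℓ hℓ using fun ψ => cauchySeq_tendsto_of_complete (hcauchy ψ)
  let limit : 𝓢(V, ℂ) →ₗ[ℂ] ℂ :=
    { toFun := ℓ
      map_add' := fun φ ψ => tendsto_nhds_unique (hℓ (φ + ψ)) (by
        simpa only [map_add] using (hℓ φ).add (hℓ ψ))
      map_smul' := fun c φ => tendsto_nhds_unique (hℓ (c • φ)) (by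
        simpa only [map_smul, RingHom.id_apply] using (hℓ φ).const_smul c) }
  obtain ⟨f, hf⟩ := exists_distribution_eq_of_norm_le limit hP
    fun ψ => le_of_tendsto (hℓ ψ).norm (hle ψ)
  refine ⟨f, fun ψ => ?_⟩
  rw [hf]
  exact hℓ ψ

end WeakLimits

section SeminormCauchy

open Filter

variable {E : Type*} [AddCommGroup E] [Module ℂ E] {N : Seminorm ℂ E} {u : ℕ → E}

theorem exists_forall_eventually_seminorm_le
    (hu : ∀ ε, 0 < ε → ∃ K, ∀ m k, K ≤ m → K ≤ k → N (u m - u k) < ε) :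
    ∃ b, 0 ≤ b ∧ ∀ᶠ k in atTop, N (u k) ≤ b := by
  obtain ⟨K, hK⟩ := hu 1 one_pos
  refine ⟨1 + N (u K), add_nonneg zero_le_one (apply_nonneg N _), ?_⟩
  filter_upwards [eventually_ge_atTop K] with k hk
  calc N (u k) ≤ N (u k - u K) + N (u K) := by
        simpa only [sub_add_cancel] using map_add_le_add N (u k - u K) (u K)
    _ ≤ 1 + N (u K) := by gcongr; exact (hK k K hk le_rfl).le

theorem cauchySeq_of_dist_le_mul_seminorm_sub {X : Type*} [PseudoMetricSpace X] {F : E → X} (c : ℝ)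
    (hF : ∀ x y, dist (F x) (F y) ≤ c * N (x - y))
    (hu : ∀ ε, 0 < ε → ∃ K, ∀ m k, K ≤ m → K ≤ k → N (u m - u k) < ε) :
    CauchySeq fun k => F (u k) := by
  refine Metric.cauchySeq_iff.2 fun ε hε => ?_
  have hpos : 0 < |c| + 1 := by positivity
  obtain ⟨K, hK⟩ := hu (ε / (|c| + 1)) (div_pos hε hpos)
  refine ⟨K, fun m hm k hk => ?_⟩
  calc dist (F (u m)) (F (u k)) ≤ c * N (u m - u k) := hF _ _
    _ ≤ (|c| + 1) * N (u m - u k) := by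
        gcongr
        linarith [le_abs_self c]
    _ < ε := by rw [mul_comm, ← lt_div_iff₀ hpos]; exact hK m k hm hk

end SeminormCauchy

section ModulationSpace

open Filter Topology

variable {n : ℕ} {lam : ℝ} (hlam : lam ≠ 0) {p q : ℝ≥0∞}

include hlam in
theorem mem_twistedModulationSpace_iff (hp : 1 ≤ p) (hq : 1 ≤ q) {g : 𝓢(Space n, ℂ)} (hg : g ≠ 0)
    {f : 𝓢'(Space n, ℂ)} :
    f ∈ twistedModulationSpace n lam p q ↔ modulationNorm lam p q g f < ∞ := by
  refine ⟨?_, fun hf => ⟨g, hg, (continuous_matrixCoeff hlam g f).aestronglyMeasurable, hf⟩⟩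
  rintro ⟨γ, hγ, -, hfinite⟩
  obtain ⟨C, hC, hle⟩ := exists_modulationNorm_le hlam hγ g hp hq le_rfl le_rfl
  exact (hle f).trans_lt (ENNReal.mul_lt_top hC hfinite)

include hlam in
theorem modulationNorm_add_le (hp : 1 ≤ p) (hq : 1 ≤ q) (g : 𝓢(Space n, ℂ))
    (f h : 𝓢'(Space n, ℂ)) :
    modulationNorm lam p q g (f + h) ≤
      modulationNorm lam p q g f + modulationNorm lam p q g h := by
  simp only [modulationNorm_eq_mixedENorm, matrixCoeff_add]
  exact (mixedENorm_mono p q fun z => enorm_add_le _ _).trans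
    (mixedENorm_add_le (measurable_enorm_matrixCoeff hlam g f)
      (measurable_enorm_matrixCoeff hlam g h) hp hq)

include hlam in
theorem modulationNorm_smul_le (p q : ℝ≥0∞) (g : 𝓢(Space n, ℂ)) (c : ℂ) (f : 𝓢'(Space n, ℂ)) :
    modulationNorm lam p q g (c • f) ≤ ‖c‖ₑ * modulationNorm lam p q g f := by
  simp only [modulationNorm_eq_mixedENorm, matrixCoeff_smul, enorm_mul]
  exact mixedENorm_const_mul_le (measurable_enorm_matrixCoeff hlam g f) _ _ _

theorem modulationNorm_zero (lam : ℝ) (p q : ℝ≥0∞) (g : 𝓢(Space n, ℂ)) :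
    modulationNorm lam p q g 0 = 0 := by
  have hzero : matrixCoeff lam g 0 = fun _ => 0 := rfl
  simp [modulationNorm, mixedNorm, hzero]

/-- The twisted modulation space `M_λ^{p,q}` as a subspace of the tempered distributions. -/
noncomputable def modulationSubmodule (n : ℕ) {lam : ℝ} (hlam : lam ≠ 0) {p q : ℝ≥0∞} (hp : 1 ≤ p)
    (hq : 1 ≤ q) : Submodule ℂ 𝓢'(Space n, ℂ) where
  carrier := twistedModulationSpace n lam p q
  zero_mem' := by
    obtain ⟨g, hg⟩ := exists_schwartz_ne_zero (V := Space n)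
    rw [mem_twistedModulationSpace_iff hlam hp hq hg, modulationNorm_zero]
    exact ENNReal.zero_lt_top
  add_mem' := by
    obtain ⟨g, hg⟩ := exists_schwartz_ne_zero (V := Space n)
    intro f h hf hh
    rw [mem_twistedModulationSpace_iff hlam hp hq hg] at *
    exact (modulationNorm_add_le hlam hp hq g f h).trans_lt (ENNReal.add_lt_top.2 ⟨hf, hh⟩)
  smul_mem' := by
    obtain ⟨g, hg⟩ := exists_schwartz_ne_zero (V := Space n)
    intro c f hf
    rw [mem_twistedModulationSpace_iff hlam hp hq hg] at *
    exact (modulationNorm_smul_le hlam p q g c f).trans_lt (ENNReal.mul_lt_top enorm_lt_top hf)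

variable {hp : 1 ≤ p} {hq : 1 ≤ q} {g : 𝓢(Space n, ℂ)} (hg : g ≠ 0)

include hg in
theorem modulationNorm_coe_lt_top (f : modulationSubmodule n hlam hp hq) :
    modulationNorm lam p q g f < ∞ :=
  (mem_twistedModulationSpace_iff hlam hp hq hg).1 f.2

/-- The norm `‖f‖_{(p,q)}` with window `g` as a seminorm on `M_λ^{p,q}`. -/
noncomputable def modulationSeminorm (hp : 1 ≤ p) (hq : 1 ≤ q) :
    Seminorm ℂ (modulationSubmodule n hlam hp hq) :=
  Seminorm.ofSMulLE (fun f => (modulationNorm lam p q g f).toReal)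
    (by simp [modulationNorm_zero])
    (fun f h => by
      have hf := modulationNorm_coe_lt_top hlam hg f
      have hh := modulationNorm_coe_lt_top hlam hg h
      rw [← ENNReal.toReal_add hf.ne hh.ne]
      exact ENNReal.toReal_mono (ENNReal.add_lt_top.2 ⟨hf, hh⟩).ne
        (modulationNorm_add_le hlam hp hq g _ _))
    (fun c f => by
      have hf := modulationNorm_coe_lt_top hlam hg f
      rw [← toReal_enorm c, ← ENNReal.toReal_mul]
      exact ENNReal.toReal_mono (ENNReal.mul_lt_top enorm_lt_top hf).ne
        (modulationNorm_smul_le hlam p q g c _))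

theorem ofReal_modulationSeminorm (f : modulationSubmodule n hlam hp hq) :
    modulationNorm lam p q g f = ENNReal.ofReal (modulationSeminorm hlam hg hp hq f) :=
  (ENNReal.ofReal_toReal (modulationNorm_coe_lt_top hlam hg f).ne).symm

theorem modulationNorm_sub_le_iff (f h : modulationSubmodule n hlam hp hq) {ε : ℝ} (hε : 0 ≤ ε) :
    modulationNorm lam p q g ((f : 𝓢'(Space n, ℂ)) - (h : 𝓢'(Space n, ℂ))) ≤ ENNReal.ofReal ε ↔
      modulationSeminorm hlam hg hp hq (f - h) ≤ ε := by
  rw [← Submodule.coe_sub, ofReal_modulationSeminorm hlam hg, ENNReal.ofReal_le_ofReal_iff hε]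

include hlam in
theorem modulationPairing_ofSchwartz (g φ : 𝓢(Space n, ℂ)) (h : 𝓢'(Space n, ℂ)) :
    modulationPairing lam g (ofSchwartz φ) h = frameConst lam g * conj (h (conjSchwartz φ)) := by
  rw [ofReal_frameConst]
  exact integral_matrixCoeff_mul_conj hlam φ g g h

include hlam in
theorem lintegral_pairingIntegrand_le (g : 𝓢(Space n, ℂ)) (p p' q q' : ℝ≥0∞)
    [p.HolderConjugate p'] [q.HolderConjugate q'] (f h : 𝓢'(Space n, ℂ)) :
    ∫⁻ z, ‖pairingIntegrand lam g f h z‖ₑ ≤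
      modulationNorm lam p q g f * modulationNorm lam p' q' g h := by
  simp only [modulationNorm_eq_mixedENorm, pairingIntegrand, enorm_mul, RCLike.enorm_conj]
  exact lintegral_mul_le_mixedENorm_mul_mixedENorm p p' q q'
    (measurable_enorm_matrixCoeff hlam g f) (measurable_enorm_matrixCoeff hlam g h)

include hlam in
theorem enorm_modulationPairing_le (g : 𝓢(Space n, ℂ)) (p p' q q' : ℝ≥0∞)
    [p.HolderConjugate p'] [q.HolderConjugate q'] (f h : 𝓢'(Space n, ℂ)) :
    ‖modulationPairing lam g f h‖ₑ ≤ modulationNorm lam p q g f * modulationNorm lam p' q' g h :=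
  (enorm_integral_le_lintegral_enorm _).trans (lintegral_pairingIntegrand_le hlam g p p' q q' f h)

include hlam hg in
theorem enorm_apply_conjSchwartz_le (p p' q q' : ℝ≥0∞)
    [p.HolderConjugate p'] [q.HolderConjugate q'] (f : 𝓢'(Space n, ℂ)) (φ : 𝓢(Space n, ℂ)) :
    ‖f (conjSchwartz φ)‖ₑ ≤ ENNReal.ofReal (frameConst lam g)⁻¹ *
      (modulationNorm lam p q g (ofSchwartz φ) * modulationNorm lam p' q' g f) := by
  have hκ := frameConst_pos hlam hg
  have hpairing : ENNReal.ofReal (frameConst lam g) * ‖f (conjSchwartz φ)‖ₑ =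
      ‖modulationPairing lam g (ofSchwartz φ) f‖ₑ := by
    rw [modulationPairing_ofSchwartz hlam, enorm_mul, RCLike.enorm_conj, ← ofReal_norm (E := ℂ)
      (frameConst lam g), Complex.norm_real, Real.norm_of_nonneg hκ.le]
  rw [ENNReal.ofReal_inv_of_pos hκ, mul_comm (ENNReal.ofReal _)⁻¹, ← div_eq_mul_inv,
    ENNReal.le_div_iff_mul_le (.inl (ENNReal.ofReal_pos.2 hκ).ne') (.inl ENNReal.ofReal_ne_top),
    mul_comm, hpairing]
  exact enorm_modulationPairing_le hlam g p p' q q' _ f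

theorem exists_continuous_seminorm_eq_comp_conjSchwartz {P : Seminorm ℂ 𝓢(Space n, ℂ)}
    (hP : Continuous P) :
    ∃ Q : Seminorm ℂ 𝓢(Space n, ℂ), Continuous Q ∧ ∀ φ, Q φ = P (conjSchwartz φ) :=
  ⟨Seminorm.of (fun φ => P (conjSchwartz φ))
    (fun φ ψ => by rw [conjSchwartz_add]; exact map_add_le_add P _ _)
    (fun c φ => by rw [conjSchwartz_smul, map_smul_eq_mul, RCLike.norm_conj]),
    hP.comp continuous_conjSchwartz, fun _ => rfl⟩

include hlam hg in
theorem exists_enorm_apply_le (hp : 1 ≤ p) (hq : 1 ≤ q) :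
    ∃ P : Seminorm ℂ 𝓢(Space n, ℂ), Continuous P ∧
      ∀ (f : 𝓢'(Space n, ℂ)) ψ, ‖f ψ‖ₑ ≤ ENNReal.ofReal (P ψ) * modulationNorm lam p q g f := by
  have := (ENNReal.HolderConjugate.conjExponent hp).symm
  have := (ENNReal.HolderConjugate.conjExponent hq).symm
  obtain ⟨Q, hQ, hQ_le⟩ := exists_modulationNorm_ofSchwartz_le hlam g
    (ENNReal.HolderConjugate.one_le p.conjExponent p)
    (ENNReal.HolderConjugate.one_le q.conjExponent q)
  have hκ : 0 ≤ (frameConst lam g)⁻¹ := (inv_pos.2 (frameConst_pos hlam hg)).le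
  obtain ⟨R, hR, hR_apply⟩ := exists_continuous_seminorm_eq_comp_conjSchwartz hQ
  obtain ⟨P, hP, hP_apply⟩ := exists_continuous_seminorm_eq_mul hκ hR
  refine ⟨P, hP, fun f ψ => ?_⟩
  have hle := enorm_apply_conjSchwartz_le hlam hg p.conjExponent p q.conjExponent q f
    (conjSchwartz ψ)
  rw [conjSchwartz_conjSchwartz] at hle
  rw [hP_apply, hR_apply, ENNReal.ofReal_mul hκ, mul_assoc]
  refine hle.trans ?_
  gcongr
  exact hQ_le _

theorem exists_norm_apply_le_mul_modulationSeminorm (hp : 1 ≤ p) (hq : 1 ≤ q) :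
    ∃ P : Seminorm ℂ 𝓢(Space n, ℂ), Continuous P ∧
      ∀ (f : modulationSubmodule n hlam hp hq) ψ,
        ‖(f : 𝓢'(Space n, ℂ)) ψ‖ ≤ P ψ * modulationSeminorm hlam hg hp hq f := by
  obtain ⟨P, hP, hle⟩ := exists_enorm_apply_le hlam hg hp hq
  refine ⟨P, hP, fun f ψ => ?_⟩
  have hf := hle f ψ
  rw [ofReal_modulationSeminorm hlam hg, ← ENNReal.ofReal_mul (apply_nonneg P ψ),
    ← ofReal_norm] at hf
  exact (ENNReal.ofReal_le_ofReal_iff (mul_nonneg (apply_nonneg P ψ) (apply_nonneg _ f))).1 hf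

include hlam in
theorem modulationNorm_le_of_tendsto {b : ℝ≥0∞} {u : ℕ → 𝓢'(Space n, ℂ)} {f : 𝓢'(Space n, ℂ)}
    (hlim : ∀ ψ, Tendsto (fun k => u k ψ) atTop (𝓝 (f ψ)))
    (hb : ∀ᶠ k in atTop, modulationNorm lam p q g (u k) ≤ b) : modulationNorm lam p q g f ≤ b := by
  simp only [modulationNorm_eq_mixedENorm] at hb ⊢
  exact mixedENorm_le_of_tendsto (fun k => measurable_enorm_matrixCoeff hlam g (u k))
    (fun z => (hlim _).enorm) hb

theorem exists_modulationSubmodule_tendsto_apply {u : ℕ → modulationSubmodule n hlam hp hq}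
    (hu : ∀ ε, 0 < ε → ∃ K, ∀ m k, K ≤ m → K ≤ k →
      modulationSeminorm hlam hg hp hq (u m - u k) < ε) :
    ∃ f : modulationSubmodule n hlam hp hq, ∀ ψ,
      Tendsto (fun k => (u k : 𝓢'(Space n, ℂ)) ψ) atTop (𝓝 ((f : 𝓢'(Space n, ℂ)) ψ)) := by
  obtain ⟨P, hP, hP_le⟩ := exists_norm_apply_le_mul_modulationSeminorm hlam hg hp hq
  obtain ⟨b, hb, hu_le⟩ := exists_forall_eventually_seminorm_le hu
  obtain ⟨Q, hQ, hQ_apply⟩ := exists_continuous_seminorm_eq_mul hb hP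
  have hu_apply_le (ψ) : ∀ᶠ k in atTop, ‖(u k : 𝓢'(Space n, ℂ)) ψ‖ ≤ Q ψ := by
    filter_upwards [hu_le] with k hk
    rw [hQ_apply, mul_comm]
    exact (hP_le (u k) ψ).trans (mul_le_mul_of_nonneg_left hk (apply_nonneg P ψ))
  have hcauchy (ψ) : CauchySeq fun k => (u k : 𝓢'(Space n, ℂ)) ψ :=
    cauchySeq_of_dist_le_mul_seminorm_sub
      (F := fun f : modulationSubmodule n hlam hp hq => (f : 𝓢'(Space n, ℂ)) ψ) (P ψ)
      (fun f h => by
        rw [dist_eq_norm]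
        exact hP_le (f - h) ψ) hu
  obtain ⟨f, hf⟩ := exists_distribution_tendsto hQ hu_apply_le hcauchy
  refine ⟨⟨f, (mem_twistedModulationSpace_iff hlam hp hq hg).2 ?_⟩, hf⟩
  refine (modulationNorm_le_of_tendsto (b := ENNReal.ofReal b) hlam hf ?_).trans_lt
    ENNReal.ofReal_lt_top
  filter_upwards [hu_le] with k hk
  rw [ofReal_modulationSeminorm hlam hg]
  exact ENNReal.ofReal_le_ofReal hk

theorem isBanachNorm_modulationSeminorm (hp : 1 ≤ p) (hq : 1 ≤ q) :
    IsBanachNorm (modulationSeminorm hlam hg hp hq) := by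
  refine ⟨fun f hf => ?_, fun u hu => ?_⟩
  · obtain ⟨P, -, hP_le⟩ := exists_norm_apply_le_mul_modulationSeminorm hlam hg hp hq
    ext ψ
    exact norm_le_zero_iff.1 ((hP_le f ψ).trans_eq (by rw [hf, mul_zero]))
  obtain ⟨f, hf⟩ := exists_modulationSubmodule_tendsto_apply hlam hg hu
  refine ⟨f, Metric.tendsto_atTop.2 fun ε hε => ?_⟩
  obtain ⟨K, hK⟩ := hu (ε / 2) (half_pos hε)
  refine ⟨K, fun k hk => ?_⟩
  rw [Real.dist_eq, sub_zero, abs_of_nonneg (apply_nonneg _ _)]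
  refine lt_of_le_of_lt ?_ (half_lt_self hε)
  rw [← modulationNorm_sub_le_iff hlam hg _ _ (half_pos hε).le]
  refine modulationNorm_le_of_tendsto hlam
    (u := fun m => (u k : 𝓢'(Space n, ℂ)) - (u m : 𝓢'(Space n, ℂ)))
    (fun ψ => tendsto_const_nhds.sub (hf ψ)) ?_
  filter_upwards [eventually_ge_atTop K] with m hm
  exact (modulationNorm_sub_le_iff hlam hg _ _ (half_pos hε).le).2 (hK k m hk hm).le

end ModulationSpace

/-! ### Density of the Schwartz functions -/

section RapidDecay

open Filter

variable {E : Type*} [NormedAddCommGroup E] [MeasureSpace E] [OpensMeasurableSpace E]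
  [ProperSpace E] [IsFiniteMeasureOnCompacts (volume : Measure E)]

theorem RapidlyDecreasing.of_norm_le_indicator {F : E → ℂ} (hF : AEStronglyMeasurable F volume)
    {R b : ℝ} (hb : ∀ z, ‖F z‖ ≤ (Metric.closedBall (0 : E) R).indicator (fun _ => b) z) :
    RapidlyDecreasing F := by
  refine ⟨hF, fun N => ?_⟩
  have hmajorant :
      Integrable ((Metric.closedBall (0 : E) R).indicator fun _ => (1 + R) ^ N * b) := by
    rw [integrable_indicator_iff Metric.isClosed_closedBall.measurableSet]
    exact integrableOn_const (isCompact_closedBall _ _).measure_lt_top.ne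
  have hweight : Continuous fun z : E => (1 + ‖z‖) ^ N := by fun_prop
  refine hmajorant.mono' (hweight.aestronglyMeasurable.mul hF.norm)
    (Eventually.of_forall fun z => ?_)
  have hz_le := hb z
  rw [Real.norm_of_nonneg (by positivity)]
  by_cases hz : z ∈ Metric.closedBall (0 : E) R
  · rw [Set.indicator_of_mem hz] at hz_le ⊢
    rw [mem_closedBall_zero_iff] at hz
    have hR : 0 ≤ R := (norm_nonneg z).trans hz
    gcongr
  · rw [Set.indicator_of_notMem hz] at hz_le ⊢
    rw [le_antisymm hz_le (norm_nonneg _), mul_zero]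

theorem rapidlyDecreasing_indicator_closedBall {F : E → ℂ} (hF : Continuous F) (R : ℝ) :
    RapidlyDecreasing ((Metric.closedBall (0 : E) R).indicator F) := by
  obtain ⟨b, hb⟩ := (isCompact_closedBall (0 : E) R).exists_bound_of_continuousOn hF.continuousOn
  refine .of_norm_le_indicator (R := R) (b := b)
    (hF.aestronglyMeasurable.indicator Metric.isClosed_closedBall.measurableSet) fun z => ?_
  rw [norm_indicator_eq_indicator_norm]
  exact Set.indicator_le_indicator' fun hz => hb z hz

end RapidDecay

section Density

open Filter Topology

variable {n : ℕ} {lam : ℝ} (hlam : lam ≠ 0) {g : 𝓢(Space n, ℂ)} (hg : g ≠ 0) {p q : ℝ≥0∞}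

theorem monotone_closedBall_natCast {X : Type*} [PseudoMetricSpace X] (x : X) :
    Monotone fun k : ℕ => Metric.closedBall x (k : ℝ) := fun _ _ hij =>
  Metric.closedBall_subset_closedBall (Nat.cast_le.2 hij)

theorem enorm_matrixCoeff_sub_ofSchwartz_synthesis_le (hg : g ≠ 0) (f : 𝓢'(Space n, ℂ))
    {F : Space n × Space n → ℂ} (hF : ∀ z, frameConst lam g * F z = matrixCoeff lam g f z)
    {B : Set (Space n × Space n)} (hB : MeasurableSet B) (hBF : RapidlyDecreasing (B.indicator F))
    (z : Space n × Space n) :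
    ‖matrixCoeff lam g (f - ofSchwartz (synthesis hlam g hBF)) z‖ₑ ≤
      ∫⁻ z', ‖Bᶜ.indicator F z'‖ₑ * ‖reproducingKernel lam g g z' z‖ₑ := by
  let K (z' : Space n × Space n) : ℂ := reproducingKernel lam g g z' z
  have hκ : (frameConst lam g : ℂ) ≠ 0 := Complex.ofReal_ne_zero.2 (frameConst_pos hlam hg).ne'
  have hF_eq : F = fun z' => (frameConst lam g : ℂ)⁻¹ * matrixCoeff lam g f z' := by
    funext z'
    rw [← hF, inv_mul_cancel_left₀ hκ]
  have hint : Integrable fun z' => F z' * K z' := by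
    simpa only [hF_eq, mul_assoc] using
      (integrable_matrixCoeff_mul_reproducingKernel hlam g g f z).const_mul _
  have hreproduce : matrixCoeff lam g f z = ∫ z', F z' * K z' := by
    simp only [hF_eq, mul_assoc, K]
    rw [integral_const_mul, integral_matrixCoeff_mul_reproducingKernel hlam,
      inv_mul_cancel_left₀ hκ]
  have htruncate : Integrable fun z' => B.indicator F z' * K z' := by
    simpa only [← Set.indicator_mul_left] using hint.indicator hB
  rw [matrixCoeff_sub, hreproduce, matrixCoeff_ofSchwartz_synthesis hlam,
    ← integral_sub hint htruncate]
  refine (enorm_integral_le_lintegral_enorm _).trans_eq (lintegral_congr fun z' => ?_)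
  rw [← sub_mul, enorm_mul, Set.indicator_compl, Pi.sub_apply]

include hlam in
theorem exists_modulationNorm_sub_ofSchwartz_lt (hg : g ≠ 0) (hp : 1 ≤ p) (hq : 1 ≤ q)
    (hp_top : p ≠ ∞) (hq_top : q ≠ ∞) {f : 𝓢'(Space n, ℂ)} (hf : modulationNorm lam p q g f < ∞)
    {ε : ℝ≥0∞} (hε : 0 < ε) :
    ∃ φ, modulationNorm lam p q g (f - ofSchwartz φ) < ε := by
  obtain ⟨C, hC, hnorm⟩ :=
    exists_mixedNorm_le_of_enorm_le_reproducingKernel hlam g g hp hq le_rfl le_rfl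
  let κ : ℂ := frameConst lam g
  have hκ : κ ≠ 0 := Complex.ofReal_ne_zero.2 (frameConst_pos hlam hg).ne'
  let F (z : Space n × Space n) : ℂ := κ⁻¹ * matrixCoeff lam g f z
  have hF : Continuous F := (continuous_matrixCoeff hlam g f).const_mul _
  let B (k : ℕ) : Set (Space n × Space n) := Metric.closedBall 0 k
  have hB (k) : MeasurableSet (B k) := Metric.isClosed_closedBall.measurableSet
  have hF_finite : mixedENorm volume volume p q (fun z => ‖F z‖ₑ) ≠ ∞ := by
    simp only [F, enorm_mul]
    refine ((mixedENorm_const_mul_le (measurable_enorm_matrixCoeff hlam g f) _ p q).trans_lt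
      (ENNReal.mul_lt_top enorm_lt_top ?_)).ne
    rwa [← modulationNorm_eq_mixedENorm]
  have htail : Tendsto (fun k => C * mixedNorm p q ((B k)ᶜ.indicator F)) atTop (𝓝 0) := by
    simp only [mixedNorm_eq_mixedENorm, enorm_indicator_eq_indicator_enorm]
    simpa only [mul_zero] using ENNReal.Tendsto.const_mul
      (tendsto_mixedENorm_indicator_compl hF.measurable.enorm hB (monotone_closedBall_natCast 0)
        (Metric.iUnion_closedBall_nat 0) (zero_lt_one.trans_le hp).ne' hp_top
        (zero_lt_one.trans_le hq).ne' hq_top hF_finite) (.inr hC.ne)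
  obtain ⟨k, hk⟩ := (htail.eventually_lt_const hε).exists
  have hBF : RapidlyDecreasing ((B k).indicator F) := rapidlyDecreasing_indicator_closedBall hF k
  refine ⟨synthesis hlam g hBF, (hnorm _ _ (hF.measurable.indicator (hB k).compl) ?_).trans_lt hk⟩
  exact enorm_matrixCoeff_sub_ofSchwartz_synthesis_le hlam hg f
    (fun z => mul_inv_cancel_left₀ hκ _) (hB k) hBF

theorem ofSchwartz_mem_modulationSubmodule (hp : 1 ≤ p) (hq : 1 ≤ q) (φ : 𝓢(Space n, ℂ)) :
    ofSchwartz φ ∈ modulationSubmodule n hlam hp hq := by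
  obtain ⟨g, hg⟩ := exists_schwartz_ne_zero (V := Space n)
  obtain ⟨P, -, hP⟩ := exists_modulationNorm_ofSchwartz_le hlam g hp hq
  exact (mem_twistedModulationSpace_iff hlam hp hq hg).2 ((hP φ).trans_lt ENNReal.ofReal_lt_top)

/-- The inclusion of the Schwartz functions into `M_λ^{p,q}`. -/
noncomputable def schwartzInclusion (n : ℕ) {lam : ℝ} (hlam : lam ≠ 0) {p q : ℝ≥0∞} (hp : 1 ≤ p)
    (hq : 1 ≤ q) : 𝓢(Space n, ℂ) →ₗ[ℂ] modulationSubmodule n hlam hp hq :=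
  (SchwartzMap.toTemperedDistributionCLM (Space n) ℂ volume).toLinearMap.codRestrict _
    (ofSchwartz_mem_modulationSubmodule hlam hp hq)

theorem coe_schwartzInclusion (hp : 1 ≤ p) (hq : 1 ≤ q) (φ : 𝓢(Space n, ℂ)) :
    (schwartzInclusion n hlam hp hq φ : 𝓢'(Space n, ℂ)) = ofSchwartz φ := rfl

theorem exists_modulationSeminorm_sub_schwartzInclusion_lt (hp : 1 ≤ p) (hq : 1 ≤ q)
    (hp_top : p ≠ ∞) (hq_top : q ≠ ∞) (f : modulationSubmodule n hlam hp hq) {ε : ℝ} (hε : 0 < ε) :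
    ∃ φ, modulationSeminorm hlam hg hp hq (f - schwartzInclusion n hlam hp hq φ) < ε := by
  obtain ⟨φ, hφ⟩ := exists_modulationNorm_sub_ofSchwartz_lt hlam hg hp hq hp_top hq_top
    (modulationNorm_coe_lt_top hlam hg f) (ENNReal.ofReal_pos.2 hε)
  refine ⟨φ, ?_⟩
  rwa [← coe_schwartzInclusion hlam hp hq, ← Submodule.coe_sub, ofReal_modulationSeminorm hlam hg,
    ENNReal.ofReal_lt_ofReal_iff hε] at hφ

end Density

/-! ### Duality -/

section Phase

variable {X : Type*} [MeasurableSpace X]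

theorem exists_measurable_mul_conj_eq_norm {H : X → ℝ≥0∞} (hH : Measurable H)
    (hfinite : ∀ z, H z ≠ ∞) {V : X → ℂ} (hV : Measurable V) :
    ∃ F : X → ℂ, Measurable F ∧ (∀ z, ‖F z‖ₑ = H z) ∧
      ∀ z, F z * conj (V z) = ‖F z * conj (V z)‖ := by
  let e (z : X) : ℂ := Complex.exp ((V z).arg * Complex.I)
  have he (z) : ‖e z‖ = 1 := Complex.norm_exp_ofReal_mul_I _
  refine ⟨fun z => (H z).toReal * e z, ?_, fun z => ?_, fun z => ?_⟩
  · exact (Complex.measurable_ofReal.comp hH.ennreal_toReal).mul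
      (((Complex.measurable_ofReal.comp (Complex.measurable_arg.comp hV)).mul_const _).cexp)
  · rw [enorm_mul, ← ofReal_norm (e z), he, ENNReal.ofReal_one, mul_one, ← ofReal_norm,
      Complex.norm_real, Real.norm_of_nonneg ENNReal.toReal_nonneg,
      ENNReal.ofReal_toReal (hfinite z)]
  · have hconj : e z * conj (V z) = ‖V z‖ := by
      conv_lhs => rw [← Complex.norm_mul_exp_arg_mul_I (V z), map_mul, Complex.conj_ofReal]
      rw [mul_left_comm, Complex.mul_conj, Complex.normSq_eq_norm_sq, he, one_pow,
        Complex.ofReal_one, mul_one]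
    rw [mul_assoc, hconj, norm_mul, Complex.norm_real, Complex.norm_real, norm_norm,
      Real.norm_of_nonneg ENNReal.toReal_nonneg, Complex.ofReal_mul]

theorem enorm_integral_eq_lintegral_enorm_of_eq_norm {μ : Measure X} {f : X → ℂ}
    (hf : Integrable f μ) (hnorm : ∀ z, f z = ‖f z‖) : ‖∫ z, f z ∂μ‖ₑ = ∫⁻ z, ‖f z‖ₑ ∂μ := by
  rw [← ofReal_integral_norm_eq_lintegral_enorm hf, integral_congr_ae (ae_of_all _ hnorm),
    integral_complex_ofReal, ← ofReal_norm, Complex.norm_real,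
    Real.norm_of_nonneg (integral_nonneg fun z => norm_nonneg _)]

end Phase

section Duality

variable {n : ℕ} {lam : ℝ} (hlam : lam ≠ 0) {g : 𝓢(Space n, ℂ)} {p q : ℝ≥0∞}

theorem exists_modulationNorm_synthesis_le (γ g : 𝓢(Space n, ℂ)) (hp : 1 ≤ p) (hq : 1 ≤ q) :
    ∃ C : ℝ≥0∞, C < ∞ ∧ ∀ (F : Space n × Space n → ℂ) (hF : RapidlyDecreasing F), Measurable F →
      modulationNorm lam p q g (ofSchwartz (synthesis hlam γ hF)) ≤ C * mixedNorm p q F := by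
  obtain ⟨C, hC, hle⟩ :=
    exists_mixedNorm_le_of_enorm_le_reproducingKernel hlam γ g hp hq le_rfl le_rfl
  refine ⟨C, hC, fun F hF hF_meas => hle F _ hF_meas fun z => ?_⟩
  rw [matrixCoeff_ofSchwartz_synthesis hlam]
  exact (enorm_integral_le_lintegral_enorm _).trans_eq
    (lintegral_congr fun z' => enorm_mul _ _)

theorem enorm_apply_conjSchwartz_synthesis_eq (h : 𝓢'(Space n, ℂ)) {F : Space n × Space n → ℂ}
    (hF : RapidlyDecreasing F)
    (hphase : ∀ z, F z * conj (matrixCoeff lam g h z) = ‖F z * conj (matrixCoeff lam g h z)‖) :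
    ‖h (conjSchwartz (synthesis hlam g hF))‖ₑ = ∫⁻ z, ‖matrixCoeff lam g h z‖ₑ * ‖F z‖ₑ := by
  have hint : Integrable fun z => F z * conj (matrixCoeff lam g h z) :=
    integrable_mul_clm_twistedRep hlam (conjFunctional h) g hF
  rw [← RCLike.enorm_conj, conj_apply_conjSchwartz_synthesis hlam,
    enorm_integral_eq_lintegral_enorm_of_eq_norm hint hphase]
  simp only [enorm_mul, RCLike.enorm_conj, mul_comm]

include hlam in
theorem exists_modulationNorm_le_of_forall_ofSchwartz (g : 𝓢(Space n, ℂ)) (p p' q q' : ℝ≥0∞)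
    [p.HolderConjugate p'] [q.HolderConjugate q'] :
    ∃ A : ℝ≥0∞, A < ∞ ∧ ∀ (h : 𝓢'(Space n, ℂ)) (c : ℝ≥0∞),
      (∀ φ, ‖h (conjSchwartz φ)‖ₑ ≤ c * modulationNorm lam p q g (ofSchwartz φ)) →
        modulationNorm lam p' q' g h ≤ c * A := by
  have : p'.HolderConjugate p := ENNReal.HolderConjugate.symm
  have : q'.HolderConjugate q := ENNReal.HolderConjugate.symm
  obtain ⟨A, hA, hsynthesis⟩ := exists_modulationNorm_synthesis_le hlam g g
    (ENNReal.HolderConjugate.one_le p p') (ENNReal.HolderConjugate.one_le q q')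
  refine ⟨A, hA, fun h c hle => ?_⟩
  rw [modulationNorm_eq_mixedENorm]
  refine mixedENorm_le_of_forall_bounded p' p q' q (measurable_enorm_matrixCoeff hlam g h)
    (fun k => Metric.isClosed_closedBall.measurableSet) (monotone_closedBall_natCast 0)
    (Metric.iUnion_closedBall_nat 0) fun H hH k hHk => ?_
  have hfinite (z) : H z ≠ ∞ :=
    ((hHk z).trans (Set.indicator_le_self' (fun _ _ => zero_le) z)).trans_lt
      (ENNReal.natCast_lt_top k) |>.ne
  obtain ⟨F, hF_meas, hF_enorm, hphase⟩ := exists_measurable_mul_conj_eq_norm hH hfinite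
    (continuous_matrixCoeff hlam g h).measurable
  have hF_le (z) : ‖F z‖ ≤ (Metric.closedBall 0 (k : ℝ)).indicator (fun _ => (k : ℝ)) z := by
    have hz_le := (hF_enorm z).trans_le (hHk z)
    rw [← toReal_enorm]
    by_cases hz : z ∈ Metric.closedBall 0 (k : ℝ)
    · rw [Set.indicator_of_mem hz] at hz_le ⊢
      exact ENNReal.toReal_mono (ENNReal.natCast_ne_top k) hz_le
    · rw [Set.indicator_of_notMem hz] at hz_le ⊢
      rw [le_antisymm hz_le bot_le, ENNReal.toReal_zero]
  have hF : RapidlyDecreasing F := .of_norm_le_indicator hF_meas.aestronglyMeasurable hF_le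
  calc ∫⁻ z, ‖matrixCoeff lam g h z‖ₑ * H z
      = ‖h (conjSchwartz (synthesis hlam g hF))‖ₑ := by
        rw [enorm_apply_conjSchwartz_synthesis_eq hlam h hF hphase]
        simp only [hF_enorm]
    _ ≤ c * (A * mixedNorm p q F) := (hle _).trans (by gcongr; exact hsynthesis F hF hF_meas)
    _ = c * A * mixedENorm volume volume p q H := by
        rw [mixedNorm_eq_mixedENorm, mul_assoc, funext hF_enorm]

variable (hg : g ≠ 0) {hp : 1 ≤ p} {hq : 1 ≤ q}

include hlam hg in
theorem norm_modulationPairing_ofSchwartz (φ : 𝓢(Space n, ℂ)) (h : 𝓢'(Space n, ℂ)) :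
    ‖modulationPairing lam g (ofSchwartz φ) h‖ = frameConst lam g * ‖h (conjSchwartz φ)‖ := by
  rw [modulationPairing_ofSchwartz hlam, norm_mul, RCLike.norm_conj, Complex.norm_real,
    Real.norm_of_nonneg (frameConst_pos hlam hg).le]

theorem exists_modulationNorm_le_of_pairing_le (hp : 1 ≤ p) (hq : 1 ≤ q) (p' q' : ℝ≥0∞)
    [p.HolderConjugate p'] [q.HolderConjugate q'] :
    ∃ A : ℝ, 0 < A ∧ ∀ (h : 𝓢'(Space n, ℂ)) (C : ℝ), 0 ≤ C →
      (∀ φ, ‖modulationPairing lam g (ofSchwartz φ) h‖ ≤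
        C * modulationSeminorm hlam hg hp hq (schwartzInclusion n hlam hp hq φ)) →
      modulationNorm lam p' q' g h ≤ ENNReal.ofReal (A * C) := by
  obtain ⟨A, hA, hle⟩ := exists_modulationNorm_le_of_forall_ofSchwartz hlam g p p' q q'
  set κ := frameConst lam g
  have hκ : 0 < κ := frameConst_pos hlam hg
  refine ⟨κ⁻¹ * A.toReal + 1, by positivity, fun h C hC hpairing => ?_⟩
  have hbound (φ) : ‖h (conjSchwartz φ)‖ₑ ≤
      ENNReal.ofReal (κ⁻¹ * C) * modulationNorm lam p q g (ofSchwartz φ) := by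
    rw [← coe_schwartzInclusion hlam hp hq, ofReal_modulationSeminorm hlam hg,
      ← ENNReal.ofReal_mul (by positivity), ← ofReal_norm]
    refine ENNReal.ofReal_le_ofReal ?_
    rw [mul_assoc, le_inv_mul_iff₀ hκ, ← norm_modulationPairing_ofSchwartz hlam hg]
    exact hpairing φ
  calc modulationNorm lam p' q' g h ≤ ENNReal.ofReal (κ⁻¹ * C) * A := hle h _ hbound
    _ = ENNReal.ofReal (κ⁻¹ * A.toReal * C) := by
        rw [mul_right_comm, ENNReal.ofReal_mul (by positivity) (q := A.toReal),
          ENNReal.ofReal_toReal hA.ne]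
    _ ≤ ENNReal.ofReal ((κ⁻¹ * A.toReal + 1) * C) := by
        gcongr
        exact (lt_add_one _).le

theorem eq_zero_of_forall_schwartzInclusion (hp_top : p ≠ ∞) (hq_top : q ≠ ∞)
    {ℓ : modulationSubmodule n hlam hp hq →ₗ[ℂ] ℂ} {C : ℝ}
    (hℓ : ∀ f, ‖ℓ f‖ ≤ C * modulationSeminorm hlam hg hp hq f)
    (hzero : ∀ φ, ℓ (schwartzInclusion n hlam hp hq φ) = 0) : ℓ = 0 := by
  ext f
  refine norm_le_zero_iff.1 (le_of_forall_pos_le_add fun ε hε => ?_)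
  have hC : 0 < |C| + 1 := by positivity
  obtain ⟨φ, hφ⟩ := exists_modulationSeminorm_sub_schwartzInclusion_lt hlam hg hp hq hp_top hq_top f
    (div_pos hε hC)
  set S := schwartzInclusion n hlam hp hq
  set N := modulationSeminorm hlam hg hp hq
  calc ‖ℓ f‖ = ‖ℓ (f - S φ)‖ := by rw [map_sub, hzero, sub_zero]
    _ ≤ C * N (f - S φ) := hℓ _
    _ ≤ (|C| + 1) * N (f - S φ) := by
        gcongr
        exact (le_abs_self C).trans (lt_add_one _).le
    _ ≤ 0 + ε := by
        rw [zero_add, ← le_div_iff₀' hC]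
        exact hφ.le

theorem exists_modulationPairing_eq {ℓ : modulationSubmodule n hlam hp hq →ₗ[ℂ] ℂ} {C : ℝ}
    (hC : 0 ≤ C) (hℓ : ∀ f, ‖ℓ f‖ ≤ C * modulationSeminorm hlam hg hp hq f) :
    ∃ h : 𝓢'(Space n, ℂ), ∀ φ, modulationPairing lam g (ofSchwartz φ) h =
      ℓ (schwartzInclusion n hlam hp hq φ) := by
  let S := schwartzInclusion n hlam hp hq
  set κ := frameConst lam g
  have hκ : 0 < κ := frameConst_pos hlam hg
  have hκ_ne : (κ : ℂ) ≠ 0 := Complex.ofReal_ne_zero.2 hκ.ne'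
  obtain ⟨P, hP, hP_le⟩ := exists_modulationNorm_ofSchwartz_le hlam g hp hq
  have hℓ_le (φ) : ‖ℓ (S φ)‖ ≤ C * P φ := by
    refine (hℓ _).trans (mul_le_mul_of_nonneg_left ?_ hC)
    exact ENNReal.toReal_le_of_le_ofReal (apply_nonneg P φ) (hP_le φ)
  obtain ⟨Q, hQ, hQ_apply⟩ := exists_continuous_seminorm_eq_comp_conjSchwartz hP
  obtain ⟨R, hR, hR_apply⟩ :=
    exists_continuous_seminorm_eq_mul (mul_nonneg (inv_pos.2 hκ).le hC) hQ
  let T : 𝓢(Space n, ℂ) →ₗ[ℂ] ℂ :=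
    { toFun ψ := (κ : ℂ)⁻¹ * conj (ℓ (S (conjSchwartz ψ)))
      map_add' φ ψ := by
        rw [conjSchwartz_add, map_add, map_add, map_add, mul_add]
      map_smul' c φ := by
        rw [conjSchwartz_smul, map_smul, map_smul, smul_eq_mul, map_mul, Complex.conj_conj,
          RingHom.id_apply, smul_eq_mul, mul_left_comm] }
  have hT_le (ψ) : ‖T ψ‖ ≤ R ψ := by
    change ‖(κ : ℂ)⁻¹ * conj (ℓ (S (conjSchwartz ψ)))‖ ≤ R ψ
    rw [norm_mul, RCLike.norm_conj, norm_inv, Complex.norm_real, Real.norm_of_nonneg hκ.le,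
      hR_apply, hQ_apply, mul_assoc]
    exact mul_le_mul_of_nonneg_left (hℓ_le _) (inv_pos.2 hκ).le
  obtain ⟨h, hh⟩ := exists_distribution_eq_of_norm_le T hR hT_le
  refine ⟨h, fun φ => ?_⟩
  rw [modulationPairing_ofSchwartz hlam, hh]
  change (κ : ℂ) * conj ((κ : ℂ)⁻¹ * conj (ℓ (S (conjSchwartz (conjSchwartz φ))))) = _
  rw [conjSchwartz_conjSchwartz, map_mul, Complex.conj_conj, map_inv₀, Complex.conj_ofReal,
    mul_inv_cancel_left₀ hκ_ne]

include hlam hg in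
theorem eq_of_forall_modulationPairing_ofSchwartz_eq {h₁ h₂ : 𝓢'(Space n, ℂ)}
    (heq : ∀ φ, modulationPairing lam g (ofSchwartz φ) h₁ =
      modulationPairing lam g (ofSchwartz φ) h₂) : h₁ = h₂ := by
  ext ψ
  have hψ := heq (conjSchwartz ψ)
  rw [modulationPairing_ofSchwartz hlam, modulationPairing_ofSchwartz hlam,
    conjSchwartz_conjSchwartz] at hψ
  exact (starRingEnd ℂ).injective
    (mul_left_cancel₀ (Complex.ofReal_ne_zero.2 (frameConst_pos hlam hg).ne') hψ)

variable (p' q' : ℝ≥0∞) [p.HolderConjugate p'] [q.HolderConjugate q']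

include hg in
theorem integrable_pairingIntegrand (f : modulationSubmodule n hlam hp hq) {h : 𝓢'(Space n, ℂ)}
    (hh : modulationNorm lam p' q' g h < ∞) : Integrable (pairingIntegrand lam g f h) := by
  refine ⟨Continuous.aestronglyMeasurable ?_, ?_⟩
  · exact (continuous_matrixCoeff hlam g f).mul
      (Complex.continuous_conj.comp (continuous_matrixCoeff hlam g h))
  · exact (lintegral_pairingIntegrand_le hlam g p p' q q' f h).trans_lt
      (ENNReal.mul_lt_top (modulationNorm_coe_lt_top hlam hg f) hh)

theorem norm_modulationPairing_le (f : modulationSubmodule n hlam hp hq) {h : 𝓢'(Space n, ℂ)}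
    (hh : modulationNorm lam p' q' g h < ∞) :
    ‖modulationPairing lam g f h‖ ≤
      (modulationNorm lam p' q' g h).toReal * modulationSeminorm hlam hg hp hq f := by
  change _ ≤ _ * (modulationNorm lam p q g f).toReal
  rw [mul_comm, ← ENNReal.toReal_mul, ← toReal_enorm]
  exact ENNReal.toReal_mono (ENNReal.mul_lt_top (modulationNorm_coe_lt_top hlam hg f) hh).ne
    (enorm_modulationPairing_le hlam g p p' q q' f h)

/-- The linear functional `f ↦ ⟨f, h⟩_λ` on `M_λ^{p,q}` for `h ∈ M_λ^{p',q'}`. -/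
noncomputable def pairingFunctional {h : 𝓢'(Space n, ℂ)}
    (hh : modulationNorm lam p' q' g h < ∞) : modulationSubmodule n hlam hp hq →ₗ[ℂ] ℂ where
  toFun f := modulationPairing lam g f h
  map_add' f₁ f₂ := by
    rw [modulationPairing, modulationPairing, modulationPairing,
      ← integral_add (integrable_pairingIntegrand hlam hg p' q' f₁ hh)
        (integrable_pairingIntegrand hlam hg p' q' f₂ hh)]
    simp only [pairingIntegrand, Submodule.coe_add, matrixCoeff_add, add_mul]
  map_smul' c f := by
    rw [modulationPairing, modulationPairing, RingHom.id_apply, smul_eq_mul, ← integral_const_mul]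
    simp only [pairingIntegrand, Submodule.coe_smul, matrixCoeff_smul, mul_assoc]

theorem existsUnique_modulationPairing_eq (hp_top : p ≠ ∞) (hq_top : q ≠ ∞)
    {ℓ : modulationSubmodule n hlam hp hq →ₗ[ℂ] ℂ} {C : ℝ}
    (hℓ : ∀ f, ‖ℓ f‖ ≤ C * modulationSeminorm hlam hg hp hq f) :
    ∃! h : 𝓢'(Space n, ℂ), modulationNorm lam p' q' g h < ∞ ∧
      ∀ f : modulationSubmodule n hlam hp hq, ℓ f = modulationPairing lam g f h := by
  have hℓ_abs (f) : ‖ℓ f‖ ≤ |C| * modulationSeminorm hlam hg hp hq f :=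
    (hℓ f).trans (mul_le_mul_of_nonneg_right (le_abs_self C) (apply_nonneg _ f))
  obtain ⟨h, hh⟩ := exists_modulationPairing_eq hlam hg (abs_nonneg C) hℓ_abs
  obtain ⟨A, -, hnorm⟩ := exists_modulationNorm_le_of_pairing_le hlam hg hp hq p' q'
  have hh_finite : modulationNorm lam p' q' g h < ∞ :=
    (hnorm h |C| (abs_nonneg C) fun φ => by
      rw [hh]
      exact hℓ_abs _).trans_lt ENNReal.ofReal_lt_top
  refine ⟨h, ⟨hh_finite, ?_⟩, fun h₂ hh₂ =>
    eq_of_forall_modulationPairing_ofSchwartz_eq hlam hg fun φ =>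
      (hh₂.2 (schwartzInclusion n hlam hp hq φ)).symm.trans (hh φ).symm⟩
  let D := pairingFunctional (hp := hp) (hq := hq) hlam hg p' q' hh_finite
  have hdiff : ℓ - D = 0 := by
    refine eq_zero_of_forall_schwartzInclusion (C := C + (modulationNorm lam p' q' g h).toReal)
      hlam hg hp_top hq_top (fun f => ?_) fun φ => sub_eq_zero.2 (hh φ).symm
    rw [add_mul]
    exact (norm_sub_le _ _).trans
      (add_le_add (hℓ f) (norm_modulationPairing_le hlam hg p' q' f hh_finite))
  exact fun f => LinearMap.congr_fun (sub_eq_zero.1 hdiff) f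

theorem isDualUnderPairing (hp_top : p ≠ ∞) (hq_top : q ≠ ∞) :
    IsDualUnderPairing lam g (modulationSubmodule n hlam hp hq)
      (modulationSeminorm hlam hg hp hq) (twistedModulationSpace n lam p' q')
      (modulationNorm lam p' q' g) := by
  have : p'.HolderConjugate p := ENNReal.HolderConjugate.symm
  have : q'.HolderConjugate q := ENNReal.HolderConjugate.symm
  have hmem (h : 𝓢'(Space n, ℂ)) :
      h ∈ twistedModulationSpace n lam p' q' ↔ modulationNorm lam p' q' g h < ∞ :=
    mem_twistedModulationSpace_iff hlam (ENNReal.HolderConjugate.one_le p' p)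
      (ENNReal.HolderConjugate.one_le q' q) hg
  refine ⟨fun h hh => ?_, ?_, ?_⟩
  · rw [hmem] at hh
    exact ⟨pairingFunctional hlam hg p' q' hh, fun f =>
      ⟨integrable_pairingIntegrand hlam hg p' q' f hh, rfl,
        norm_modulationPairing_le hlam hg p' q' f hh⟩⟩
  · rintro ℓ ⟨C, hℓ⟩
    simpa only [hmem] using existsUnique_modulationPairing_eq hlam hg p' q' hp_top hq_top hℓ
  · obtain ⟨A, hA, hle⟩ := exists_modulationNorm_le_of_pairing_le hlam hg hp hq p' q'
    exact ⟨A, hA, fun h _ C hC hpairing => hle h C hC fun φ =>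
      hpairing (schwartzInclusion n hlam hp hq φ)⟩

end Duality

end TwistedMod

theorem mainTheorem3 (n : ℕ) (lam : ℝ) (hlam : lam ≠ 0) :
    (∀ p q : ℝ≥0∞, 1 ≤ p → 1 ≤ q →
      ∃ M : Submodule ℂ 𝓢'(Space n, ℂ),
        (M : Set 𝓢'(Space n, ℂ)) = twistedModulationSpace n lam p q ∧
        ∀ g : 𝓢(Space n, ℂ), g ≠ 0 →
          ∃ N : Seminorm ℂ M,
            (∀ f : M, modulationNorm lam p q g (f : 𝓢'(Space n, ℂ)) = ENNReal.ofReal (N f)) ∧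
            IsBanachNorm N ∧
            (p ≠ ∞ → q ≠ ∞ →
              ((∀ φ : 𝓢(Space n, ℂ), ofSchwartz φ ∈ M) ∧
                ∀ f : M, ∀ ε : ℝ, 0 < ε →
                  ∃ φ : 𝓢(Space n, ℂ), ∃ hφ : ofSchwartz φ ∈ M, N (f - ⟨ofSchwartz φ, hφ⟩) < ε) ∧
              ∀ p' q' : ℝ≥0∞, p.HolderConjugate p' → q.HolderConjugate q' →
                IsDualUnderPairing lam g M N (twistedModulationSpace n lam p' q')
                  (modulationNorm lam p' q' g))) ∧
    (∀ p₁ q₁ p₂ q₂ : ℝ≥0∞, 1 ≤ p₁ → p₁ ≤ p₂ → 1 ≤ q₁ → q₁ ≤ q₂ →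
      twistedModulationSpace n lam p₁ q₁ ⊆ twistedModulationSpace n lam p₂ q₂) := by
  refine ⟨fun p q hp hq => ⟨modulationSubmodule n hlam hp hq, rfl, fun g hg =>
    ⟨modulationSeminorm hlam hg hp hq, ofReal_modulationSeminorm hlam hg,
      isBanachNorm_modulationSeminorm hlam hg hp hq, fun hp_top hq_top =>
        ⟨⟨ofSchwartz_mem_modulationSubmodule hlam hp hq, ?_⟩, ?_⟩⟩⟩, ?_⟩
  · intro f ε hε
    obtain ⟨φ, hφ⟩ := exists_modulationSeminorm_sub_schwartzInclusion_lt hlam hg hp hq hp_top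
      hq_top f hε
    exact ⟨φ, ofSchwartz_mem_modulationSubmodule hlam hp hq φ, hφ⟩
  · intro p' q' _ _
    exact isDualUnderPairing hlam hg p' q' hp_top hq_top
  · rintro p₁ q₁ p₂ q₂ hp₁ hp hq₁ hq f ⟨g, hg, -, hf⟩
    obtain ⟨C, hC, hle⟩ := exists_modulationNorm_le hlam hg g hp₁ hq₁ hp hq
    exact (mem_twistedModulationSpace_iff hlam (hp₁.trans hp) (hq₁.trans hq) hg).2
      ((hle f).trans_lt (ENNReal.mul_lt_top hC hf))
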